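/- **Setting.** For a multiset $L$ of integers $\ge 3$, let $[L]$ denote the simple $2$-regular graph that is the vertex-disjoint union of cycles whose lengths are the members of $L$ (with multiplicity). Here ${}^2\ell$ stands for two copies of $\ell$. Let $F$ be a simple $2$-regular graph of order $v$ and let $\sigma\in\{-1,0,1\}$ with $v-1\equiv\sigma \pmod 2$ (so $\sigma=0$ if $v$ is odd, and $\sigma\in\{-1,1\}$ may be chosen freely if $v$ is even). Let $(K_v)^{\sigma}$ be $K_v-J$, $K_v$ or $K_v+J$ according to whether $\sigma=-1,0,1$, where $J$ is a $1$-factor of $K_v$ (in $K_v+J$ the edges of $J$ have multiplicity $2$). A *solution to $OP^{\sigma}(F)$* is a set $\mathcal S$ of spanning subgraphs of $(K_v)^\sigma$, each isomorphic to $F$, whose edge sets partition the edge multiset of $(K_v)^\sigma$. It is *$f$-pyramidal* if there is a group $G$ of permutations of the $v$ vertices, each mapping $\mathcal S$ to itself, that fixes $f$ vertices and acts sharply transitively on the remaining $v-f$ vertices. (A $1$-pyramidal solution is also called $1$-rotational, and a $0$-pyramidal one regular.) **Theorem.** Let $s\ge r\ge 0$ and let $F=[h, 2\ell_1,\ldots,2\ell_r,{}^2\ell_{r+1},\ldots,{}^2\ell_s]$,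 where $2\le \ell_1<\ell_2<\cdots<\ell_r$ and $h,\ell_{r+1},\ldots,\ell_s\ge 3$. Let $I=\{i : 1\le i\le s,\ \ell_i>2,\ \ell_i \text{ even}\}$ and put $$h_0 = 2|I|\max\{\ell_i+3 : i\in I\}-1,\qquad h_1 = 7^{\,s-|I|-1}\max\{2\ell_i+1 : 1\le i\le s,\ i\notin I,\ \ell_i\ne 2\},$$ where the maximum of the empty set is $0$. If $$h>16\max(1,h_0)+20\max(3,h_1)+29,$$ then for every $\sigma\in\{-1,0,1\}$ with $v-1\equiv\sigma\pmod 2$, where $v$ is the order of $F$, the problem $OP^\sigma(F)$ has a $(1-\sigma)$-pyramidal solution. That is, it has a $1$-rotational solution (a factorization of $K_v$) if $v$ is odd, and if $v$ is even it has both a $2$-pyramidal solution to the packing version (a factorization of $K_v-J$ for some $1$-factor $J$) and a regular solution to the covering version (a factorization of $K_v+J$ for some $1$-factor $J$). -/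

import Mathlib

/-- The vertex-disjoint union of cycles, one cycle of length `l i` for each index `i`. -/
def cycleUnion {ι : Type*} (l : ι → ℕ) : SimpleGraph (Σ i, Fin (l i)) :=
  ⨆ i, (SimpleGraph.cycleGraph (l i)).map (Function.Embedding.sigmaMk i)

/-- `F` is the graph `[L]`, the simple 2-regular graph whose cycles have as lengths the members
of the multiset `L`, counted with multiplicity.  Used only when all members of `L` are `≥ 3`. -/
def IsCycleGraphOf {V : Type*} (F : SimpleGraph V) (L : Multiset ℕ) : Prop :=
  ∃ M : List ℕ, (M : Multiset ℕ) = L ∧ Nonempty (F ≃g cycleUnion M.get)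

/-- The multiset of cycle lengths
`{h, 2 ℓ 1, …, 2 ℓ r, ℓ (r+1), ℓ (r+1), …, ℓ s, ℓ s}` of a single-flip 2-regular graph. -/
def singleFlipLengths (h r s : ℕ) (ℓ : ℕ → ℕ) : Multiset ℕ :=
  {h} + (Finset.Icc 1 r).val.map (fun i => 2 * ℓ i) + 2 • (Finset.Icc (r + 1) s).val.map ℓ

/-- The set `I` of those `i` in `{1, …, s}` with `ℓ i > 2` and `ℓ i` even. -/
def evenIndices (s : ℕ) (ℓ : ℕ → ℕ) : Finset ℕ :=
  {i ∈ Finset.Icc 1 s | 2 < ℓ i ∧ Even (ℓ i)}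

/-- The integer `h₀ = 2 |I| max {ℓ i + 3 | i ∈ I} - 1`, where the maximum of the empty set is `0`. -/
def boundEven (s : ℕ) (ℓ : ℕ → ℕ) : ℤ :=
  2 * ((evenIndices s ℓ).card : ℤ) * ((evenIndices s ℓ).sup (fun i => ℓ i + 3) : ℕ) - 1

/-- The integer `h₁ = 7 ^ (s - |I| - 1) max {2 ℓ i + 1 | i ∉ I, ℓ i ≠ 2}`, where the maximum of the
empty set is `0`.  When the set is nonempty, `|I| < s`, so the exponent is not truncated;
otherwise `h₁ = 0` whatever the exponent. -/
def boundOdd (s : ℕ) (ℓ : ℕ → ℕ) : ℤ :=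
  7 ^ (s - (evenIndices s ℓ).card - 1) *
    (({i ∈ Finset.Icc 1 s | i ∉ evenIndices s ℓ ∧ ℓ i ≠ 2}).sup (fun i => 2 * ℓ i + 1) : ℕ)

/-- `J` is (the edge set of) a 1-factor of the complete graph on `V`: every vertex lies on exactly
one edge of `J`. -/
def IsOneFactor {V : Type*} (J : SimpleGraph V) : Prop :=
  ∀ v, ∃! w, J.Adj v w

open Classical in
/-- The multiplicity of `e` in the graph obtained from the complete graph on `V` by adding `σ`
copies of every edge of `J`: this is `K_v - J`, `K_v`, `K_v + J` for `σ = -1, 0, 1`. -/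
noncomputable def edgeMult {V : Type*} (σ : ℤ) (J : SimpleGraph V) (e : Sym2 V) : ℤ :=
  (if e ∈ (⊤ : SimpleGraph V).edgeSet then 1 else 0) + σ * (if e ∈ J.edgeSet then 1 else 0)

/-- `S` is a solution to `OP^σ(F)` on the vertex set `V`: a set of spanning subgraphs, all isomorphic
to `F`, whose edge sets partition the edge multiset of `K_v - J`, `K_v` or `K_v + J` according to
`σ = -1, 0, 1`, for some 1-factor `J` (there is no 1-factor involved when `σ = 0`). -/
def IsOPSolution {W V : Type*} (σ : ℤ) (F : SimpleGraph W) (S : Finset (SimpleGraph V)) : Prop :=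
  (∀ G ∈ S, Nonempty (G ≃g F)) ∧
  ∃ J : SimpleGraph V, (σ ≠ 0 → IsOneFactor J) ∧
    ∀ e : Sym2 V, (({G : SimpleGraph V | G ∈ S ∧ e ∈ G.edgeSet}.ncard : ℕ) : ℤ) = edgeMult σ J e

/-- `S` is `f`-pyramidal: some group `A` of permutations of `V`, each of which maps factors in `S`
to factors in `S`, fixes `f` vertices and acts sharply transitively on the remaining ones. -/
def IsPyramidal {V : Type*} (f : ℕ) (S : Finset (SimpleGraph V)) : Prop :=
  ∃ A : Subgroup (Equiv.Perm V),
    (∀ g ∈ A, ∀ G ∈ S, G.map g.toEmbedding ∈ S) ∧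
    ∃ X : Finset V, X.card = f ∧
      (∀ g ∈ A, ∀ x ∈ X, g x = x) ∧
      (∀ x ∉ X, ∀ y ∉ X, ∃! g : Equiv.Perm V, g ∈ A ∧ g x = y)

/-!
Let `f = 1 - σ`.  The vertices are taken to be the elements of `ℤ / 2n` and `f` fixed points, and a
solution is obtained by translating one *starter factor* that is invariant under translation by `n`.
It has exactly `n` distinct translates, which form a solution as soon as the starter contains every
difference `d` with `0 < d < n`, an edge from every fixed point to `ℤ / 2n`, and enough edges
`{p, p + n}` (none, one or two): these conditions show that every edge of `K_v + σ J` is covered at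
least as often as its multiplicity demands, and as the numbers of edges agree, it is covered exactly
so often (`cover_eq_edgeMult`, `exists_solution_of_starter`).

A starter is the union of a *half system* (`HalfSystem`) and its translate by `n`.  A half system
consists of a path, which is joined to its translate at both ends, directly or through a fixed point,
to form the cycle of length `h`; of lists which are joined to their translates, to form the cycles of
length `2 ℓ i` for `i ≤ r`; and of closed lists, which with their translates form the pairs of cycles
of length `ℓ i` for `i > r`.  Everything reduces to finding a half system in which each difference
between `1` and `n - 1` occurs (`HalfSystem.exists_solution`).

Half systems come from graceful labellings, with labels `0, …, n - 1`, of the disjoint union of a long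
path and of cycles of lengths `ℓ i` (`Grace`).  Such a labelling has every difference once, but all its
cycles are closed.  To join a cycle with closing difference `g` to its translate by `n` changes this
difference into `n - g`.  If the differences in the cycles are all less than `n / 2`, then `n - g`
is the difference of an edge of the path, and moving a part of the path by `n` changes that edge into
one of difference `g` (`HalfSystem.of_lists`).  A cycle of length `4` arises from a component that is
a single edge and whose closing difference `n - d` is not otherwise used (`GraceEdge`).

The labellings are built from the inside out.  The basic objects are *blocks* (`Blk`): bipartite
labellings of a path and some cycles, all of whose edges cross the threshold `0`.  A block can be
nested in another one, since moving the two sides of the threshold apart by `q` increases all the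
differences by `2 q`, and a block can surround any labelling (a *core*, `Core`) whose path starts at
the right vertex.  Blocks with a path only exist for every position of the ends of the path
(`Blk.path`), and explicit zigzags give a block around any even cycle (`Alpha.exists_even`).  An odd
cycle is not bipartite.  It is obtained from an even cycle in a block, opened at an edge: the resulting
path is closed by a new vertex below the core (`Grace.odd_cycle`).  Each such step multiplies the
number of vertices by at most `14 / 3`, whence the powers of `7` in the bound.  Blocks with a path
only then enlarge the labelling to the desired number of vertices (`Grace.exists`,
`GraceEdge.exists`).
-/

/-! ### Multisets of consecutive integers -/

/-- The multiset of the integers `t` with `a ≤ t < b`. -/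
noncomputable def iv (a b : ℤ) : Multiset ℤ := (Finset.Ico a b).val

/-- The indicator of `a ≤ t`.  Counting `t` in `iv a b` gives `stp t a - stp t b`, so that an
identity between unions of intervals becomes a linear identity between values of `stp t`. -/
def stp (t a : ℤ) : ℤ := if a ≤ t then 1 else 0

lemma count_iv {a b : ℤ} (t : ℤ) (h : a ≤ b) :
    ((iv a b).count t : ℤ) = stp t a - stp t b := by
  unfold iv stp
  rw [Multiset.count_eq_of_nodup (Finset.nodup _)]
  simp
  split_ifs <;> omega

lemma count_sing (a t : ℤ) :
    ((Multiset.count t {a} : ℕ) : ℤ) = stp t a - stp t (a + 1) := by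
  unfold stp
  rw [Multiset.count_singleton]
  split_ifs <;> omega

lemma ms_ext {A B : Multiset ℤ} (h : ∀ t, (A.count t : ℤ) = B.count t) : A = B := by
  ext t
  exact_mod_cast h t

lemma mem_iv {a b t : ℤ} : t ∈ iv a b ↔ a ≤ t ∧ t < b := by
  simp [iv]

lemma nodup_iv (a b : ℤ) : (iv a b).Nodup := Finset.nodup _

lemma card_iv {a b : ℤ} (h : a ≤ b) : ((iv a b).card : ℤ) = b - a := by
  simp [iv]
  omega

lemma iv_self (a : ℤ) : iv a a = 0 := by simp [iv]

lemma iv_single (a : ℤ) : iv a (a + 1) = {a} := by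
  refine ms_ext fun t => ?_
  simp (discharger := omega) only [count_iv, count_sing]

lemma iv_add {a b c : ℤ} (h : a ≤ b) (h' : b ≤ c) : iv a b + iv b c = iv a c := by
  refine ms_ext fun t => ?_
  simp (discharger := omega) only [Multiset.count_add, Nat.cast_add, count_iv]
  ring

lemma map_add_iv (a b c : ℤ) : (iv a b).map (· + c) = iv (a + c) (b + c) := by
  refine Multiset.Nodup.ext ((nodup_iv a b).map (add_left_injective c)) (nodup_iv _ _) |>.2 ?_
  intro t
  simp only [Multiset.mem_map, mem_iv]
  constructor
  · rintro ⟨x, hx, rfl⟩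
    omega
  · intro h
    exact ⟨t - c, by omega, by omega⟩

lemma map_sub_iv (a b c : ℤ) : (iv a b).map (fun x => c - x) = iv (c - b + 1) (c - a + 1) := by
  refine Multiset.Nodup.ext ((nodup_iv a b).map (sub_right_injective)) (nodup_iv _ _) |>.2 ?_
  intro t
  simp only [Multiset.mem_map, mem_iv]
  constructor
  · rintro ⟨x, hx, rfl⟩
    omega
  · intro h
    exact ⟨c - t, by omega, by omega⟩

/-! ### Strands: paths with prescribed vertices and differences -/

/-- The multiset of absolute differences of consecutive members of a list. -/
def steps : List ℤ → Multiset ℤ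
  | a :: b :: l => |b - a| ::ₘ steps (b :: l)
  | _ => 0

@[simp] lemma steps_nil : steps [] = 0 := rfl

@[simp] lemma steps_single (a : ℤ) : steps [a] = 0 := rfl

@[simp] lemma steps_cons (a b : ℤ) (l : List ℤ) :
    steps (a :: b :: l) = |b - a| ::ₘ steps (b :: l) := rfl

lemma steps_append {l₁ l₂ : List ℤ} {b c : ℤ} (h₁ : l₁.getLast? = some b)
    (h₂ : l₂.head? = some c) : steps (l₁ ++ l₂) = steps l₁ + {|c - b|} + steps l₂ := by
  induction l₁ with
  | nil => simp at h₁
  | cons x l ih =>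
    cases l with
    | nil =>
      cases l₂ with
      | nil => simp at h₂
      | cons y l' =>
        simp at h₁ h₂
        subst h₁ h₂
        simp [Multiset.singleton_add]
    | cons y l =>
      have := ih (by simpa using h₁)
      simp only [List.cons_append, steps_cons] at this ⊢
      rw [this]
      simp [Multiset.cons_add]

lemma steps_reverse (l : List ℤ) : steps l.reverse = steps l := by
  induction l with
  | nil => rfl
  | cons x l ih =>
    cases l with
    | nil => rfl
    | cons y l =>
      rw [List.reverse_cons, steps_append (b := y) (c := x) (by simp) (by simp), ih, steps_cons,
        steps_single, add_zero, abs_sub_comm, add_comm, Multiset.singleton_add]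

lemma steps_map {R : ℤ → ℤ → Prop} {f g : ℤ → ℤ}
    (h : ∀ x y, R x y → |f y - f x| = g |y - x|) {l : List ℤ} (hl : l.IsChain R) :
    steps (l.map f) = (steps l).map g := by
  induction l with
  | nil => rfl
  | cons x l ih =>
    cases l with
    | nil => rfl
    | cons y l =>
      rw [List.isChain_cons_cons] at hl
      have := ih hl.2
      simp only [List.map_cons, steps_cons, Multiset.map_cons] at this ⊢
      rw [this, h x y hl.1]

/-- There is a path from `a` to `b` with vertex multiset `V` and multiset of differences `D`, all
of whose edges satisfy `R`. -/
def Str (R : ℤ → ℤ → Prop) (a b : ℤ) (V D : Multiset ℤ) : Prop :=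
  ∃ l : List ℤ, l.IsChain R ∧ l.head? = some a ∧ l.getLast? = some b ∧ (l : Multiset ℤ) = V ∧
    steps l = D

/-- The two vertices lie on different sides of the threshold `0`. -/
def Crs (x y : ℤ) : Prop := x < 0 ↔ 0 ≤ y

/-- The relation that always holds. -/
def Any (_ _ : ℤ) : Prop := True

lemma Crs.symm {x y : ℤ} (h : Crs x y) : Crs y x := by
  unfold Crs at *
  omega

namespace Str

variable {R R' : ℤ → ℤ → Prop} {a b c d : ℤ} {V V' D D' : Multiset ℤ}

lemma single (R : ℤ → ℤ → Prop) (a : ℤ) : Str R a a {a} 0 :=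
  ⟨[a], by simp, by simp, by simp, by simp, by simp⟩

lemma append (h : Str R a b V D) (h' : Str R c d V' D') (hbc : R b c) :
    Str R a d (V + V') (D + {|c - b|} + D') := by
  obtain ⟨l, hl, ha, hb, rfl, rfl⟩ := h
  obtain ⟨l', hl', hc, hd, rfl, rfl⟩ := h'
  refine ⟨l ++ l', ?_, ?_, ?_, ?_, steps_append hb hc⟩
  · refine List.isChain_append.2 ⟨hl, hl', ?_⟩
    simp [hb, hc, hbc]
  · simp [List.head?_append, ha]
  · simp [List.getLast?_append, hd]
  · simp

lemma of_eq (h : Str R a b V D) (hV : V = V') (hD : D = D') : Str R a b V' D' := by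
  subst hV hD
  exact h

lemma cast {a' b' : ℤ} (h : Str R a b V D) (ha : a = a') (hb : b = b') (hV : V = V')
    (hD : D = D') : Str R a' b' V' D' := by
  subst ha hb hV hD
  exact h

lemma reverse (hR : ∀ x y, R x y → R y x) (h : Str R a b V D) : Str R b a V D := by
  obtain ⟨l, hl, ha, hb, rfl, rfl⟩ := h
  refine ⟨l.reverse, ?_, ?_, ?_, ?_, steps_reverse l⟩
  · rw [List.isChain_reverse]
    exact hl.imp fun x y h => hR _ _ h
  · simpa using hb
  · simpa using ha
  · simp

lemma map {f g : ℤ → ℤ} (h : Str R a b V D)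
    (hf : ∀ x y, R x y → R' (f x) (f y) ∧ |f y - f x| = g |y - x|) :
    Str R' (f a) (f b) (V.map f) (D.map g) := by
  obtain ⟨l, hl, ha, hb, rfl, rfl⟩ := h
  refine ⟨l.map f, ?_, ?_, ?_, ?_, steps_map (fun x y h => (hf x y h).2) hl⟩
  · rw [List.isChain_map]
    exact hl.imp fun x y h => (hf _ _ h).1
  · simp [ha]
  · simp [hb]
  · simp

lemma shift (h : Str Any a b V D) (c : ℤ) :
    Str Any (a + c) (b + c) (V.map (· + c)) D := by
  have := h.map (R' := Any) (f := (· + c)) (g := id)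
    (fun x y _ => ⟨trivial, by simp⟩)
  simpa using this

lemma refl (h : Str Any a b V D) (c : ℤ) :
    Str Any (c - a) (c - b) (V.map (fun x => c - x)) D := by
  have := h.map (R' := Any) (f := fun x => c - x) (g := id)
    (fun x y _ => ⟨trivial, by rw [id, abs_sub_comm]; congr 1; ring⟩)
  simpa using this

/-- The zigzag `x, y, x + 1, y - 1, …` with `2 * k + 2` vertices. -/
lemma zig_even {x y : ℤ} {k : ℕ}
    (hR : ∀ u v, x ≤ u → u ≤ x + k → y - k ≤ v → v ≤ y → R u v ∧ R v u)
    (h : x + k ≤ y - k ∨ y < x) :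
    Str R x (y - k) (iv x (x + k + 1) + iv (y - k) (y + 1))
      (if x + k ≤ y - k then iv (y - x - 2 * k) (y - x + 1) else iv (x - y) (x - y + 2 * k + 1)) := by
  induction k with
  | zero =>
    have := (single R x).append (single R y) (hR x y (by simp) (by simp) (by simp) (by simp)).1
    simp only [Nat.cast_zero, add_zero, sub_zero, zero_add, mul_zero] at this h ⊢
    refine this.of_eq (by rw [iv_single, iv_single]) ?_
    split_ifs with h1
    · rw [abs_of_nonneg (by omega), iv_single]
    · rw [abs_of_nonpos (by omega), ← iv_single]
      congr 1 <;> ring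
  | succ k ih =>
    have h0 := ih (fun u v h1 h2 h3 h4 => hR u v h1 (by push_cast; omega) (by push_cast; omega) h4)
      (by push_cast at h; omega)
    have h1 := (h0.append (single R (x + k + 1))
      (hR (x + k + 1) (y - k) (by omega) (by push_cast; omega) (by push_cast; omega) (by omega)).2).append
      (single R (y - k - 1))
      (hR _ _ (by omega) (by push_cast; omega) (by push_cast; omega) (by omega)).1
    push_cast at h ⊢
    rw [show y - ((k : ℤ) + 1) = y - k - 1 by ring]
    refine h1.of_eq ?_ ?_
    · refine ms_ext fun t => ?_
      simp (discharger := omega) only [Multiset.count_add, Nat.cast_add, count_iv, count_sing]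
      ring_nf
    · split_ifs with h2 h3 h3
      · rw [abs_of_nonpos (by omega), abs_of_nonneg (by omega)]
        refine ms_ext fun t => ?_
        simp (discharger := omega) only [Multiset.count_add, Nat.cast_add, count_iv, count_sing,
          Multiset.count_zero, Nat.cast_zero]
        ring_nf
      · omega
      · omega
      · rw [abs_of_nonneg (by omega), abs_of_nonpos (by omega)]
        refine ms_ext fun t => ?_
        simp (discharger := omega) only [Multiset.count_add, Nat.cast_add, count_iv, count_sing,
          Multiset.count_zero, Nat.cast_zero]
        ring_nf

/-- The zigzag `x, y, x + 1, y - 1, …` on `k` lower and `k` upper vertices, with decreasing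
differences. -/
lemma zig_in {x y k : ℤ} (hk : 1 ≤ k) (h : x + k ≤ y - k + 2)
    (hR : ∀ u v, x ≤ u → u < x + k → y - k < v → v ≤ y → R u v ∧ R v u) :
    Str R x (y - k + 1) (iv x (x + k) + iv (y - k + 1) (y + 1))
      (iv (y - x - 2 * k + 2) (y - x + 1)) := by
  obtain ⟨n, rfl⟩ : ∃ n : ℕ, k = n + 1 := ⟨(k - 1).toNat, by omega⟩
  have := zig_even (R := R) (x := x) (y := y) (k := n)
    (fun u v h1 h2 h3 h4 => hR u v h1 (by omega) (by omega) h4) (by omega)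
  rw [if_pos (by omega)] at this
  convert this using 2 <;> ring_nf

/-- The zigzag `x, y, x + 1, y - 1, …` starting with `y < x`, with increasing differences. -/
lemma zig_out {x y k : ℤ} (hk : 1 ≤ k) (h : y < x)
    (hR : ∀ u v, x ≤ u → u < x + k → y - k < v → v ≤ y → R u v ∧ R v u) :
    Str R x (y - k + 1) (iv x (x + k) + iv (y - k + 1) (y + 1))
      (iv (x - y) (x - y + 2 * k - 1)) := by
  obtain ⟨n, rfl⟩ : ∃ n : ℕ, k = n + 1 := ⟨(k - 1).toNat, by omega⟩
  have := zig_even (R := R) (x := x) (y := y) (k := n)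
    (fun u v h1 h2 h3 h4 => hR u v h1 (by omega) (by omega) h4) (by omega)
  rw [if_neg (by omega)] at this
  convert this using 2 <;> ring_nf

/-- The zigzag `x, y, x - 1, y + 1, …` with `x < y`, with increasing differences. -/
lemma zag_out {x y k : ℤ} (hk : 1 ≤ k) (h : x < y)
    (hR : ∀ u v, x - k < u → u ≤ x → y ≤ v → v < y + k → R u v ∧ R v u) :
    Str R x (y + k - 1) (iv (x - k + 1) (x + 1) + iv y (y + k))
      (iv (y - x) (y - x + 2 * k - 1)) := by
  have h0 := zig_out (R := fun u v => R (-u) (-v)) (x := -x) (y := -y) hk (by omega)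
    (fun u v h1 h2 h3 h4 => hR (-u) (-v) (by omega) (by omega) (by omega) (by omega))
  have := h0.map (R' := R) (f := fun u => 0 - u) (g := id) (fun x y h =>
    ⟨by simpa using h, by rw [id, abs_sub_comm]; congr 1; ring⟩)
  simp only [Multiset.map_add, map_sub_iv, Multiset.map_id] at this
  exact this.cast (by ring) (by ring)
    (congrArg₂ _ (congrArg₂ _ (by ring) (by ring)) (congrArg₂ _ (by ring) (by ring)))
    (congrArg₂ _ (by ring) (by ring))

/-- The zigzag `x, y, x - 1, y + 1, …` with `x > y`, with decreasing differences. -/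
lemma zag_in {x y k : ℤ} (hk : 1 ≤ k) (h : y + k ≤ x - k + 2)
    (hR : ∀ u v, x - k < u → u ≤ x → y ≤ v → v < y + k → R u v ∧ R v u) :
    Str R x (y + k - 1) (iv (x - k + 1) (x + 1) + iv y (y + k))
      (iv (x - y - 2 * k + 2) (x - y + 1)) := by
  have h0 := zig_in (R := fun u v => R (-u) (-v)) (x := -x) (y := -y) hk (by omega)
    (fun u v h1 h2 h3 h4 => hR (-u) (-v) (by omega) (by omega) (by omega) (by omega))
  have := h0.map (R' := R) (f := fun u => 0 - u) (g := id) (fun x y h =>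
    ⟨by simpa using h, by rw [id, abs_sub_comm]; congr 1; ring⟩)
  simp only [Multiset.map_add, map_sub_iv, Multiset.map_id] at this
  exact this.cast (by ring) (by ring)
    (congrArg₂ _ (congrArg₂ _ (by ring) (by ring)) (congrArg₂ _ (by ring) (by ring)))
    (congrArg₂ _ (by ring) (by ring))

end Str

/-! ### Blocks, cores and their compositions -/

/-- The map moving the two sides of the threshold `0` away from it by `q`. -/
def infl (q x : ℤ) : ℤ := if x < 0 then x - q else x + q

/-- The map moving the upper side of the threshold `0` up by `m`. -/
def lift (m x : ℤ) : ℤ := if x < 0 then x else x + m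

lemma Crs.infl {q x y : ℤ} (hq : 0 ≤ q) (h : Crs x y) :
    Crs (infl q x) (infl q y) ∧ |_root_.infl q y - _root_.infl q x| = |y - x| + 2 * q := by
  unfold Crs _root_.infl at *
  by_cases hx : x < 0
  · have hy := h.1 hx
    rw [if_pos hx, if_neg (by omega), abs_of_nonneg (by omega), abs_of_nonneg (by omega)]
    constructor <;> omega
  · have hy : y < 0 := by omega
    rw [if_pos hy, if_neg (by omega), abs_of_nonpos (by omega), abs_of_nonpos (by omega)]
    constructor <;> omega

lemma Crs.lift {m x y : ℤ} (hm : 0 ≤ m) (h : Crs x y) :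
    Any (lift m x) (lift m y) ∧ |_root_.lift m y - _root_.lift m x| = |y - x| + m := by
  unfold Crs _root_.lift at *
  refine ⟨trivial, ?_⟩
  by_cases hx : x < 0
  · have hy := h.1 hx
    rw [if_pos hx, if_neg (by omega), abs_of_nonneg (by omega), abs_of_nonneg (by omega)]
    omega
  · have hy : y < 0 := by omega
    rw [if_pos hy, if_neg (by omega), abs_of_nonpos (by omega), abs_of_nonpos (by omega)]
    omega

lemma map_infl_neg {q a b : ℤ} (hb : b ≤ 0) : (iv a b).map (infl q) = iv (a - q) (b - q) := by
  rw [sub_eq_add_neg, sub_eq_add_neg, ← map_add_iv]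
  refine Multiset.map_congr rfl fun x hx => ?_
  rw [mem_iv] at hx
  rw [infl, if_pos (by omega)]
  ring

lemma map_infl_pos {q a b : ℤ} (ha : 0 ≤ a) : (iv a b).map (infl q) = iv (a + q) (b + q) := by
  rw [← map_add_iv]
  refine Multiset.map_congr rfl fun x hx => ?_
  rw [mem_iv] at hx
  rw [infl, if_neg (by omega)]

lemma map_lift_neg {q a b : ℤ} (hb : b ≤ 0) : (iv a b).map (lift q) = iv a b := by
  conv_rhs => rw [← Multiset.map_id (iv a b)]
  refine Multiset.map_congr rfl fun x hx => ?_
  rw [mem_iv] at hx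
  rw [lift, if_pos (by omega), id]

lemma map_lift_pos {q a b : ℤ} (ha : 0 ≤ a) : (iv a b).map (lift q) = iv (a + q) (b + q) := by
  rw [← map_add_iv]
  refine Multiset.map_congr rfl fun x hx => ?_
  rw [mem_iv] at hx
  rw [lift, if_neg (by omega)]

lemma map_infl {p q : ℤ} (hp : 0 ≤ p) :
    (iv (-p) p).map (infl q) = iv (-p - q) (-q) + iv q (p + q) := by
  rw [← iv_add (b := 0) (by omega) hp, Multiset.map_add, map_infl_neg le_rfl, map_infl_pos le_rfl]
  simp

lemma map_lift {p q : ℤ} (hp : 0 ≤ p) :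
    (iv (-p) p).map (lift q) = iv (-p) 0 + iv q (p + q) := by
  rw [← iv_add (b := 0) (by omega) hp, Multiset.map_add, map_lift_neg le_rfl, map_lift_pos le_rfl]
  simp

/-- A block: a path from `a < 0` to `b ≥ 0` on vertices between `-p` and `p - 1`, all of whose
edges cross the threshold `0`; it leaves the vertices `VR` and the differences `DR` to the other
components. -/
def Blk (p a b : ℤ) (VR DR : Multiset ℤ) : Prop :=
  a < 0 ∧ 0 ≤ b ∧ ∃ V D, Str Crs a b V D ∧ V + VR = iv (-p) p ∧ D + DR = iv 1 (2 * p)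

/-- A core: a path starting at `k` on vertices between `0` and `m - 1`, which leaves the vertices
`VR` and the differences `DR` to the other components. -/
def Core (m k : ℤ) (VR DR : Multiset ℤ) : Prop :=
  ∃ e V D, Str Any k e V D ∧ V + VR = iv 0 m ∧ D + DR = iv 1 m

lemma Str.head_mem {R : ℤ → ℤ → Prop} {a b : ℤ} {V D : Multiset ℤ} (h : Str R a b V D) :
    a ∈ V := by
  obtain ⟨l, -, ha, -, rfl, -⟩ := h
  exact List.mem_of_mem_head? (by rw [ha]; rfl)

lemma Str.last_mem {R : ℤ → ℤ → Prop} {a b : ℤ} {V D : Multiset ℤ} (h : Str R a b V D) :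
    b ∈ V := by
  obtain ⟨l, -, -, hb, rfl, -⟩ := h
  exact List.mem_of_mem_getLast? (by rw [hb]; rfl)

lemma Blk.bounds {p a b : ℤ} {VR DR : Multiset ℤ} (h : Blk p a b VR DR) :
    -p ≤ a ∧ a < 0 ∧ 0 ≤ b ∧ b < p := by
  obtain ⟨ha, hb, V, D, hs, hV, -⟩ := h
  have h1 : a ∈ iv (-p) p := hV ▸ Multiset.mem_add.2 (Or.inl hs.head_mem)
  have h2 : b ∈ iv (-p) p := hV ▸ Multiset.mem_add.2 (Or.inl hs.last_mem)
  rw [mem_iv] at h1 h2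
  omega

lemma Blk.congr {p a b : ℤ} {V D V' D' : Multiset ℤ} (h : Blk p a b V D) (hV : V = V')
    (hD : D = D') : Blk p a b V' D' := by
  subst hV hD
  exact h

lemma Core.bounds {m k : ℤ} {VR DR : Multiset ℤ} (h : Core m k VR DR) : 0 ≤ k ∧ k < m := by
  obtain ⟨e, V, D, hs, hV, -⟩ := h
  have h1 : k ∈ iv 0 m := hV ▸ Multiset.mem_add.2 (Or.inl hs.head_mem)
  rwa [mem_iv] at h1

lemma Crs.of_neg_nonneg {x y : ℤ} (h : x < 0) (h' : 0 ≤ y) : Crs x y := by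
  unfold Crs
  omega

lemma map_infl_iff {V VR : Multiset ℤ} {p q : ℤ} (hp : 0 ≤ p) (hV : V + VR = iv (-p) p) :
    V.map (infl q) + VR.map (infl q) = iv (-p - q) (-q) + iv q (p + q) := by
  rw [← Multiset.map_add, hV, map_infl hp]

lemma map_add_of_add {D DR : Multiset ℤ} {a b c : ℤ} (hD : D + DR = iv a b) :
    D.map (· + c) + DR.map (· + c) = iv (a + c) (b + c) := by
  rw [← Multiset.map_add, hD, map_add_iv]

/-- Nesting of blocks: the path of the inner block is attached to the upper end of the path of the
outer block. -/
lemma Blk.comp {p₁ p₂ a b d : ℤ} {V₁ D₁ V₂ D₂ : Multiset ℤ} (h₁ : Blk p₁ a b V₁ D₁)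
    (h₂ : Blk p₂ (b - p₂) d V₂ D₂) :
    Blk (p₁ + p₂) (a - p₂) d (V₁.map (infl p₂) + V₂) (D₁.map (· + 2 * p₂) + D₂) := by
  have hb₁ := h₁.bounds
  have hb₂ := h₂.bounds
  obtain ⟨ha, hb, V, D, hs, hV, hD⟩ := h₁
  obtain ⟨hc, hd, W, E, ht, hW, hE⟩ := h₂
  have h1 := hs.map (R' := Crs) (f := infl p₂) (g := (· + 2 * p₂))
    (fun x y h => h.infl (by omega))
  have e1 : infl p₂ a = a - p₂ := if_pos ha
  have e2 : infl p₂ b = b + p₂ := if_neg (by omega)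
  rw [e1, e2] at h1
  have h2 := h1.append ht (Crs.of_neg_nonneg hc (by omega)).symm
  rw [show |b - p₂ - (b + p₂)| = 2 * p₂ by rw [abs_of_nonpos] <;> omega] at h2
  refine ⟨by omega, hd, _, _, h2, ?_, ?_⟩
  · rw [add_add_add_comm, map_infl_iff (by omega) hV, hW]
    refine ms_ext fun t => ?_
    simp (discharger := omega) only [Multiset.count_add, Nat.cast_add, count_iv]
    ring_nf
  · have h3 := map_add_of_add (c := 2 * p₂) hD
    calc _ = (D.map (· + 2 * p₂) + D₁.map (· + 2 * p₂)) + {2 * p₂} + (E + D₂) := by abel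
      _ = _ := by
        rw [h3, hE]
        refine ms_ext fun t => ?_
        simp (discharger := omega) only [Multiset.count_add, Nat.cast_add, count_iv, count_sing]
        ring_nf

/-- Nesting of blocks: the path of the inner block is attached to the lower end of the path of the
outer block. -/
lemma Blk.comp_low {p₁ p₂ a b c : ℤ} {V₁ D₁ V₂ D₂ : Multiset ℤ} (h₁ : Blk p₁ a b V₁ D₁)
    (h₂ : Blk p₂ c (a + p₂) V₂ D₂) :
    Blk (p₁ + p₂) c (b + p₂) (V₁.map (infl p₂) + V₂) (D₁.map (· + 2 * p₂) + D₂) := by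
  have hb₁ := h₁.bounds
  have hb₂ := h₂.bounds
  obtain ⟨ha, hb, V, D, hs, hV, hD⟩ := h₁
  obtain ⟨hc, hd, W, E, ht, hW, hE⟩ := h₂
  have h1 := hs.map (R' := Crs) (f := infl p₂) (g := (· + 2 * p₂))
    (fun x y h => h.infl (by omega))
  have e1 : infl p₂ a = a - p₂ := if_pos ha
  have e2 : infl p₂ b = b + p₂ := if_neg (by omega)
  rw [e1, e2] at h1
  have h2 := ht.append h1 (Crs.of_neg_nonneg (by omega) hd).symm
  rw [show |a - p₂ - (a + p₂)| = 2 * p₂ by rw [abs_of_nonpos] <;> omega] at h2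
  refine ⟨by omega, by omega, _, _, h2, ?_, ?_⟩
  · rw [add_comm W, add_add_add_comm, map_infl_iff (by omega) hV, hW]
    refine ms_ext fun t => ?_
    simp (discharger := omega) only [Multiset.count_add, Nat.cast_add, count_iv]
    ring_nf
  · have h3 := map_add_of_add (c := 2 * p₂) hD
    calc _ = (D.map (· + 2 * p₂) + D₁.map (· + 2 * p₂)) + {2 * p₂} + (E + D₂) := by abel
      _ = _ := by
        rw [h3, hE]
        refine ms_ext fun t => ?_
        simp (discharger := omega) only [Multiset.count_add, Nat.cast_add, count_iv, count_sing]
        ring_nf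

/-- Reflection of a block in its threshold. -/
lemma Blk.dual {p a b : ℤ} {V D : Multiset ℤ} (h : Blk p a b V D) :
    Blk p (-1 - b) (-1 - a) (V.map (fun x => -1 - x)) D := by
  obtain ⟨ha, hb, W, E, hs, hV, hD⟩ := h
  have h1 := hs.map (R' := Crs) (f := fun x => -1 - x) (g := id) (fun x y h =>
    ⟨by unfold Crs at *; omega, by rw [id, abs_sub_comm]; congr 1; ring⟩)
  have h2 := h1.reverse fun _ _ => Crs.symm
  refine ⟨by omega, by omega, _, _, h2, ?_, ?_⟩
  · rw [← Multiset.map_add, hV, map_sub_iv]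
    congr 1 <;> ring
  · rw [Multiset.map_id, hD]

/-- A core is surrounded by a block whose path has its upper end at `k`. -/
lemma Core.wrap {m k p a : ℤ} {V D V' D' : Multiset ℤ} (h : Core m k V D)
    (h' : Blk p a k V' D') :
    Core (m + 2 * p) (a + p) ((V'.map (lift m) + V).map (· + p)) (D'.map (· + m) + D) := by
  have hb := h.bounds
  have hb' := h'.bounds
  obtain ⟨e, W, E, hs, hV, hD⟩ := h
  obtain ⟨ha, -, W', E', hs', hV', hD'⟩ := h'
  have h1 := hs'.map (R' := Any) (f := lift m) (g := (· + m)) (fun x y h => h.lift (by omega))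
  have e1 : lift m a = a := if_pos ha
  have e2 : lift m k = k + m := if_neg (by omega)
  rw [e1, e2] at h1
  have h2 := (h1.append hs trivial).shift p
  rw [show |k - (k + m)| = m by rw [abs_of_nonpos] <;> omega] at h2
  refine ⟨_, _, _, h2, ?_, ?_⟩
  · have : (W'.map (lift m) + W) + (V'.map (lift m) + V) = iv (-p) (m + p) := by
      rw [add_add_add_comm, ← Multiset.map_add, hV', hV, map_lift (by omega)]
      refine ms_ext fun t => ?_
      simp (discharger := omega) only [Multiset.count_add, Nat.cast_add, count_iv]
      ring_nf
    rw [← Multiset.map_add, this, map_add_iv]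
    congr 1 <;> ring
  · have h3 := map_add_of_add (c := m) hD'
    calc _ = (E'.map (· + m) + D'.map (· + m)) + {m} + (E + D) := by abel
      _ = _ := by
        rw [h3, hD]
        refine ms_ext fun t => ?_
        simp (discharger := omega) only [Multiset.count_add, Nat.cast_add, count_iv, count_sing]
        ring_nf

lemma Core.refl {m k : ℤ} {V D : Multiset ℤ} (h : Core m k V D) :
    Core m (m - 1 - k) (V.map (fun x => m - 1 - x)) D := by
  obtain ⟨e, W, E, hs, hV, hD⟩ := h
  refine ⟨_, _, _, hs.refl (m - 1), ?_, hD⟩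
  rw [← Multiset.map_add, hV, map_sub_iv]
  congr 1 <;> ring

/-! ### Blocks consisting of a path only -/

/-- For every `a` with `0 ≤ a < p` there is a block that consists of a path from `a - p` to `a`. -/
lemma Blk.path : ∀ (p a : ℤ), 0 ≤ a → a < p → Blk p (a - p) a 0 0 := by
  suffices H : ∀ n : ℕ, ∀ p a : ℤ, p ≤ n → 0 ≤ a → a < p → Blk p (a - p) a 0 0 from
    fun p a => H p.toNat p a (by omega)
  have base : ∀ p : ℤ, 1 ≤ p → Blk p (0 - p) 0 0 0 := by
    intro p hp
    refine ⟨by omega, le_rfl, _, _, (Str.zig_in (x := -p) (y := p - 1) hp (by omega) ?_).cast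
      (by ring) (by ring) rfl rfl, ?_, ?_⟩
    · intro u v h1 h2 h3 h4
      have := Crs.of_neg_nonneg (x := u) (y := v) (by omega) (by omega)
      exact ⟨this, this.symm⟩
    · refine ms_ext fun t => ?_
      simp (discharger := omega) only [Multiset.count_add, Nat.cast_add, count_iv, add_zero]
      ring_nf
    · rw [add_zero]
      congr 1 <;> ring
  have dual : ∀ p a, Blk p (a - p) a 0 0 → Blk p ((p - 1 - a) - p) (p - 1 - a) 0 0 := by
    intro p a h
    have := h.dual
    rw [show -1 - a = p - 1 - a - p by ring, show -1 - (a - p) = p - 1 - a by ring] at this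
    simpa using this
  have base' : ∀ p : ℤ, 1 ≤ p → Blk p (p - 1 - p) (p - 1) 0 0 := by
    intro p hp
    simpa using dual p 0 (base p hp)
  have mid : ∀ a : ℤ, 1 ≤ a → Blk (2 * a + 1) (a - (2 * a + 1)) a 0 0 := by
    intro a ha
    have h1 : Str Crs _ _ _ _ := Str.zag_out (x := -a - 1) (y := a + 1) (k := a) ha (by omega)
      (by
        intro u v h1 h2 h3 h4
        have := Crs.of_neg_nonneg (x := u) (y := v) (by omega) (by omega)
        exact ⟨this, this.symm⟩)
    have h2 : Str Crs _ _ _ _ := Str.zag_out (x := -1) (y := 1) (k := a) ha (by omega)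
      (by
        intro u v h1 h2 h3 h4
        have := Crs.of_neg_nonneg (x := u) (y := v) (by omega) (by omega)
        exact ⟨this, this.symm⟩)
    have h3 := ((h1.append (Str.single _ (-2 * a - 1))
      (Crs.of_neg_nonneg (by omega) (by omega)).symm).append (Str.single _ 0)
      (Crs.of_neg_nonneg (by omega) (by omega))).append h2
      (Crs.of_neg_nonneg (by omega) (by omega)).symm
    refine ⟨by omega, by omega, _, _, h3.cast (by ring) (by ring) rfl rfl, ?_, ?_⟩
    · refine ms_ext fun t => ?_
      simp (discharger := omega) only [Multiset.count_add, Nat.cast_add, count_iv, count_sing, add_zero]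
      ring_nf
    · rw [abs_of_nonpos (by omega), abs_of_nonneg (by omega), abs_of_nonpos (by omega)]
      refine ms_ext fun t => ?_
      simp (discharger := omega) only [Multiset.count_add, Nat.cast_add, count_iv, count_sing, add_zero]
      ring_nf
  intro n
  induction n with
  | zero =>
    intro p a h1 h2 h3
    push_cast at h1
    omega
  | succ n ih =>
    have big : ∀ p a : ℤ, p ≤ n + 1 → 0 ≤ a → 2 * a + 1 ≤ p → Blk p (a - p) a 0 0 := by
      intro p a h1 h2 h3
      rcases eq_or_lt_of_le h2 with rfl | h2
      · exact base p (by omega)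
      rcases eq_or_lt_of_le h3 with rfl | h3
      · exact mid a (by omega)
      · have h4 := base' (a + 1) (by omega)
        have h5 := ih (p - a - 1) a (by omega) (by omega) (by omega)
        rw [add_sub_cancel_right] at h4
        have h6 := h4.comp h5
        simp only [Multiset.map_zero, add_zero] at h6
        convert h6 using 1 <;> ring
    intro p a h1 h2 h3
    push_cast at h1
    by_cases h : 2 * a + 1 ≤ p
    · exact big p a h1 h2 h
    · have := dual p _ (big p (p - 1 - a) h1 (by omega) (by omega))
      simpa using this

lemma Core.path (m : ℤ) (k : ℤ) (hm : 1 ≤ m) (hk : k = m / 2) : Core m k 0 0 := by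
  have hR : ∀ u v, Any u v ∧ Any v u := fun _ _ => ⟨trivial, trivial⟩
  rcases eq_or_lt_of_le hm with rfl | hm
  · obtain rfl : k = 0 := by omega
    refine ⟨_, _, _, Str.single _ 0, ?_, ?_⟩
    · rw [add_zero]
      exact (iv_single 0).symm
    · rw [iv_self, add_zero]
  -- the path zigzags outwards from the middle
  rcases Int.even_or_odd' m with ⟨q, rfl | rfl⟩
  · obtain rfl : k = q := by omega
    refine ⟨_, _, _, Str.zig_out (x := k) (y := k - 1) (k := k) (by omega) (by omega)
      (fun u v _ _ _ _ => hR u v), ?_, ?_⟩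
    · refine ms_ext fun t => ?_
      simp (discharger := omega) only [Multiset.count_add, Nat.cast_add, count_iv, add_zero]
      ring_nf
    · rw [add_zero]
      congr 1 <;> ring
  · obtain rfl : k = q := by omega
    refine ⟨_, _, _, (Str.zag_out (x := k) (y := k + 1) (k := k) (by omega) (by omega)
      (fun u v _ _ _ _ => hR u v)).append (Str.single _ 0) trivial, ?_, ?_⟩
    · refine ms_ext fun t => ?_
      simp (discharger := omega) only [Multiset.count_add, Nat.cast_add, count_iv, add_zero, count_sing]
      ring_nf
    · rw [abs_of_nonpos (by omega)]
      refine ms_ext fun t => ?_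
      simp (discharger := omega) only [Multiset.count_add, Nat.cast_add, count_iv, add_zero, count_sing]
      ring_nf

/-! ### Graceful labellings of a path together with cycles -/

/-- `Rest R t L V D`: there are cycles of the lengths in the list `L`, with joint vertex multiset
`V` and joint multiset of differences `D`; all their edges satisfy `R` and all their differences
are less than `t`. -/
inductive Rest (R : ℤ → ℤ → Prop) (t : ℤ) : List ℕ → Multiset ℤ → Multiset ℤ → Prop
  | nil : Rest R t [] 0 0
  | cons {n : ℕ} {L : List ℕ} {a b : ℤ} {V D V' D' : Multiset ℤ} (hs : Str R a b V D)
      (hc : R b a) (hn : V.card = n) (ht : ∀ v ∈ D + {|a - b|}, v < t) (h : Rest R t L V' D') :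
      Rest R t (n :: L) (V + V') (D + {|a - b|} + D')

namespace Rest

variable {R R' : ℤ → ℤ → Prop} {t t' : ℤ} {L L' : List ℕ} {V D V' D' : Multiset ℤ}

lemma append (h : Rest R t L V D) (h' : Rest R t L' V' D') :
    Rest R t (L ++ L') (V + V') (D + D') := by
  induction h with
  | nil => simpa using h'
  | cons hs hc hn ht _ ih =>
    rw [add_assoc, add_assoc]
    exact cons hs hc hn ht ih

lemma map {f g : ℤ → ℤ} (h : Rest R t L V D)
    (hf : ∀ x y, R x y → R' (f x) (f y) ∧ |f y - f x| = g |y - x|)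
    (hg : ∀ v, v < t → g v < t') : Rest R' t' L (V.map f) (D.map g) := by
  induction h with
  | nil => simpa using nil
  | cons hs hc hn ht _ ih =>
    have e := (hf _ _ hc).2
    simp only [Multiset.map_add, Multiset.map_singleton, ← e]
    refine cons (hs.map hf) (hf _ _ hc).1 (by simpa using hn) ?_ ih
    intro v hv
    rw [e] at hv
    rcases Multiset.mem_add.1 hv with hv | hv
    · obtain ⟨w, hw, rfl⟩ := Multiset.mem_map.1 hv
      exact hg w (ht w (Multiset.mem_add.2 (Or.inl hw)))
    · rw [Multiset.mem_singleton.1 hv]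
      exact hg _ (ht _ (by simp))

lemma perm (h : Rest R t L V D) (hL : L.Perm L') : Rest R t L' V D := by
  induction hL generalizing V D with
  | nil => exact h
  | cons x _ ih =>
    cases h with
    | cons hs hc hn ht h => exact cons hs hc hn ht (ih h)
  | swap x y l =>
    cases h with
    | cons hs hc hn ht h =>
      cases h with
      | cons hs' hc' hn' ht' h =>
        rw [add_left_comm, add_left_comm (_ + _)]
        exact cons hs' hc' hn' ht' (cons hs hc hn ht h)
  | trans _ _ ih₁ ih₂ => exact ih₂ (ih₁ h)

lemma mono (h : Rest R t L V D) (ht : t ≤ t') : Rest R t' L V D := by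
  have := h.map (R' := R) (f := id) (g := id) (t' := t') (fun x y h => ⟨h, rfl⟩)
    (fun v hv => lt_of_lt_of_le hv ht)
  simpa using this

end Rest

/-- An α-labelling, up to a shift: a path and cycles of the lengths in `L` on the vertices
`-p, …, p - 1`, all edges crossing the threshold `0`, with each of the differences
`1, …, 2 * p - 1` once.  The path runs from `a - p` to `a`, and the differences in the cycles are
less than `t`. -/
def Alpha (L : List ℕ) (p t a : ℤ) : Prop :=
  ∃ V D, Blk p (a - p) a V D ∧ Rest Crs t L V D

/-- A graceful labelling with the labels `0, …, m - 1` of a path starting at `k` and of cycles of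
the lengths in `L`; the differences in the cycles are less than `t`. -/
def Grace (L : List ℕ) (m t k : ℤ) : Prop :=
  ∃ V D, Core m k V D ∧ Rest Any t L V D

lemma Alpha.bounds {L : List ℕ} {p t a : ℤ} (h : Alpha L p t a) : 0 ≤ a ∧ a < p := by
  obtain ⟨V, D, h, -⟩ := h
  have := h.bounds
  omega

lemma Grace.bounds {L : List ℕ} {m t k : ℤ} (h : Grace L m t k) : 0 ≤ k ∧ k < m := by
  obtain ⟨V, D, h, -⟩ := h
  exact h.bounds

lemma Alpha.path {p a : ℤ} (t : ℤ) (ha : 0 ≤ a) (hp : a < p) : Alpha [] p t a :=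
  ⟨0, 0, Blk.path p a ha hp, Rest.nil⟩

lemma Alpha.mono {L : List ℕ} {p t t' a : ℤ} (h : Alpha L p t a) (ht : t ≤ t') :
    Alpha L p t' a := by
  obtain ⟨V, D, hb, hr⟩ := h
  exact ⟨V, D, hb, hr.mono ht⟩

lemma Alpha.comp {L₁ L₂ : List ℕ} {p₁ p₂ t₁ t a : ℤ} (h₁ : Alpha L₁ p₁ t₁ a)
    (h₂ : Alpha L₂ p₂ t a) (ht : t₁ + 2 * p₂ ≤ t) : Alpha (L₁ ++ L₂) (p₁ + p₂) t a := by
  have := h₂.bounds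
  obtain ⟨V₁, D₁, hb₁, hr₁⟩ := h₁
  obtain ⟨V₂, D₂, hb₂, hr₂⟩ := h₂
  refine ⟨_, _, ?_, (hr₁.map (g := (· + 2 * p₂)) (fun x y h => h.infl (by omega))
    (fun v hv => by omega)).append hr₂⟩
  have := hb₁.comp hb₂
  rwa [show a - p₁ - p₂ = a - (p₁ + p₂) by ring] at this

lemma Alpha.dual {L : List ℕ} {p t a : ℤ} (h : Alpha L p t a) : Alpha L p t (p - 1 - a) := by
  obtain ⟨V, D, hb, hr⟩ := h
  have h1 := hb.dual
  rw [show -1 - a = p - 1 - a - p by ring, show -1 - (a - p) = p - 1 - a by ring] at h1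
  refine ⟨_, _, h1, ?_⟩
  have := hr.map (R' := Crs) (f := fun x => -1 - x) (g := id) (t' := t) (fun x y h =>
    ⟨by unfold Crs at *; omega, by rw [id, abs_sub_comm]; congr 1; ring⟩) (fun v hv => hv)
  simpa using this

lemma Grace.path {m k : ℤ} (t : ℤ) (hm : 1 ≤ m) (hk : k = m / 2) : Grace [] m t k :=
  ⟨0, 0, Core.path m k hm hk, Rest.nil⟩

lemma Any.shift (c x y : ℤ) : Any (x + c) (y + c) ∧ |y + c - (x + c)| = id |y - x| :=
  ⟨trivial, by simp⟩

lemma Grace.wrap {L L' : List ℕ} {m p t t' t'' k : ℤ} (h : Grace L m t k)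
    (h' : Alpha L' p t' k) (ht : t ≤ t'') (ht' : t' + m ≤ t'') :
    Grace (L' ++ L) (m + 2 * p) t'' k := by
  have := h.bounds
  obtain ⟨V₁, D₁, hb₁, hr₁⟩ := h
  obtain ⟨V₂, D₂, hb₂, hr₂⟩ := h'
  have h1 := hb₁.wrap hb₂
  rw [sub_add_cancel] at h1
  refine ⟨_, _, h1, ?_⟩
  have h2 := ((hr₂.map (g := (· + m)) (fun x y h => h.lift (by omega)) (t' := t'')
    (fun v hv => by omega)).append (hr₁.mono ht)).map (R' := Any) (t' := t'')
    (fun x y _ => Any.shift p x y) (fun v hv => hv)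
  simpa using h2

lemma Grace.wrap_path {L : List ℕ} {m p t k : ℤ} (h : Grace L m t k) (hp : k < p) :
    Grace L (m + 2 * p) t k :=
  h.wrap (Alpha.path (t - m) h.bounds.1 hp) le_rfl (by omega)

lemma Grace.refl {L : List ℕ} {m t k : ℤ} (h : Grace L m t k) : Grace L m t (m - 1 - k) := by
  obtain ⟨V, D, hb, hr⟩ := h
  refine ⟨_, _, hb.refl, ?_⟩
  have := hr.map (R' := Any) (f := fun x => m - 1 - x) (g := id) (t' := t) (fun x y h =>
    ⟨trivial, by rw [id, abs_sub_comm]; congr 1; ring⟩) (fun v hv => hv)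
  simpa using this

lemma Grace.perm {L L' : List ℕ} {m t k : ℤ} (h : Grace L m t k) (hL : L.Perm L') :
    Grace L' m t k := by
  obtain ⟨V, D, hb, hr⟩ := h
  exact ⟨V, D, hb, hr.perm hL⟩

/-! ### Blocks with an open strand -/

/-- A path from `-1 - y` to `b` and a second path with `n` vertices from `-1 - u` to `d - 1 - u`,
on the vertices `-p, …, p - 1`, all edges crossing the threshold `0`, with each of the differences
`1, …, 2 * p - 1` except `d'` once.  Joining the ends of the second path creates the
difference `d`. -/
def OpenBlk (n : ℕ) (p y b u d d' : ℤ) : Prop :=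
  ∃ V D, Blk p (-1 - y) b V (D + {d'}) ∧ Str Crs (-1 - u) (d - 1 - u) V D ∧ V.card = n ∧
    0 ≤ u ∧ u < d

namespace OpenBlk

variable {n : ℕ} {p y b u d d' : ℤ}

lemma bounds (h : OpenBlk n p y b u d d') : 0 ≤ y ∧ y < p ∧ 0 ≤ b ∧ b < p ∧ 0 ≤ u ∧ u < d := by
  obtain ⟨V, D, h, -, -, h1, h2⟩ := h
  have := h.bounds
  omega

lemma inner (h : OpenBlk n p y b u d d') {q : ℤ} (hq : y < q) :
    OpenBlk n (p + q) y (b + q) (u + q) (d + 2 * q) (d' + 2 * q) := by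
  have hy := h.bounds
  obtain ⟨V, D, hb, hs, hn, hu, hd⟩ := h
  have h1 := Blk.path q (-1 - y + q) (by omega) (by omega)
  rw [show -1 - y + q - q = -1 - y by ring] at h1
  have h2 := hb.comp_low h1
  have h3 := hs.map (R' := Crs) (f := infl q) (g := (· + 2 * q))
    (fun x y h => h.infl (by omega))
  refine ⟨V.map (infl q), D.map (· + 2 * q), ?_, ?_, by simpa using hn, by omega, by omega⟩
  · simpa using h2
  · have e1 : infl q (-1 - u) = -1 - (u + q) := by
      rw [infl, if_pos (by omega)]; ring
    have e2 : infl q (d - 1 - u) = d + 2 * q - 1 - (u + q) := by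
      rw [infl, if_neg (by omega)]; ring
    rwa [e1, e2] at h3

lemma outer (h : OpenBlk n p y b u d d') {q : ℤ} (hq : p - b ≤ q) :
    OpenBlk n (p + q) y (b + q) u d d' := by
  have hy := h.bounds
  obtain ⟨V, D, hb, hs, hn, hu, hd⟩ := h
  have h1 := Blk.path q (b + q - p) (by omega) (by omega)
  have h2 := h1.comp_low (p₂ := p) (c := -1 - y) (V₂ := V) (D₂ := D + {d'})
    (by rwa [show b + q - p - q + p = b by ring])
  rw [sub_add_cancel, add_comm q p] at h2
  simp only [Multiset.map_zero, zero_add] at h2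
  exact ⟨V, D, h2, hs, hn, hu, hd⟩

lemma close (h : OpenBlk n p y b u d d) (hb : b + y + 1 = p) : Alpha [n] p (2 * p) b := by
  obtain ⟨V, D, hb', hs, hn, hu, hd⟩ := h
  have hD : ∀ v ∈ D + {d}, v < 2 * p := by
    obtain ⟨-, -, W, E, -, -, hE⟩ := hb'
    intro v hv
    have : v ∈ iv 1 (2 * p) := hE ▸ Multiset.mem_add.2 (Or.inr hv)
    exact (mem_iv.1 this).2
  have e : |(-1 - u) - (d - 1 - u)| = d := by
    rw [abs_of_nonpos] <;> omega
  refine ⟨V, D + {d}, ?_, ?_⟩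
  · rwa [show b - p = -1 - y by omega]
  · have := Rest.cons (R := Crs) (t := 2 * p) hs
      (Crs.of_neg_nonneg (by omega) (by omega)).symm hn (by rwa [e]) Rest.nil
    rwa [e, add_zero, add_zero] at this

end OpenBlk

/-! ### Blocks containing one cycle of even length or one edge -/

lemma crs_pair {u v : ℤ} (h : u < 0) (h' : 0 ≤ v) : Crs u v ∧ Crs v u :=
  ⟨Crs.of_neg_nonneg h h', (Crs.of_neg_nonneg h h').symm⟩

namespace Str

variable {R : ℤ → ℤ → Prop}

/-- The zigzag `x, y, x + 1, y - 1, …, x + k` with decreasing differences. -/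
lemma zig_in_odd {x y k : ℤ} (hk : 0 ≤ k) (h : x + k ≤ y - k + 1)
    (hR : ∀ u v, x ≤ u → u ≤ x + k → y - k < v → v ≤ y → R u v ∧ R v u) :
    Str R x (x + k) (iv x (x + k + 1) + iv (y - k + 1) (y + 1))
      (iv (y - x - 2 * k + 1) (y - x + 1)) := by
  rcases eq_or_lt_of_le hk with rfl | hk
  · refine (single R x).cast rfl (by ring) ?_ ?_
    · rw [show y - 0 + 1 = y + 1 by ring, iv_self, add_zero, add_zero, iv_single]
    · rw [show y - x - 2 * 0 + 1 = y - x + 1 by ring, iv_self]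
  · refine ((zig_in (x := x) (y := y) (k := k) hk (by omega) fun u v h1 h2 h3 h4 =>
      hR u v h1 (by omega) h3 h4).append (single R (x + k))
      (hR _ _ (by omega) le_rfl (by omega) (by omega)).2).cast rfl rfl ?_ ?_
    · refine ms_ext fun t => ?_
      simp (discharger := omega) only [Multiset.count_add, Nat.cast_add, count_iv, count_sing]
      ring_nf
    · rw [abs_of_nonpos (by omega)]
      refine ms_ext fun t => ?_
      simp (discharger := omega) only [Multiset.count_add, Nat.cast_add, count_iv, count_sing,
        add_zero]
      ring_nf

/-- The zigzag `x, y, x - 1, y + 1, …, x - k` with decreasing differences. -/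
lemma zag_in_odd {x y k : ℤ} (hk : 0 ≤ k) (h : y + k ≤ x - k + 1)
    (hR : ∀ u v, x - k ≤ u → u ≤ x → y ≤ v → v < y + k → R u v ∧ R v u) :
    Str R x (x - k) (iv (x - k) (x + 1) + iv y (y + k))
      (iv (x - y - 2 * k + 1) (x - y + 1)) := by
  rcases eq_or_lt_of_le hk with rfl | hk
  · refine (single R x).cast rfl (by ring) ?_ ?_
    · rw [show y + 0 = y by ring, iv_self, sub_zero, add_zero, iv_single]
    · rw [show x - y - 2 * 0 + 1 = x - y + 1 by ring, iv_self]
  · refine ((zag_in (x := x) (y := y) (k := k) hk (by omega) fun u v h1 h2 h3 h4 =>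
      hR u v (by omega) h2 h3 h4).append (single R (x - k))
      (hR _ _ (by omega) (by omega) (by omega) (by omega)).2).cast rfl rfl ?_ ?_
    · refine ms_ext fun t => ?_
      simp (discharger := omega) only [Multiset.count_add, Nat.cast_add, count_iv, count_sing]
      ring_nf
    · rw [abs_of_nonneg (by omega)]
      refine ms_ext fun t => ?_
      simp (discharger := omega) only [Multiset.count_add, Nat.cast_add, count_iv, count_sing,
        add_zero]
      ring_nf

end Str

/-- The block around a cycle of length `4 * k`: the upper vertices of the cycle are consecutive,
and its lower vertices are consecutive but for the one in the middle, which belongs to the path. -/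
lemma Blk.around_four {q k : ℤ} (hk : 1 ≤ k) (hq : k + 1 ≤ q) :
    Blk (q + 3 * k + 1) (-1 - k) (q + 2 * k)
      (iv q (q + 2 * k) + iv (-1 - q - 2 * k) (-1 - q - k) + iv (-q - k) (-q))
      (iv (2 * q + 1) (2 * q + 4 * k + 1)) := by
  obtain ⟨-, -, V, D, h1, hV, hD⟩ := Blk.path q (q - 1 - k) (by omega) (by omega)
  rw [add_zero] at hV hD
  subst hV hD
  have h2 : Str Crs _ _ _ _ := Str.zag_in_odd (x := q + 3 * k) (y := -1 - (q + 3 * k)) (k := k)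
    (by omega) (by omega) fun u v h1 h2 h3 h4 => (crs_pair (by omega) (by omega)).symm
  have h3 := (h1.append (Str.single Crs (-1 - (q + k))) (crs_pair (by omega) (by omega)).2).append
    h2 (crs_pair (by omega) (by omega)).1
  refine ⟨by omega, by omega, _, _, h3.cast (by ring) (by ring) rfl rfl, ?_, ?_⟩
  · refine ms_ext fun t => ?_
    simp (discharger := omega) only [Multiset.count_add, Nat.cast_add, count_iv, count_sing]
    ring_nf
  · rw [abs_of_nonpos (by omega), abs_of_nonneg (by omega)]
    refine ms_ext fun t => ?_
    simp (discharger := omega) only [Multiset.count_add, Nat.cast_add, count_iv, count_sing,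
      add_zero]
    ring_nf

lemma card_toNat {V : Multiset ℤ} {n : ℕ} (h : (V.card : ℤ) = n) : V.card = n := by
  exact_mod_cast h

/-- A block with a cycle of length `4 * k`, opened at an edge of odd difference. -/
lemma OpenBlk.four_odd {q : ℤ} {k : ℕ} (hk : 1 ≤ k) (hq : k + 1 ≤ q) :
    OpenBlk (4 * k) (q + 3 * k + 1) k (q + 2 * k) (q + k + 1) (2 * q + 2 * k + 1)
      (2 * q + 2 * k + 1) := by
  have h1 : Str Crs _ _ _ _ := Str.zag_in (x := q + 2 * k - 1) (y := -1 - (q + 2 * k)) (k := k)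
    (by omega) (by omega) fun u v h1 h2 h3 h4 => (crs_pair (by omega) (by omega)).symm
  have h2 : Str Crs _ _ _ _ := Str.zag_in (x := q + k - 1) (y := -1 - (q + k - 1)) (k := k)
    (by omega) (by omega) fun u v h1 h2 h3 h4 => (crs_pair (by omega) (by omega)).symm
  have h3 := (h1.reverse fun _ _ => Crs.symm).append (h2.reverse fun _ _ => Crs.symm)
    (crs_pair (by omega) (by omega)).2
  refine ⟨_, _, (Blk.around_four (q := q) (k := k) (by omega) hq).congr ?_ ?_,
    h3.cast (by ring) (by ring) rfl rfl, card_toNat ?_, by omega, by omega⟩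
  · refine ms_ext fun t => ?_
    simp (discharger := omega) only [Multiset.count_add, Nat.cast_add, count_iv]
    ring_nf
  · rw [abs_of_nonpos (by omega)]
    refine ms_ext fun t => ?_
    simp (discharger := omega) only [Multiset.count_add, Nat.cast_add, count_iv, count_sing]
    ring_nf
  · simp (discharger := omega) only [Multiset.card_add, Nat.cast_add, card_iv]
    push_cast
    ring

/-- A block with a cycle of length `4 * k`, opened at an edge of even difference. -/
lemma OpenBlk.four_even {q : ℤ} {k : ℕ} (hk : 1 ≤ k) (hq : k + 1 ≤ q) :
    OpenBlk (4 * k) (q + 3 * k + 1) k (q + 2 * k) (q + k + 1) (2 * q + 2 * k + 2)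
      (2 * q + 2 * k + 2) := by
  have h1 : Str Crs _ _ _ _ := Str.zag_in_odd (x := q + 2 * k - 1) (y := -1 - (q + 2 * k))
    (k := k - 1)
    (by omega) (by omega) fun u v h1 h2 h3 h4 => (crs_pair (by omega) (by omega)).symm
  have h2 : Str Crs _ _ _ _ := Str.zag_in (x := q + k - 1) (y := -1 - (q + k - 1)) (k := k)
    (by omega) (by omega) fun u v h1 h2 h3 h4 => (crs_pair (by omega) (by omega)).symm
  have h3 := ((Str.single Crs (-1 - (q + k + 1))).append h2
    (crs_pair (by omega) (by omega)).1).append h1 (crs_pair (by omega) (by omega)).1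
  refine ⟨_, _, (Blk.around_four (q := q) (k := k) (by omega) hq).congr ?_ ?_,
    h3.cast (by ring) (by ring) rfl rfl, card_toNat ?_, by omega, by omega⟩
  · refine ms_ext fun t => ?_
    simp (discharger := omega) only [Multiset.count_add, Nat.cast_add, count_iv, count_sing]
    ring_nf
  · rw [abs_of_nonneg (by omega), abs_of_nonneg (by omega)]
    refine ms_ext fun t => ?_
    simp (discharger := omega) only [Multiset.count_add, Nat.cast_add, count_iv, count_sing,
      zero_add]
    ring_nf
  · simp (discharger := omega) only [Multiset.card_add, Nat.cast_add, card_iv,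
      Multiset.card_singleton]
    push_cast
    ring

/-- The block around a cycle of length `4 * k + 2`: an upper and a lower vertex between those of
the cycle belong to the path, which uses one difference between those of the cycle. -/
lemma Blk.around_four_add_two {q k : ℤ} (hk : 2 ≤ k) (hq : k + 2 ≤ q) :
    Blk (q + 3 * k + 2) (-1 - (k + 1)) (q + 2 * k)
      (iv q (q + 2 * k) + {q + 2 * k + 1} + iv (-2 - q - 2 * k) (-2 - q - k) +
        iv (-1 - q - k) (-q))
      (iv (2 * q + 1) (2 * q + 4 * k + 2) + {2 * q + 4 * k + 3}) := by
  obtain ⟨-, -, V, D, h1, hV, hD⟩ := Blk.path q (q - 2 - k) (by omega) (by omega)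
  rw [add_zero] at hV hD
  subst hV hD
  obtain ⟨-, -, V, D, h2, hV, hD⟩ := Blk.path k (k - 2) (by omega) (by omega)
  rw [add_zero] at hV hD
  subst hV hD
  have h3 := (h2.map (R' := Crs) (f := infl (q + 2 * k + 2)) (g := (· + 2 * (q + 2 * k + 2)))
    (fun x y h => h.infl (by omega))).reverse fun _ _ => Crs.symm
  rw [infl, infl, if_neg (by omega), if_pos (by omega), map_infl (by omega), map_add_iv] at h3
  have h4 := ((h1.append (Str.single Crs (-1 - (q + k + 1)))
    (crs_pair (by omega) (by omega)).2).append h3 (crs_pair (by omega) (by omega)).1).append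
    (Str.single Crs (q + 2 * k)) (crs_pair (by omega) (by omega)).1
  refine ⟨by omega, by omega, _, _, h4.cast (by ring) rfl rfl rfl, ?_, ?_⟩
  · refine ms_ext fun t => ?_
    simp (discharger := omega) only [Multiset.count_add, Nat.cast_add, count_iv, count_sing]
    ring_nf
  · rw [abs_of_nonpos (by omega), abs_of_nonneg (by omega), abs_of_nonneg (by omega)]
    refine ms_ext fun t => ?_
    simp (discharger := omega) only [Multiset.count_add, Nat.cast_add, count_iv, count_sing,
      add_zero]
    ring_nf

/-- A block with a cycle of length `4 * k + 2`, opened at an edge of odd difference. -/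
lemma OpenBlk.four_add_two_odd {q : ℤ} {k : ℕ} (hk : 2 ≤ k) (hq : k + 2 ≤ q) :
    OpenBlk (4 * k + 2) (q + 3 * k + 2) (k + 1) (q + 2 * k) (q + k) (2 * q + 2 * k + 1)
      (2 * q + 2 * k + 1) := by
  have h1 : Str Crs _ _ _ _ := Str.zag_in (x := q + 2 * k - 1) (y := -1 - (q + 2 * k))
    (k := k - 1) (by omega) (by omega)
    fun u v h1 h2 h3 h4 => (crs_pair (by omega) (by omega)).symm
  have h2 : Str Crs _ _ _ _ := Str.zig_in_odd (x := -1 - (q + k)) (y := q + k - 1) (k := k)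
    (by omega) (by omega) fun u v h1 h2 h3 h4 => crs_pair (by omega) (by omega)
  have h3 := (((h2.append (Str.single Crs (q + 2 * k + 1))
    (crs_pair (by omega) (by omega)).1).append (Str.single Crs (-1 - (q + 2 * k + 1)))
    (crs_pair (by omega) (by omega)).2).append h1 (crs_pair (by omega) (by omega)).1).append
    (Str.single Crs (q + k)) (crs_pair (by omega) (by omega)).1
  refine ⟨_, _, (Blk.around_four_add_two (q := q) (k := k) (by omega) hq).congr ?_ ?_,
    h3.cast (by ring) (by ring) rfl rfl, card_toNat ?_, by omega, by omega⟩
  · refine ms_ext fun t => ?_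
    simp (discharger := omega) only [Multiset.count_add, Nat.cast_add, count_iv, count_sing]
    ring_nf
  · rw [abs_of_nonneg (by omega), abs_of_nonpos (by omega), abs_of_nonneg (by omega),
      abs_of_nonneg (by omega)]
    refine ms_ext fun t => ?_
    simp (discharger := omega) only [Multiset.count_add, Nat.cast_add, count_iv, count_sing,
      add_zero]
    ring_nf
  · simp (discharger := omega) only [Multiset.card_add, Nat.cast_add, card_iv,
      Multiset.card_singleton]
    push_cast
    ring

/-- A block with a cycle of length `4 * k + 2`, opened at an edge of even difference. -/
lemma OpenBlk.four_add_two_even {q : ℤ} {k : ℕ} (hk : 2 ≤ k) (hq : k + 2 ≤ q) :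
    OpenBlk (4 * k + 2) (q + 3 * k + 2) (k + 1) (q + 2 * k) (q + k) (2 * q + 2 * k)
      (2 * q + 2 * k) := by
  have h1 : Str Crs _ _ _ _ := Str.zag_in (x := q + 2 * k - 1) (y := -1 - (q + 2 * k))
    (k := k - 1) (by omega) (by omega)
    fun u v h1 h2 h3 h4 => (crs_pair (by omega) (by omega)).symm
  have h2 : Str Crs _ _ _ _ := Str.zag_in (x := q + k - 1) (y := -1 - (q + k - 1)) (k := k)
    (by omega) (by omega) fun u v h1 h2 h3 h4 => (crs_pair (by omega) (by omega)).symm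
  have h3 := (((((Str.single Crs (-1 - (q + k))).append (Str.single Crs (q + k))
    (crs_pair (by omega) (by omega)).1).append (h1.reverse fun _ _ => Crs.symm)
    (crs_pair (by omega) (by omega)).2).append (Str.single Crs (-1 - (q + 2 * k + 1)))
    (crs_pair (by omega) (by omega)).2).append (Str.single Crs (q + 2 * k + 1))
    (crs_pair (by omega) (by omega)).1).append (h2.reverse fun _ _ => Crs.symm)
    (crs_pair (by omega) (by omega)).2
  refine ⟨_, _, (Blk.around_four_add_two (q := q) (k := k) (by omega) hq).congr ?_ ?_,
    h3.cast (by ring) (by ring) rfl rfl, card_toNat ?_, by omega, by omega⟩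
  · refine ms_ext fun t => ?_
    simp (discharger := omega) only [Multiset.count_add, Nat.cast_add, count_iv, count_sing]
    ring_nf
  · rw [abs_of_nonneg (by omega), abs_of_nonpos (by omega), abs_of_nonpos (by omega),
      abs_of_nonneg (by omega), abs_of_nonpos (by omega)]
    refine ms_ext fun t => ?_
    simp (discharger := omega) only [Multiset.count_add, Nat.cast_add, count_iv, count_sing,
      add_zero, Multiset.count_zero, Nat.cast_zero]
    ring_nf
  · simp (discharger := omega) only [Multiset.card_add, Nat.cast_add, card_iv,
      Multiset.card_singleton]
    push_cast
    ring

lemma iv_eq_range (a b : ℤ) :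
    iv a b = ((List.range (b - a).toNat).map (fun i : ℕ => a + i) : List ℤ) := by
  refine (Multiset.Nodup.ext (nodup_iv a b) ?_).2 fun t => ?_
  · rw [Multiset.coe_nodup]
    exact List.nodup_range.map fun i j h => by simpa using h
  · simp only [mem_iv, Multiset.mem_coe, List.mem_map, List.mem_range]
    constructor
    · intro h
      exact ⟨(t - a).toNat, by omega, by omega⟩
    · rintro ⟨i, hi, rfl⟩
      omega

/-- An open block given by explicit lists. -/
lemma OpenBlk.of_lists (P Q : List ℤ) {p y b u d d' : ℤ} (hP : P.IsChain Crs)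
    (hQ : Q.IsChain Crs) (hPy : P.head? = some (-1 - y)) (hPb : P.getLast? = some b)
    (hQu : Q.head? = some (-1 - u)) (hQd : Q.getLast? = some (d - 1 - u))
    (hV : (P ++ Q).Perm ((List.range (2 * p).toNat).map fun i : ℕ => -p + i))
    (hD : steps P + (steps Q + {d'}) =
      ((List.range (2 * p - 1).toNat).map fun i : ℕ => 1 + (i : ℤ) : List ℤ))
    (hy : 0 ≤ y) (hb : 0 ≤ b) (hu : 0 ≤ u) (hd : u < d) :
    OpenBlk Q.length p y b u d d' := by
  refine ⟨Q, steps Q, ⟨by omega, hb, P, steps P, ⟨P, hP, hPy, hPb, rfl, rfl⟩, ?_, ?_⟩,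
    ⟨Q, hQ, hQu, hQd, rfl, rfl⟩, rfl, hu, hd⟩
  · rw [iv_eq_range, Multiset.coe_add, Multiset.coe_eq_coe, show p - -p = 2 * p by ring]
    exact hV
  · rw [hD, iv_eq_range]

lemma OpenBlk.six_odd : OpenBlk 6 4 2 1 0 1 1 := by
  refine of_lists [-3, 1] [-1, 2, -4, 3, -2, 0] ?_ ?_ ?_ ?_ ?_ ?_ ?_ ?_ ?_ ?_ ?_ ?_ <;>
    first
    | decide
    | norm_num [Crs]

lemma OpenBlk.six_even : OpenBlk 6 4 2 1 1 2 2 := by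
  refine of_lists [-3, 1] [-2, 3, -4, 2, -1, 0] ?_ ?_ ?_ ?_ ?_ ?_ ?_ ?_ ?_ ?_ ?_ ?_ <;>
    first
    | decide
    | norm_num [Crs]

lemma OpenBlk.two_three : OpenBlk 2 2 1 1 0 1 2 := by
  refine of_lists [-2, 1] [-1, 0] ?_ ?_ ?_ ?_ ?_ ?_ ?_ ?_ ?_ ?_ ?_ ?_ <;>
    first
    | decide
    | norm_num [Crs]

lemma OpenBlk.two_even : OpenBlk 2 3 0 1 1 2 1 := by
  refine of_lists [-1, 2, -3, 1] [-2, 0] ?_ ?_ ?_ ?_ ?_ ?_ ?_ ?_ ?_ ?_ ?_ ?_ <;>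
    first
    | decide
    | norm_num [Crs]

lemma OpenBlk.two_zero : OpenBlk 2 5 1 1 0 3 1 := by
  refine of_lists [-2, 0, -5, 4, -4, 3, -3, 1] [-1, 2] ?_ ?_ ?_ ?_ ?_ ?_ ?_ ?_ ?_ ?_ ?_ ?_ <;>
    first
    | decide
    | norm_num [Crs]

lemma OpenBlk.two_one : OpenBlk 2 2 0 0 1 3 2 := by
  refine of_lists [-1, 0] [-2, 1] ?_ ?_ ?_ ?_ ?_ ?_ ?_ ?_ ?_ ?_ ?_ ?_ <;>
    first
    | decide
    | norm_num [Crs]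

lemma OpenBlk.two_two : OpenBlk 2 4 0 1 1 4 2 := by
  refine of_lists [-1, 0, -3, 3, -4, 1] [-2, 2] ?_ ?_ ?_ ?_ ?_ ?_ ?_ ?_ ?_ ?_ ?_ ?_ <;>
    first
    | decide
    | norm_num [Crs]

lemma OpenBlk.cast {n : ℕ} {p y b u d d' p₁ y₁ b₁ u₁ d₁ d₁' : ℤ} (h : OpenBlk n p y b u d d')
    (hp : p = p₁) (hy : y = y₁) (hb : b = b₁) (hu : u = u₁) (hd : d = d₁) (hd' : d' = d₁') :
    OpenBlk n p₁ y₁ b₁ u₁ d₁ d₁' := by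
  subst hp hy hb hu hd hd'
  exact h

/-- Open blocks whose strand closes to the difference `m` and whose path has the shape needed to
enlarge a core of size `m`. -/
lemma OpenBlk.exists (n : ℕ) (hn : Even n) (hn' : 2 ≤ n) (m : ℤ) (hm : n + 4 ≤ m) :
    ∃ y u d' : ℤ, OpenBlk n (y + 1 + m) y d' u m d' ∧ 4 * y ≤ n + 2 ∧ m ≤ 2 * u + 1 ∧
      u ≤ y + m / 2 := by
  obtain ⟨j, rfl⟩ := hn
  rcases Nat.even_or_odd' j with ⟨k, rfl | rfl⟩
  · rw [show 2 * k + 2 * k = 4 * k by ring] at *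
    rcases Int.even_or_odd' m with ⟨i, rfl | rfl⟩
    · have h := (four_even (q := i - k - 1) (k := k) (by omega) (by push_cast at hm; omega)).outer
        (q := i + 1 - k) (by push_cast at hm; omega)
      exact ⟨k, i, 2 * i, h.cast (by ring) rfl (by ring) (by ring) (by ring) (by ring),
        by push_cast; omega, by omega, by omega⟩
    · have h := (four_odd (q := i - k) (k := k) (by omega) (by push_cast at hm; omega)).outer
        (q := i + 1 - k) (by push_cast at hm; omega)
      exact ⟨k, i + 1, 2 * i + 1, h.cast (by ring) rfl (by ring) (by ring) (by ring) (by ring),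
        by push_cast; omega, by omega, by omega⟩
  · rw [show 2 * k + 1 + (2 * k + 1) = 4 * k + 2 by ring] at *
    obtain rfl | rfl | hk : k = 0 ∨ k = 1 ∨ 2 ≤ k := by omega
    · rcases Int.even_or_odd' m with ⟨i, rfl | rfl⟩
      · have h := (two_even.inner (q := i - 1) (by push_cast at hm; omega)).outer (q := i - 1)
          (by push_cast at hm; omega)
        exact ⟨0, i, 2 * i - 1, h.cast (by ring) rfl (by ring) (by ring) (by ring) (by ring),
          by norm_num, by omega, by omega⟩
      · have h := (two_three.inner (q := i) (by push_cast at hm; omega)).outer (q := i + 1)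
          (by push_cast at hm; omega)
        exact ⟨1, i, 2 * i + 2, h.cast (by ring) rfl (by ring) (by ring) (by ring) (by ring),
          by norm_num, by omega, by omega⟩
    · rcases Int.even_or_odd' m with ⟨i, rfl | rfl⟩
      · have h := (six_even.inner (q := i - 1) (by push_cast at hm; omega)).outer (q := i)
          (by push_cast at hm; omega)
        exact ⟨2, i, 2 * i, h.cast (by ring) rfl (by ring) (by ring) (by ring) (by ring),
          by norm_num, by omega, by omega⟩
      · have h := (six_odd.inner (q := i) (by push_cast at hm; omega)).outer (q := i)
          (by push_cast at hm; omega)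
        exact ⟨2, i, 2 * i + 1, h.cast (by ring) rfl (by ring) (by ring) (by ring) (by ring),
          by norm_num, by omega, by omega⟩
    · rcases Int.even_or_odd' m with ⟨i, rfl | rfl⟩
      · have h := (four_add_two_even (q := i - k) (k := k) hk (by push_cast at hm; omega)).outer
          (q := i - k) (by push_cast at hm; omega)
        exact ⟨k + 1, i, 2 * i, h.cast (by ring) rfl (by ring) (by ring) (by ring) (by ring),
          by push_cast; omega, by omega, by omega⟩
      · have h := (four_add_two_odd (q := i - k) (k := k) hk (by push_cast at hm; omega)).outer
          (q := i + 1 - k) (by push_cast at hm; omega)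
        exact ⟨k + 1, i, 2 * i + 1, h.cast (by ring) rfl (by ring) (by ring) (by ring) (by ring),
          by push_cast; omega, by omega, by omega⟩

/-- Every even cycle has an α-labelling together with a short path. -/
lemma Alpha.exists_even (n : ℕ) (hn : Even n) (hn' : 4 ≤ n) :
    ∃ p a : ℤ, Alpha [n] p (2 * p) a ∧ p ≤ n + 2 ∧ 4 * a ≤ n + 2 := by
  obtain ⟨j, rfl⟩ := hn
  rcases Nat.even_or_odd' j with ⟨k, rfl | rfl⟩
  · have h := ((OpenBlk.four_odd (q := k + 1) (k := k) (by omega) le_rfl).close (by ring)).dual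
    rw [show 2 * k + 2 * k = 4 * k by ring]
    exact ⟨_, _, h, by push_cast; omega, by push_cast; omega⟩
  · rw [show 2 * k + 1 + (2 * k + 1) = 4 * k + 2 by ring] at *
    obtain rfl | hk : k = 1 ∨ 2 ≤ k := by omega
    · exact ⟨_, _, OpenBlk.six_odd.close (by norm_num), by norm_num, by norm_num⟩
    · have h := ((OpenBlk.four_add_two_odd (q := k + 2) hk le_rfl).close (by ring)).dual
      exact ⟨_, _, h, by push_cast; omega, by push_cast; omega⟩

/-! ### Adding a cycle of odd length -/

/-- The main construction for cycles of odd length: the strand of an open block is closed by a new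
vertex lying below a core of size `m`, which creates the difference `m` and one larger
difference. -/
lemma Grace.odd_cycle {L : List ℕ} {n : ℕ} {m t k y u d' : ℤ} (h : Grace L m t k)
    (hB : OpenBlk n (y + 1 + m) y d' u m d') (hk : u ≤ y + k) (hu : u + 2 ≤ m) (ht : t ≤ m) :
    Grace ((n + 1) :: L) (5 * m + 2 * k + 4 * y - 4 * u + 1) (5 * m + 2 * k + 4 * y - 4 * u + 1)
      (3 * m + k + 2 * y - 2 * u + 1) := by
  have hb := h.bounds
  have hbB := hB.bounds
  obtain ⟨V, D, ⟨e, W, E, hc, hW, hE⟩, hr⟩ := h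
  obtain ⟨V', D', ⟨-, -, W', E', hs', hW', hE'⟩, hQ, hcard, -, -⟩ := hB
  -- `g + w` lower and `g + w - 1` upper vertices are placed between the block and the core
  obtain ⟨g, hg⟩ : ∃ g, g = k + y - u := ⟨_, rfl⟩
  obtain ⟨w, hw⟩ : ∃ w, w = m - u := ⟨_, rfl⟩
  obtain rfl : u = m - w := by omega
  obtain rfl : y = g + m - w - k := by omega
  have hany : ∀ u v, Any u v ∧ Any v u := fun _ _ => ⟨trivial, trivial⟩
  have hz : Str Any (g + w + m) 0
      (iv (g + w + m) (2 * g + 2 * w + m - 1) + (iv 0 (w - 1) + iv w (g + w)))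
      (iv (m + 1) (m + 1 + 2 * g) + iv (m + 2 + 2 * g) (m + 2 * g + 2 * w - 1)) := by
    have h2 : Str Any _ _ _ _ := Str.zig_out (x := g + w + m + g) (y := w - 2) (k := w - 1)
      (by omega) (by omega) fun u v _ _ _ _ => hany u v
    rcases eq_or_lt_of_le (show 0 ≤ g by omega) with hg0 | hg0
    · refine h2.cast (by omega) (by ring) ?_ ?_ <;> subst hg0
      · refine ms_ext fun t => ?_
        simp (discharger := omega) only [Multiset.count_add, Nat.cast_add, count_iv]
        ring_nf
      · refine ms_ext fun t => ?_
        simp (discharger := omega) only [Multiset.count_add, Nat.cast_add, count_iv]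
        ring_nf
    · have h1 : Str Any _ _ _ _ := Str.zig_out (x := g + w + m) (y := g + w - 1) (k := g)
        hg0 (by omega) fun u v _ _ _ _ => hany u v
      refine (h1.append h2 trivial).cast rfl (by ring) ?_ ?_
      · refine ms_ext fun t => ?_
        simp (discharger := omega) only [Multiset.count_add, Nat.cast_add, count_iv]
        ring_nf
      · rw [abs_of_nonneg (by omega)]
        refine ms_ext fun t => ?_
        simp (discharger := omega) only [Multiset.count_add, Nat.cast_add, count_iv, count_sing]
        ring_nf
  have hP := (hs'.map (R' := Any) (f := lift (2 * g + 2 * w - 1 + m))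
    (g := (· + (2 * g + 2 * w - 1 + m))) (fun x y h => h.lift (by omega))).reverse
    (fun _ _ _ => trivial)
  have hQ' := hQ.map (R' := Any) (f := lift (2 * g + 2 * w - 1 + m))
    (g := (· + (2 * g + 2 * w - 1 + m))) (fun x y h => h.lift (by omega))
  rw [lift, lift, if_neg (by omega), if_pos (by omega)] at hP
  rw [lift, lift, if_pos (by omega), if_neg (by omega)] at hQ'
  have hpath := ((hz.append hP trivial).append (hc.shift (g + w)) trivial).shift
    (g + m - w - k + 1 + m)
  have hcyc := (hQ'.append (Str.single Any (w - 1)) trivial).shift (g + m - w - k + 1 + m)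
  have e1 : |d' + (2 * g + 2 * w - 1 + m) - 0| = d' + (2 * g + 2 * w - 1 + m) := by
    rw [abs_of_nonneg] <;> omega
  have e2 : |k + (g + w) - (-1 - (g + m - w - k))| = 2 * g + m + 1 := by
    rw [abs_of_nonneg] <;> omega
  have e3 : |w - 1 - (m - 1 - (m - w) + (2 * g + 2 * w - 1 + m))| = m + 2 * g + 2 * w - 1 := by
    rw [abs_of_nonpos] <;> omega
  have e4 : |-1 - (m - w) + (g + m - w - k + 1 + m) - (w - 1 + (g + m - w - k + 1 + m))| = m := by
    rw [abs_of_nonpos] <;> omega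
  rw [e1, e2] at hpath
  rw [e3] at hcyc
  have hrest := (hr.map (R' := Any) (t' := t) (fun x y _ => Any.shift (g + w) x y)
    (fun v hv => hv)).map (R' := Any) (t' := t)
    (fun x y _ => Any.shift (g + m - w - k + 1 + m) x y) (fun v hv => hv)
  rw [Multiset.map_id, Multiset.map_id] at hrest
  have hD : E'.map (· + (2 * g + 2 * w - 1 + m)) + D'.map (· + (2 * g + 2 * w - 1 + m)) +
      {d' + (2 * g + 2 * w - 1 + m)} = iv (2 * g + 2 * w + m)
        (4 * g + 5 * m - 2 * k + 1) := by
    have := congrArg (Multiset.map (· + (2 * g + 2 * w - 1 + m))) hE'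
    rw [Multiset.map_add, Multiset.map_add, Multiset.map_singleton, map_add_iv, ← add_assoc] at this
    rw [this]
    congr 1 <;> ring
  have hV : W'.map (lift (2 * g + 2 * w - 1 + m)) + V'.map (lift (2 * g + 2 * w - 1 + m)) =
      iv (-(g + m - w - k + 1 + m)) 0 +
        iv (2 * g + 2 * w - 1 + m) (g + m - w - k + 1 + m + (2 * g + 2 * w - 1 + m)) := by
    rw [← Multiset.map_add, hW', map_lift (by omega)]
  have hV₀ : W.map (· + (g + w)) + V.map (· + (g + w)) = iv (g + w) (m + (g + w)) := by
    rw [← Multiset.map_add, hW, map_add_iv, zero_add]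
  have hVt : iv (g + w + m) (2 * g + 2 * w + m - 1) + (iv 0 (w - 1) + iv w (g + w)) +
      W'.map (lift (2 * g + 2 * w - 1 + m)) + W.map (· + (g + w)) +
      (V'.map (lift (2 * g + 2 * w - 1 + m)) + {w - 1} + V.map (· + (g + w))) =
      iv (-(g + m - w - k + 1 + m)) (g + m - w - k + 1 + m + (2 * g + 2 * w - 1 + m)) := by
    calc _ = iv (g + w + m) (2 * g + 2 * w + m - 1) + (iv 0 (w - 1) + iv w (g + w)) + {w - 1} +
          (W'.map (lift (2 * g + 2 * w - 1 + m)) + V'.map (lift (2 * g + 2 * w - 1 + m))) +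
          (W.map (· + (g + w)) + V.map (· + (g + w))) := by abel
      _ = _ := by
        rw [hV, hV₀]
        refine ms_ext fun t => ?_
        simp (discharger := omega) only [Multiset.count_add, Nat.cast_add, count_iv, count_sing]
        ring_nf
  have hDt : iv (m + 1) (m + 1 + 2 * g) + iv (m + 2 + 2 * g) (m + 2 * g + 2 * w - 1) +
      {d' + (2 * g + 2 * w - 1 + m)} + E'.map (· + (2 * g + 2 * w - 1 + m)) +
      {2 * g + m + 1} + E + (D'.map (· + (2 * g + 2 * w - 1 + m)) + {m + 2 * g + 2 * w - 1} + 0 +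
      {m} + D) = iv 1 (4 * g + 5 * m - 2 * k + 1) := by
    calc _ = iv (m + 1) (m + 1 + 2 * g) + iv (m + 2 + 2 * g) (m + 2 * g + 2 * w - 1) +
          {2 * g + m + 1} + {m + 2 * g + 2 * w - 1} + {m} +
          (E'.map (· + (2 * g + 2 * w - 1 + m)) + D'.map (· + (2 * g + 2 * w - 1 + m)) +
            {d' + (2 * g + 2 * w - 1 + m)}) + (E + D) := by abel
      _ = _ := by
        rw [hD, hE]
        refine ms_ext fun t => ?_
        simp (discharger := omega) only [Multiset.count_add, Nat.cast_add, count_iv, count_sing]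
        ring_nf
  refine ⟨_, _, ⟨_, _, _, hpath.cast (by ring) rfl rfl rfl, ?_, ?_⟩,
    Rest.cons hcyc trivial ?_ ?_ (hrest.mono ?_)⟩
  · rw [← Multiset.map_add, ← Multiset.map_add, hVt, map_add_iv]
    congr 1 <;> ring
  · rw [e4, hDt]
    congr 1
    ring
  · simp [hcard]
  · rw [e4]
    intro v hv
    have : v ∈ iv 1 (4 * g + 5 * m - 2 * k + 1) := by
      rw [← hDt]
      exact Multiset.mem_add.2 (Or.inr (Multiset.mem_add.2 (Or.inl hv)))
    have := (mem_iv.1 this).2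
    omega
  · omega

/-! ### Cores with cycles of odd length -/

/-- Repeated addition of cycles of odd length. -/
lemma Grace.odd_cycles (lam : ℤ) (hlam : 3 ≤ lam) :
    ∀ (L : List ℕ) (c : ℕ), (∀ l ∈ c :: L, Odd l ∧ 3 ≤ l ∧ (l : ℤ) ≤ lam) → ∀ e : ℤ,
    ∃ M m k : ℤ, Grace (c :: L) M M k ∧ (2 : ℤ) ∣ M - e ∧ 2 * k = M + m + 1 ∧ lam + 3 ≤ m ∧
      4 * m ≤ M ∧
      (L = [] → M ≤ 5 * lam + 20) ∧ (L ≠ [] → 3 * M ≤ 7 ^ L.length * (10 * lam + 40)) := by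
  have step : ∀ (L : List ℕ) (c : ℕ) (m k : ℤ), Odd c → 3 ≤ c → (c : ℤ) ≤ lam → lam + 3 ≤ m →
      Grace L m m k → m ≤ 2 * k + 1 → ∃ M K : ℤ, Grace (c :: L) M M K ∧ (2 : ℤ) ∣ M - (m + 1) ∧
        2 * K = M + m + 1 ∧ 3 * m + 2 * k + 1 ≤ M ∧ M ≤ 3 * m + 2 * k + lam + 4 := by
    intro L c m k hc h3 hcl hm h hk
    obtain ⟨j, rfl⟩ := hc
    obtain ⟨y, u, d', hB, hy, hu, hu'⟩ := OpenBlk.exists (2 * j) (by simp) (by omega) m (by omega)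
    push_cast at hy hcl
    exact ⟨_, _, h.odd_cycle hB (by omega) (by omega) le_rfl, by omega, by omega, by omega,
      by omega⟩
  intro L
  induction L with
  | nil =>
    intro c hc e
    obtain ⟨h1, h2, h3⟩ := hc c (by simp)
    obtain ⟨m, hm⟩ : ∃ m : ℤ, (m = lam + 3 ∨ m = lam + 4) ∧ (2 : ℤ) ∣ m + 1 - e := by
      by_cases h : (2 : ℤ) ∣ lam + 4 - e
      · exact ⟨lam + 3, by simp, by omega⟩
      · exact ⟨lam + 4, by simp, by omega⟩
    obtain ⟨M, K, hG, hd, hK, h4, h5⟩ := step [] c m (m / 2) h1 h2 h3 (by omega)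
      (Grace.path m (by omega) rfl) (by omega)
    exact ⟨M, m, K, hG, by omega, hK, by omega, by omega, fun _ => by omega, by simp⟩
  | cons c' L ih =>
    intro c hc e
    obtain ⟨h1, h2, h3⟩ := hc c (by simp)
    obtain ⟨M, m, k, hG, hd, hk, hm, hM, hb, hb'⟩ := ih c' (fun l hl => hc l (by simp_all)) (e - 1)
    obtain ⟨M', K, hG', hd', hK, h4, h5⟩ := step (c' :: L) c M k h1 h2 h3 (by omega) hG (by omega)
    refine ⟨M', M, K, hG', by omega, hK, by omega, by omega, by simp, fun _ => ?_⟩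
    -- the size grows by a factor of at most `14 / 3 ≤ 7`
    have h6 : 3 * M' ≤ 14 * M := by omega
    rcases eq_or_ne L [] with rfl | hL
    · have := hb rfl
      simp only [List.length_cons, List.length_nil]
      norm_num
      omega
    · have h7 := hb' hL
      rw [List.length_cons, pow_succ]
      have h8 : 7 ^ L.length * (10 * lam + 40) * 7 = 7 ^ L.length * 7 * (10 * lam + 40) := by ring
      omega

/-- The bounds of `Grace.odd_cycles` in terms of `7 ^ (|L| - 1) * (2 * lam + 1)`. -/
lemma Grace.odd_cycles' (lam : ℤ) (hlam : 3 ≤ lam) (L : List ℕ) (hL : L ≠ [])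
    (hL' : ∀ l ∈ L, Odd l ∧ 3 ≤ l ∧ (l : ℤ) ≤ lam) (e X : ℤ)
    (hX : X = 7 ^ (L.length - 1) * (2 * lam + 1)) :
    ∃ M m k : ℤ, Grace L M M k ∧ (2 : ℤ) ∣ M - e ∧ 2 * k = M + m + 1 ∧ 6 ≤ m ∧ 4 * m ≤ M ∧
      3 * M ≤ 10 * X + 35 ∧ 7 ≤ X := by
  obtain ⟨c, L, rfl⟩ := List.exists_cons_of_ne_nil hL
  obtain ⟨M, m, k, h1, h2, h3, h4, h5, h6, h7⟩ := Grace.odd_cycles lam hlam L c hL' e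
  rw [List.length_cons, Nat.add_sub_cancel] at hX
  have hp : (1 : ℤ) ≤ 7 ^ L.length := one_le_pow₀ (by norm_num)
  refine ⟨M, m, k, h1, h2, h3, by omega, h5, ?_, ?_⟩
  · rcases eq_or_ne L [] with rfl | hL
    · have := h6 rfl
      simp at hX
      omega
    · have := h7 hL
      nlinarith
  · nlinarith

/-! ### Blocks with several cycles of even length -/

lemma Alpha.even_cycle {n : ℕ} {mu del : ℤ} (hn : Even n) (hn' : 4 ≤ n) (hmu : n ≤ mu)
    (hdel : mu + 2 ≤ del) :
    ∃ p, Alpha [n] p (2 * p) del ∧ 4 * p ≤ 4 * del + mu + 6 := by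
  obtain ⟨p, a, h, hp, ha⟩ := Alpha.exists_even n hn hn'
  have hb := h.bounds
  have h1 := ((Alpha.path (p := del + 1 + a - p) (-2 * p) hb.1 (by omega)).comp
    (h.mono (t' := 2 * (del + 1 + a)) (by omega)) (by omega)).dual
  rw [List.nil_append, sub_add_cancel, show del + 1 + a - 1 - a = del by ring] at h1
  exact ⟨del + 1 + a, h1, by omega⟩

/-- A block with cycles of prescribed even lengths and prescribed end of its path. -/
lemma Alpha.even_cycles {mu del : ℤ} (hdel : mu + 2 ≤ del) :
    ∀ L : List ℕ, L ≠ [] → (∀ l ∈ L, Even l ∧ 4 ≤ l ∧ (l : ℤ) ≤ mu) →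
    ∃ p, Alpha L p (2 * p) del ∧ 4 * p ≤ L.length * (4 * del + mu + 6) := by
  intro L
  induction L with
  | nil => simp
  | cons c L ih =>
    intro _ hc
    obtain ⟨h1, h2, h3⟩ := hc c (by simp)
    obtain ⟨p, hp, hp'⟩ := Alpha.even_cycle h1 h2 h3 hdel
    rcases eq_or_ne L [] with rfl | hL
    · exact ⟨p, hp, by simpa using hp'⟩
    · obtain ⟨q, hq, hq'⟩ := ih hL fun l hl => hc l (by simp_all)
      have := hp.bounds
      refine ⟨p + q, hp.comp (hq.mono (by omega)) (by omega), ?_⟩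
      push_cast [List.length_cons]
      linarith

/-- Surrounding a core by a block with cycles of even length, where the path of the core starts
sufficiently far from both ends. -/
lemma Grace.wrap_even {L L' : List ℕ} {m t j p del : ℤ} (h : Grace L m t j)
    (h' : Alpha L' p (2 * p) del) (hp : p ≤ j) (ht : t ≤ m) :
    Grace (L' ++ L) (m + 2 * (j + 1 + del)) (m + 2 * p) j := by
  have hb := h'.bounds
  have h1 := ((Alpha.path (p := j + 1 + del - p) 0 hb.1 (by omega)).comp h' (by omega)).dual
  rw [List.nil_append, sub_add_cancel, show j + 1 + del - 1 - del = j by ring] at h1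
  exact h.wrap h1 (by omega) (by omega)

/-- A core with cycles of prescribed odd and even lengths, at least one of them odd.  The number
`X` measures the odd lengths, and `Z` and `mu` the even ones. -/
lemma Grace.mixed_cycles {lam X mu Z W : ℤ} {Lo Le : List ℕ} (hlam : 3 ≤ lam) (hLo : Lo ≠ [])
    (hLo' : ∀ l ∈ Lo, Odd l ∧ 3 ≤ l ∧ (l : ℤ) ≤ lam)
    (hX : X = 7 ^ (Lo.length - 1) * (2 * lam + 1))
    (hLe : ∀ l ∈ Le, Even l ∧ 4 ≤ l ∧ (l : ℤ) ≤ mu) (hmu : 0 ≤ mu)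
    (hZ : Z = Le.length * (mu + 3)) (hW : W = max 1 (2 * Z - 1)) (e : ℤ) :
    ∃ S t j : ℤ, Grace (Le ++ Lo) S t j ∧ (2 : ℤ) ∣ S - e ∧ 7 ≤ j ∧
      S + 2 * j + 2 ≤ 10 * X + 8 * W + 14 + mu ∧ 2 * t ≤ 10 * X + 8 * W + 14 + mu ∧
      2 * S + 4 * j + 13 ≤ 70 * X + 8 * W + 14 + mu ∧ 8 * j + 40 ≤ 70 * X + 8 * W + 14 + mu := by
  obtain ⟨M, m, k, hG, hd, hk, hm, hM, hMX, hX7⟩ :=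
    Grace.odd_cycles' lam hlam Lo hLo hLo' e X hX
  rcases eq_or_ne Le [] with rfl | hne
  · simp at hZ
    exact ⟨M, M, _, hG.refl, hd, by omega, by omega, by omega, by omega, by omega⟩
  obtain ⟨p, hp, hp'⟩ := Alpha.even_cycles (mu := mu) (del := mu + 2) le_rfl Le hne hLe
  have hlen : (1 : ℤ) ≤ Le.length := by
    have := List.length_pos_iff.2 hne
    omega
  have hZ1 : mu + 3 ≤ Z := by nlinarith
  have hZ2 : 4 * p ≤ 5 * Z := by nlinarith
  have hpb := hp.bounds
  by_cases h1 : p ≤ M - 1 - k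
  · exact ⟨_, _, _, hG.refl.wrap_even hp h1 le_rfl, by omega, by omega, by omega, by omega,
      by omega, by omega⟩
  by_cases h2 : p ≤ k
  · exact ⟨_, _, _, hG.wrap_even hp h2 le_rfl, by omega, by omega, by omega, by omega,
      by omega, by omega⟩
  · obtain ⟨q, hq1, hq2, hq3⟩ : ∃ q : ℤ, M - 1 - k < q ∧ p - k ≤ 2 * q ∧
        (q = M - k ∨ 2 * q ≤ p - k + 1) := by
      by_cases h : M - k ≤ (p - k + 1) / 2
      · exact ⟨(p - k + 1) / 2, by omega, by omega, by omega⟩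
      · exact ⟨M - k, by omega, by omega, by omega⟩
    have h3 := (hG.refl.wrap_path hq1).refl
    exact ⟨_, _, _, h3.wrap_even hp (by omega) (by omega), by omega, by omega, by omega, by omega,
      by omega, by omega⟩

/-- A graceful labelling of a long path with cycles of prescribed lengths in which the differences
in the cycles are small. -/
lemma Grace.exists {lam X mu Z W n : ℤ} {Lo Le : List ℕ}
    (hLo' : ∀ l ∈ Lo, Odd l ∧ 3 ≤ l ∧ (l : ℤ) ≤ lam)
    (hX : Lo ≠ [] → 3 ≤ lam ∧ X = 7 ^ (Lo.length - 1) * (2 * lam + 1))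
    (hLe : ∀ l ∈ Le, Even l ∧ 4 ≤ l ∧ (l : ℤ) ≤ mu) (hmu : 0 ≤ mu)
    (hZ : Z = Le.length * (mu + 3)) (hW : W = max 1 (2 * Z - 1))
    (hn : 10 * max 3 X + 8 * W + 14 + mu ≤ n) :
    ∃ t k : ℤ, Grace (Le ++ Lo) n t k ∧ 2 * t ≤ n := by
  rcases eq_or_ne Lo [] with rfl | hne
  · rcases eq_or_ne Le [] with rfl | hne'
    · exact ⟨0, _, Grace.path (m := n) 0 (by omega) rfl, by omega⟩
    · obtain ⟨p, hp, hp'⟩ := Alpha.even_cycles (mu := mu) (del := mu + 2) le_rfl Le hne' hLe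
      have hlen : (1 : ℤ) ≤ Le.length := by
        have := List.length_pos_iff.2 hne'
        omega
      have hZ1 : mu + 3 ≤ Z := by nlinarith
      have hZ2 : 4 * p ≤ 5 * Z := by nlinarith
      have hpb := hp.bounds
      obtain ⟨m, hm, hmn⟩ : ∃ m : ℤ, (m = 2 * p + 1 ∨ m = 2 * p + 2) ∧ (2 : ℤ) ∣ n - m := by
        by_cases h : (2 : ℤ) ∣ n - (2 * p + 1)
        · exact ⟨_, Or.inl rfl, h⟩
        · exact ⟨_, Or.inr rfl, by omega⟩
      have h1 := (Grace.path (m := m) m (by omega) rfl).wrap_even hp (by omega) le_rfl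
      obtain ⟨q, hq⟩ : ∃ q, n = m + 2 * (m / 2 + 1 + (mu + 2)) + 2 * q :=
        ⟨(n - (m + 2 * (m / 2 + 1 + (mu + 2)))) / 2, by omega⟩
      have h2 := h1.wrap_path (p := q) (by omega)
      rw [← hq] at h2
      exact ⟨_, _, h2, by omega⟩
  · obtain ⟨hlam, hX⟩ := hX hne
    obtain ⟨S, t, j, hG, hd, hj, h1, h2, -, -⟩ :=
      Grace.mixed_cycles hlam hne hLo' hX hLe hmu hZ hW n
    obtain ⟨q, hq⟩ : ∃ q, n = S + 2 * q := ⟨(n - S) / 2, by omega⟩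
    have h3 := hG.wrap_path (p := q) (by omega)
    rw [← hq] at h3
    exact ⟨_, _, h3, by omega⟩

/-! ### Labellings with one component that is an edge -/

/-- A labelling with the labels `0, …, n - 1` of a path, of cycles of the lengths in `L` and of
one edge of difference `d`, such that the difference `n - d` does not occur and each other
difference between `1` and `n - 1` occurs once; the differences in the cycles are less than
`t`. -/
def GraceEdge (L : List ℕ) (n t : ℤ) : Prop :=
  ∃ k V D x d, Core n k (V + ({x} + {x + d})) (D + ({d} + {n - d})) ∧ Rest Any t L V D ∧ 0 < d ∧
    d < n

lemma Str.of_card_two {R : ℤ → ℤ → Prop} {a b : ℤ} {V D : Multiset ℤ} (h : Str R a b V D)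
    (hV : V.card = 2) : V = {a} + {b} ∧ D = {|b - a|} := by
  obtain ⟨l, -, ha, hb, rfl, rfl⟩ := h
  rw [Multiset.coe_card] at hV
  obtain ⟨x, y, rfl⟩ := List.length_eq_two.1 hV
  simp at ha hb
  subst ha hb
  exact ⟨rfl, rfl⟩

/-- A block with one open edge is placed around a labelling with `S` labels.  Its difference `d` and
its missing difference `d'` become `S + d` and `S + d'`, whose sum has to be the final number of
labels. -/
lemma Grace.edge {L : List ℕ} {S t j p y u d d' n w : ℤ} (h : Grace L S t j)
    (h' : OpenBlk 2 p y j u d d') (hn : n = 2 * S + d + d') (hw : p - 1 - y < w)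
    (hn' : n = S + 2 * p + 2 * w) : GraceEdge L n t := by
  have hb := h.bounds
  have hb' := h'.bounds
  obtain ⟨V, D, hc, hr⟩ := h
  obtain ⟨V', D', hB, hs, hcard, -, -⟩ := h'
  have hd' : 0 < d' := by
    obtain ⟨-, -, W, E, -, -, hE⟩ := hB
    have : d' ∈ iv 1 (2 * p) := by
      rw [← hE]
      simp
    exact (mem_iv.1 this).1
  obtain ⟨rfl, rfl⟩ := hs.of_card_two hcard
  have e : |d - 1 - u - (-1 - u)| = d := by
    rw [abs_of_nonneg] <;> omega
  rw [e] at hB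
  have h1 := hc.wrap hB
  have h2 := h1.wrap (Blk.path w (-1 - y + p) (by omega) (by omega))
  have hr1 := (hr.map (R' := Any) (t' := t) (fun x y _ => Any.shift p x y)
    (fun v hv => hv)).map (R' := Any) (t' := t) (fun x y _ => Any.shift w x y) (fun v hv => hv)
  refine ⟨-1 - y + p - w + w, _, _, -1 - u + p + w, d + S, ?_, hr1, by omega, by omega⟩
  convert h2 using 1
  · have e1 : lift S (-1 - u) = -1 - u := if_pos (by omega)
    have e2 : lift S (d - 1 - u) = d - 1 - u + S := if_neg (by omega)
    simp only [Multiset.map_add, Multiset.map_zero, zero_add, Multiset.map_singleton, e1, e2]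
    rw [add_comm, show -1 - u + p + w + (d + S) = d - 1 - u + S + p + w by ring]
  · simp only [Multiset.map_add, Multiset.map_zero, zero_add, Multiset.map_singleton,
      Multiset.map_id]
    rw [add_comm, show n - (d + S) = d' + S by omega]

/-- For each residue class modulo `4` there is a block with one edge whose difference and whose
missing difference have their sum in this class. -/
lemma OpenBlk.exists_two (c : ℤ) : ∃ p y b u d d' : ℤ, OpenBlk 2 p y b u d d' ∧
    (4 : ℤ) ∣ c - (d + d') ∧ 3 ≤ d + d' ∧ d + d' ≤ 6 ∧ p ≤ 5 ∧ y ≤ 1 ∧ b ≤ 1 ∧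
    4 * (p - b) ≤ d + d' + 12 := by
  obtain h | h | h | h : (4 : ℤ) ∣ c - 4 ∨ (4 : ℤ) ∣ c - 5 ∨ (4 : ℤ) ∣ c - 6 ∨ (4 : ℤ) ∣ c - 3 := by
    omega
  · exact ⟨_, _, _, _, _, _, two_zero, by norm_num [h]⟩
  · exact ⟨_, _, _, _, _, _, two_one, by norm_num [h]⟩
  · exact ⟨_, _, _, _, _, _, two_two, by norm_num [h]⟩
  · exact ⟨_, _, _, _, _, _, two_three, by norm_num [h]⟩

/-- A graceful labelling of a long path with cycles of prescribed lengths and one edge, in which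
the differences in the cycles are small. -/
lemma GraceEdge.exists {lam X mu Z W n : ℤ} {Lo Le : List ℕ}
    (hLo' : ∀ l ∈ Lo, Odd l ∧ 3 ≤ l ∧ (l : ℤ) ≤ lam)
    (hX : Lo ≠ [] → 3 ≤ lam ∧ X = 7 ^ (Lo.length - 1) * (2 * lam + 1))
    (hLe : ∀ l ∈ Le, Even l ∧ 4 ≤ l ∧ (l : ℤ) ≤ mu) (hmu : 0 ≤ mu)
    (hZ : Z = Le.length * (mu + 3)) (hW : W = max 1 (2 * Z - 1))
    (hn : 10 * max 3 (7 * X) + 8 * W + 14 + mu ≤ n) :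
    ∃ t : ℤ, GraceEdge (Le ++ Lo) n t ∧ 2 * t ≤ n := by
  obtain ⟨p, y, b, u, d, d', hB, hd4, hd3, hd6, hp5, hy1, hb1, hpb⟩ :=
    OpenBlk.exists_two (n - 2 * n)
  have hBb := hB.bounds
  rcases eq_or_ne Lo [] with rfl | hne
  · rcases eq_or_ne Le [] with rfl | hne'
    · -- the core has at most three vertices
      obtain ⟨m, k, hG, hk, hm1, hm3, hmn⟩ : ∃ m k : ℤ, Grace [] m 0 k ∧ k = b ∧ 1 ≤ m ∧ m ≤ 3 ∧
          (2 : ℤ) ∣ n - m := by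
        obtain rfl | rfl : b = 0 ∨ b = 1 := by omega
        · by_cases h : (2 : ℤ) ∣ n - 1
          · exact ⟨1, 0, Grace.path 0 (by norm_num) (by norm_num), by omega⟩
          · have h1 := (Grace.path (m := 2) (k := 1) 0 (by norm_num) (by norm_num)).refl
            exact ⟨2, 0, by simpa using h1, by omega⟩
        · by_cases h : (2 : ℤ) ∣ n - 2
          · exact ⟨2, 1, Grace.path 0 (by norm_num) (by norm_num), by omega⟩
          · exact ⟨3, 1, Grace.path 0 (by norm_num) (by norm_num), by omega⟩
      obtain ⟨i, hi⟩ : ∃ i, n = 2 * (m + 2 * i) + d + d' := ⟨(n - 2 * m - d - d') / 4, by omega⟩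
      subst hk
      have h5 := hG.wrap_path (p := i) (by omega)
      exact ⟨0, h5.edge hB hi (w := (n - (m + 2 * i) - 2 * p) / 2) (by omega) (by omega),
        by omega⟩
    · obtain ⟨del, m, hdel, hdel', hm⟩ : ∃ del m : ℤ, mu + 2 ≤ del ∧ del ≤ mu + 3 ∧
          2 * (m + 2 * (m / 2 + 1 + del)) = n - d - d' := by
        by_cases hn2 : (2 : ℤ) ∣ n
        · by_cases h : (2 : ℤ) ∣ (n - d - d') / 4 - 1 - (mu + 2)
          · exact ⟨mu + 2, (n - d - d') / 4 - 1 - (mu + 2), by omega⟩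
          · exact ⟨mu + 3, (n - d - d') / 4 - 1 - (mu + 3), by omega⟩
        · by_cases h : (2 : ℤ) ∣ ((n - d - d') / 2 - 1) / 2 - 1 - (mu + 2)
          · exact ⟨mu + 2, ((n - d - d') / 2 - 1) / 2 - (mu + 2), by omega⟩
          · exact ⟨mu + 3, ((n - d - d') / 2 - 1) / 2 - (mu + 3), by omega⟩
      obtain ⟨q, hq, hq'⟩ := Alpha.even_cycles (mu := mu) (del := del) hdel Le hne' hLe
      have hlen : (1 : ℤ) ≤ Le.length := by
        have := List.length_pos_iff.2 hne'
        omega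
      have hZ1 : mu + 3 ≤ Z := by nlinarith
      have hmu4 : 4 ≤ mu := by
        obtain ⟨c, L, rfl⟩ := List.exists_cons_of_ne_nil hne'
        have := hLe c (by simp)
        omega
      have hZ3 : 7 * (Le.length : ℤ) ≤ Z := by nlinarith
      have hZ2 : 4 * q ≤ 5 * Z + 3 * Le.length := by nlinarith
      have hqb := hq.bounds
      have h1 := (Grace.path (m := m) m (by omega) rfl).wrap_even hq (by omega) le_rfl
      have h2 := hB.outer (q := m / 2 - b) (by omega)
      rw [add_sub_cancel] at h2
      exact ⟨_, h1.edge h2 (n := n) (w := (n - (m + 2 * (m / 2 + 1 + del)) - 2 * (p + (m / 2 - b))) / 2)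
        (by omega) (by omega) (by omega), by omega⟩
  · obtain ⟨hlam, hX⟩ := hX hne
    obtain ⟨S, t, j, hG, hd, hj, -, h2, h3, h4⟩ :=
      Grace.mixed_cycles hlam hne hLo' hX hLe hmu hZ hW n
    obtain ⟨i, hi⟩ : ∃ i, n = 2 * (S + 2 * i) + d + d' := ⟨(n - 2 * S - d - d') / 4, by omega⟩
    have h5 := hG.wrap_path (p := i) (by omega)
    have h6 := hB.outer (q := j - b) (by omega)
    rw [add_sub_cancel] at h6
    exact ⟨_, h5.edge h6 hi (w := (n - (S + 2 * i) - 2 * (p + (j - b))) / 2) (by omega) (by omega),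
      by omega⟩

/-! ### Graphs made of closed lists -/

section ClosedLists

variable {W : Type*}

/-- Consecutive members of the list are related, and so are the last and the first one. -/
def ClosedChain (R : W → W → Prop) (C : List W) : Prop :=
  ∀ b ∈ C.getLast?, (b :: C).IsChain R

/-- The member with a given index of a given member of a list of lists. -/
def closedFun (Cs : List (List W)) :
    (Σ i : Fin (Cs.map List.length).length, Fin ((Cs.map List.length).get i)) → W :=
  fun x => (Cs[x.1.1]'(by simpa using x.1.2))[x.2.1]'(by simpa using x.2.2)

/-- The graph whose components are the cycles through the members of the lists in `Cs`, in their
order. -/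
def closedGraph (Cs : List (List W)) : SimpleGraph W :=
  (cycleUnion (Cs.map List.length).get).map (closedFun Cs)

lemma cycleUnion_adj {ι : Type*} {l : ι → ℕ} {x y : Σ i, Fin (l i)} :
    (cycleUnion l).Adj x y ↔
      ∃ i a b, (SimpleGraph.cycleGraph (l i)).Adj a b ∧ x = ⟨i, a⟩ ∧ y = ⟨i, b⟩ := by
  unfold cycleUnion
  simp only [SimpleGraph.iSup_adj, SimpleGraph.map_adj, Function.Embedding.sigmaMk_apply]
  constructor
  · rintro ⟨i, a, b, h, rfl, rfl⟩
    exact ⟨i, a, b, h, rfl, rfl⟩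
  · rintro ⟨i, a, b, h, rfl, rfl⟩
    exact ⟨i, a, b, h, rfl, rfl⟩

lemma fin_sub_val {n : ℕ} (u v : Fin n) :
    (v - u).val = 1 ↔ 2 ≤ n ∧ (v.val = u.val + 1 ∨ v.val = 0 ∧ u.val + 1 = n) := by
  have hu := u.2
  have hv := v.2
  have hs : (v - u).val = (n - u.val + v.val) % n := by rw [Fin.sub_def]
  rw [hs]
  rcases le_or_gt u.val v.val with h | h
  · rw [show n - u.val + v.val = (v.val - u.val) + n by omega, Nat.add_mod_right,
      Nat.mod_eq_of_lt (by omega)]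
    omega
  · rw [Nat.mod_eq_of_lt (by omega)]
    omega

lemma cycleGraph_adj_iff {n : ℕ} (u v : Fin n) : (SimpleGraph.cycleGraph n).Adj u v ↔
    2 ≤ n ∧ ((v.val = u.val + 1 ∨ v.val = 0 ∧ u.val + 1 = n) ∨
      (u.val = v.val + 1 ∨ u.val = 0 ∧ v.val + 1 = n)) := by
  rw [SimpleGraph.cycleGraph_adj', fin_sub_val, fin_sub_val]
  tauto

variable {Cs : List (List W)}

lemma closedGraph_adj_of {C : List W} (hC : C ∈ Cs) (hn : C.Nodup) {i j : ℕ} (hi : i < C.length)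
    (hj : j < C.length) (hl : 2 ≤ C.length) (h : j = i + 1 ∨ j = 0 ∧ i + 1 = C.length) :
    (closedGraph Cs).Adj C[i] C[j] := by
  obtain ⟨k, hk, rfl⟩ := List.mem_iff_getElem.1 hC
  refine ⟨fun h' => ?_, ⟨⟨k, by simpa using hk⟩, ⟨i, by simpa using hi⟩⟩,
    ⟨⟨k, by simpa using hk⟩, ⟨j, by simpa using hj⟩⟩, ?_, rfl, rfl⟩
  · have := (hn.getElem_inj_iff).1 h'
    omega
  · refine cycleUnion_adj.2 ⟨_, _, _, ?_, rfl, rfl⟩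
    rw [cycleGraph_adj_iff]
    refine ⟨by simpa using hl, Or.inl ?_⟩
    simpa using h

lemma closedGraph_closedChain {C : List W} (hC : C ∈ Cs) (hn : C.Nodup) (hl : 2 ≤ C.length) :
    ClosedChain (closedGraph Cs).Adj C := by
  intro b hb
  rw [List.isChain_cons, List.isChain_iff_getElem]
  refine ⟨fun a ha => ?_, fun i hi =>
    closedGraph_adj_of hC hn (by omega) hi (by omega) (Or.inl rfl)⟩
  have h := closedGraph_adj_of hC hn (i := C.length - 1) (j := 0) (by omega) (by omega) hl
    (Or.inr ⟨rfl, by omega⟩)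
  rw [Option.mem_def, List.head?_eq_getElem?, List.getElem?_eq_getElem (by omega)] at ha
  rw [Option.mem_def, List.getLast?_eq_getElem?, List.getElem?_eq_getElem (by omega)] at hb
  simp only [Option.some.injEq] at ha hb
  rwa [ha, hb] at h

/-- A symmetric relation that holds along all the closed lists holds along all the edges. -/
lemma closedGraph_le {R : W → W → Prop} (hR : ∀ u v, R u v → R v u)
    (h : ∀ C ∈ Cs, ClosedChain R C)
    {u v : W} (huv : (closedGraph Cs).Adj u v) : R u v := by
  have key : ∀ C ∈ Cs, ∀ i j : ℕ, (hi : i < C.length) → (hj : j < C.length) →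
      (j = i + 1 ∨ j = 0 ∧ i + 1 = C.length) → R C[i] C[j] := by
    intro C hC i j hi hj hij
    have hc := h C hC (C[C.length - 1]) (by
      rw [Option.mem_def, List.getLast?_eq_getElem?, List.getElem?_eq_getElem (by omega)])
    rw [List.isChain_cons] at hc
    rcases hij with rfl | ⟨rfl, hij⟩
    · exact List.isChain_iff_getElem.1 hc.2 i hj
    · have := hc.1 C[0] (by
        rw [Option.mem_def, List.head?_eq_getElem?, List.getElem?_eq_getElem (by omega)])
      simpa only [← hij, Nat.add_sub_cancel] using this
  obtain ⟨-, x, y, hxy, rfl, rfl⟩ := huv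
  obtain ⟨k, a, b, hab, rfl, rfl⟩ := cycleUnion_adj.1 hxy
  rw [cycleGraph_adj_iff] at hab
  have hk : k.1 < Cs.length := by simpa using k.2
  have ha : a.1 < Cs[k.1].length := by simpa using a.2
  have hb : b.1 < Cs[k.1].length := by simpa using b.2
  have hm : Cs[k.1] ∈ Cs := List.getElem_mem hk
  simp only [List.get_eq_getElem, List.getElem_map] at hab
  rcases hab.2 with h1 | h1
  · exact key _ hm a.1 b.1 ha hb h1
  · exact hR _ _ (key _ hm b.1 a.1 hb ha h1)

lemma closedFun_injective (hn : Cs.flatten.Nodup) : Function.Injective (closedFun Cs) := by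
  rw [List.nodup_flatten] at hn
  rintro ⟨i, a⟩ ⟨j, b⟩ h
  have hi : i.1 < Cs.length := by simpa using i.2
  have hj : j.1 < Cs.length := by simpa using j.2
  have ha : a.1 < Cs[i.1].length := by simpa using a.2
  have hb : b.1 < Cs[j.1].length := by simpa using b.2
  change Cs[i.1][a.1] = Cs[j.1][b.1] at h
  have hij : i = j := by
    by_contra hne
    have hne' : i.1 ≠ j.1 := fun h => hne (Fin.ext h)
    have hd := List.pairwise_iff_getElem.1 hn.2
    rcases lt_or_gt_of_ne hne' with hlt | hlt
    · exact hd _ _ hi hj hlt (List.getElem_mem ha) (h ▸ List.getElem_mem hb)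
    · exact hd _ _ hj hi hlt (List.getElem_mem hb) (h ▸ List.getElem_mem ha)
  subst hij
  have := (List.Nodup.getElem_inj_iff (hn.1 _ (List.getElem_mem hi))).1 h
  rw [Fin.ext this]

lemma closedFun_surjective (hc : ∀ w, w ∈ Cs.flatten) : Function.Surjective (closedFun Cs) := by
  intro w
  obtain ⟨C, hC, hw⟩ := List.mem_flatten.1 (hc w)
  obtain ⟨i, hi, rfl⟩ := List.mem_iff_getElem.1 hC
  obtain ⟨a, ha, rfl⟩ := List.mem_iff_getElem.1 hw
  exact ⟨⟨⟨i, by simpa using hi⟩, ⟨a, by simpa using ha⟩⟩, rfl⟩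

lemma exists_perm_map {α β : Type*} (f : α → β) {m : List β} : ∀ {l : List α},
    (l.map f).Perm m → ∃ l' : List α, l'.Perm l ∧ l'.map f = m := by
  induction m with
  | nil =>
    intro l h
    exact ⟨l, List.Perm.refl _, List.perm_nil.1 h⟩
  | cons b m ih =>
    intro l h
    have hb : b ∈ l.map f := h.symm.subset (by simp)
    obtain ⟨a, ha, rfl⟩ := List.mem_map.1 hb
    obtain ⟨l₁, l₂, rfl⟩ := List.append_of_mem ha
    have h1 : ((l₁ ++ l₂).map f).Perm m := by
      rw [← List.perm_cons (f a)]
      refine List.Perm.trans ?_ h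
      rw [← List.map_cons]
      exact (List.perm_middle.symm).map f
    obtain ⟨l', hl', rfl⟩ := ih h1
    exact ⟨a :: l', (hl'.cons a).trans List.perm_middle.symm, rfl⟩

/-- If the lists contain every vertex once, the graph depends only on their lengths. -/
lemma closedGraph_iso {V : Type*} {F : SimpleGraph V} {M : List ℕ}
    (hF : Nonempty (F ≃g cycleUnion M.get)) (hM : Cs.map List.length = M)
    (hn : Cs.flatten.Nodup) (hc : ∀ w, w ∈ Cs.flatten) : Nonempty (closedGraph Cs ≃g F) := by
  subst hM
  obtain ⟨φ⟩ := hF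
  exact ⟨(φ.trans (SimpleGraph.Iso.map (Equiv.ofBijective (closedFun Cs)
    ⟨closedFun_injective hn, closedFun_surjective hc⟩) _)).symm⟩

open Classical in
lemma closedGraph_card_edges [Fintype W] (hn : Cs.flatten.Nodup) (hc : ∀ w, w ∈ Cs.flatten) :
    (closedGraph Cs).edgeFinset.card ≤ Fintype.card W := by
  have key : ∀ x : Σ i : Fin (Cs.map List.length).length, Fin ((Cs.map List.length).get i),
      0 < (Cs.map List.length).get x.1 := fun x => x.2.pos
  -- `nx` is the successor on the cycles, and every edge is `{w, nx w}` for some `w`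
  let nx : (Σ i : Fin (Cs.map List.length).length, Fin ((Cs.map List.length).get i)) →
      (Σ i : Fin (Cs.map List.length).length, Fin ((Cs.map List.length).get i)) := fun x =>
    if h : x.2.1 + 1 < (Cs.map List.length).get x.1 then ⟨x.1, ⟨x.2.1 + 1, h⟩⟩
    else ⟨x.1, ⟨0, key x⟩⟩
  let e := Equiv.ofBijective (closedFun Cs) ⟨closedFun_injective hn, closedFun_surjective hc⟩
  have hnx : ∀ i a b, (b.val = a.val + 1 ∨ b.val = 0 ∧ a.val + 1 = (Cs.map List.length).get i) →
      nx ⟨i, a⟩ = ⟨i, b⟩ := by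
    intro i a b h
    have hb := b.2
    simp only [nx]
    split_ifs with h1
    · congr 1
      exact Fin.ext (by simp only; omega)
    · congr 1
      exact Fin.ext (by simp only; omega)
  have hsub : (closedGraph Cs).edgeFinset ⊆
      Finset.univ.image fun w : W => s(w, closedFun Cs (nx (e.symm w))) := by
    intro z hz
    rw [SimpleGraph.mem_edgeFinset] at hz
    induction z using Sym2.ind with
    | _ u v =>
      obtain ⟨-, x, y, hxy, rfl, rfl⟩ := hz
      obtain ⟨k, a, b, hab, rfl, rfl⟩ := cycleUnion_adj.1 hxy
      rw [cycleGraph_adj_iff] at hab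
      have he : ∀ x, e.symm (closedFun Cs x) = x := fun x => e.symm_apply_apply x
      rw [Finset.mem_image]
      rcases hab.2 with h1 | h1
      · exact ⟨_, Finset.mem_univ _, by rw [he, hnx _ _ _ h1]⟩
      · exact ⟨_, Finset.mem_univ _, by rw [he, hnx _ _ _ h1, Sym2.eq_swap]⟩
  exact (Finset.card_le_card hsub).trans (Finset.card_image_le.trans (by simp))

end ClosedLists

/-! ### Developing a starter factor -/

section Starter

/-- Translation by `y` on `ZMod (2 * n) ⊕ Fin f`: it fixes the points of `Fin f`. -/
def shift (n f : ℕ) (y : ZMod (2 * n)) : Equiv.Perm (ZMod (2 * n) ⊕ Fin f) :=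
  Equiv.sumCongr (Equiv.addRight y) (Equiv.refl _)

lemma map_equiv_adj {U U' : Type*} (G : SimpleGraph U) (e : U ≃ U') (u v : U') :
    (G.map e).Adj u v ↔ G.Adj (e.symm u) (e.symm v) := by
  constructor
  · rintro ⟨-, a, b, h, rfl, rfl⟩
    simpa using h
  · intro h
    exact ⟨fun h' => h.ne (by rw [h']), _, _, h, by simp, by simp⟩

lemma map_equiv_map {U : Type*} (G : SimpleGraph U) (e e' : Equiv.Perm U) :
    (G.map e).map e' = G.map (e' * e : Equiv.Perm U) := by
  ext u v
  simp only [map_equiv_adj]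
  rfl

variable {n f : ℕ}

lemma shift_inl (y a : ZMod (2 * n)) : shift n f y (Sum.inl a) = Sum.inl (a + y) := rfl

lemma shift_inr (y : ZMod (2 * n)) (i : Fin f) : shift n f y (Sum.inr i) = Sum.inr i := rfl

lemma shift_mul (y z : ZMod (2 * n)) : shift n f y * shift n f z = shift n f (z + y) := by
  ext u
  rcases u with a | i
  · simp [shift_inl, add_assoc]
  · simp [shift_inr]

lemma shift_zero : shift n f 0 = 1 := by
  ext u
  rcases u with a | i
  · simp [shift_inl]
  · simp [shift_inr]

lemma shift_symm (y : ZMod (2 * n)) : (shift n f y).symm = shift n f (-y) := by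
  rw [← Equiv.Perm.inv_def, inv_eq_iff_mul_eq_one, shift_mul, neg_add_cancel, shift_zero]

lemma half_add_half : (n : ZMod (2 * n)) + n = 0 := by
  have h := ZMod.natCast_self (2 * n)
  push_cast at h
  rw [← two_mul]
  exact h

lemma natCast_inj_of_lt {m a b : ℕ} (ha : a < m) (hb : b < m) (h : (a : ZMod m) = b) : a = b := by
  rw [ZMod.natCast_eq_natCast_iff] at h
  exact Nat.ModEq.eq_of_lt_of_lt h ha hb

lemma exists_natCast_or (hn : 0 < n) (z : ZMod (2 * n)) :
    ∃ x < n, z = (x : ZMod (2 * n)) ∨ z = (x : ZMod (2 * n)) + n := by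
  have : NeZero (2 * n) := ⟨by omega⟩
  have hz := ZMod.natCast_zmod_val z
  have hl := ZMod.val_lt z
  rcases lt_or_ge z.val n with h | h
  · exact ⟨z.val, h, Or.inl hz.symm⟩
  · refine ⟨z.val - n, by omega, Or.inr ?_⟩
    rw [← Nat.cast_add, Nat.sub_add_cancel h, hz]

/-- The moved by `y` of a graph on `ZMod (2 * n) ⊕ Fin f`. -/
def moved (G : SimpleGraph (ZMod (2 * n) ⊕ Fin f)) (y : ZMod (2 * n)) :
    SimpleGraph (ZMod (2 * n) ⊕ Fin f) :=
  G.map (shift n f y)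

variable {G : SimpleGraph (ZMod (2 * n) ⊕ Fin f)}

lemma moved_adj {y : ZMod (2 * n)} {u v : ZMod (2 * n) ⊕ Fin f} (h : G.Adj u v) :
    (moved G y).Adj (shift n f y u) (shift n f y v) := by
  rw [moved, map_equiv_adj]
  simpa using h

lemma moved_moved (y z : ZMod (2 * n)) :
    (moved G y).map (shift n f z) = moved G (y + z) := by
  rw [moved, map_equiv_map, shift_mul]
  rfl

lemma moved_half (hG : ∀ u v, G.Adj u v → G.Adj (shift n f n u) (shift n f n v)) :
    moved G n = G := by
  have hs : (shift n f n).symm = shift n f n := by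
    rw [shift_symm, neg_eq_of_add_eq_zero_left half_add_half]
  ext u v
  rw [moved, map_equiv_adj, hs]
  refine ⟨fun h => ?_, hG u v⟩
  have := hG _ _ h
  rwa [← Equiv.Perm.mul_apply, ← Equiv.Perm.mul_apply, shift_mul, half_add_half,
    shift_zero] at this

lemma moved_add_half (hG : ∀ u v, G.Adj u v → G.Adj (shift n f n u) (shift n f n v))
    (y : ZMod (2 * n)) : moved G (y + n) = moved G y := by
  rw [add_comm, ← moved_moved, moved_half hG]
  rfl

lemma exists_moved_eq (hn : 0 < n)
    (hG : ∀ u v, G.Adj u v → G.Adj (shift n f n u) (shift n f n v)) (z : ZMod (2 * n)) :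
    ∃ x < n, moved G z = moved G (x : ZMod (2 * n)) ∧
      (z = (x : ZMod (2 * n)) ∨ z = (x : ZMod (2 * n)) + n) := by
  obtain ⟨x, hx, h⟩ := exists_natCast_or hn z
  refine ⟨x, hx, ?_, h⟩
  rcases h with rfl | rfl
  · rfl
  · exact moved_add_half hG _

/-- The 1-factor of the pairs `{a, a + n}`, together with the edge between the two fixed points
when `f = 2`. -/
def halfFactor (n f : ℕ) : SimpleGraph (ZMod (2 * n) ⊕ Fin f) where
  Adj u v := u ≠ v ∧ ((∃ a, u = Sum.inl a ∧ v = Sum.inl (a + n)) ∨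
    ∃ i j, u = Sum.inr i ∧ v = Sum.inr j)
  symm := ⟨by
    rintro u v ⟨hne, ⟨a, rfl, rfl⟩ | ⟨i, j, rfl, rfl⟩⟩
    · exact ⟨hne.symm, Or.inl ⟨a + n, rfl, by rw [add_assoc, half_add_half, add_zero]⟩⟩
    · exact ⟨hne.symm, Or.inr ⟨j, i, rfl, rfl⟩⟩⟩
  loopless := ⟨fun u h => h.1 rfl⟩

lemma half_ne_zero (hn : 0 < n) : (n : ZMod (2 * n)) ≠ 0 := by
  intro h
  have := natCast_inj_of_lt (m := 2 * n) (a := n) (b := 0) (by omega) (by omega) (by simpa using h)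
  omega

lemma halfFactor_isOneFactor (hn : 0 < n) (hf : f = 0 ∨ f = 2) :
    IsOneFactor (halfFactor n f) := by
  have hh := half_ne_zero hn
  rintro (a | i)
  · refine ⟨Sum.inl (a + n), ⟨by simpa using hh, Or.inl ⟨a, rfl, rfl⟩⟩, ?_⟩
    rintro w ⟨-, ⟨b, hb, rfl⟩ | ⟨i, j, h, -⟩⟩
    · rw [Sum.inl.inj hb]
    · simp at h
  · rcases hf with rfl | rfl
    · exact i.elim0
    · refine ⟨Sum.inr (1 - i), ⟨?_, Or.inr ⟨i, 1 - i, rfl, rfl⟩⟩, ?_⟩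
      · have : ∀ i : Fin 2, i ≠ 1 - i := by decide
        exact fun h => this i (Sum.inr.inj h)
      · rintro w ⟨hne, ⟨b, hb, -⟩ | ⟨k, j, hk, rfl⟩⟩
        · simp at hb
        · have : i ≠ j := fun h => hne (by rw [h])
          have key : ∀ i j : Fin 2, i ≠ j → j = 1 - i := by decide
          rw [key i j this]

open Classical in
lemma IsOneFactor.two_mul_card_edges {U : Type*} [Fintype U] {J : SimpleGraph U}
    (hJ : IsOneFactor J) : 2 * J.edgeFinset.card = Fintype.card U := by
  rw [← SimpleGraph.sum_degrees_eq_twice_card_edges, Finset.sum_congr rfl fun v _ =>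
    SimpleGraph.degree_eq_one_iff_existsUnique_adj.2 (hJ v)]
  simp

open Classical in
/-- The number of edges of `K_v + σ J`. -/
lemma two_mul_sum_edgeMult {U : Type*} [Fintype U] {J : SimpleGraph U} {σ : ℤ}
    (hJ : σ ≠ 0 → IsOneFactor J) :
    2 * ∑ e, edgeMult σ J e = Fintype.card U * (Fintype.card U - 1 + σ) := by
  have h1 : ∑ e, edgeMult σ J e =
      ((⊤ : SimpleGraph U).edgeFinset.card : ℤ) + σ * (J.edgeFinset.card : ℤ) := by
    simp only [edgeMult, Finset.sum_add_distrib, ← Finset.mul_sum, Finset.sum_boole,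
      SimpleGraph.edgeFinset_card, ← Set.toFinset_card]
    congr 3 <;> (congr 2; ext; simp)
  have h2 : 2 * ((⊤ : SimpleGraph U).edgeFinset.card : ℤ) =
      Fintype.card U * (Fintype.card U - 1) := by
    rw [SimpleGraph.card_edgeFinset_top_eq_card_choose_two, ← Nat.cast_ofNat, ← Nat.cast_mul,
      mul_comm, Nat.choose_two_right, Nat.div_mul_cancel (Nat.even_mul_pred_self _).two_dvd]
    rcases Nat.eq_zero_or_pos (Fintype.card U) with h | h
    · simp [h]
    · push_cast [Nat.cast_sub h]
      ring
  have h3 : 2 * (σ * (J.edgeFinset.card : ℤ)) = Fintype.card U * σ := by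
    rcases eq_or_ne σ 0 with rfl | h
    · simp
    · have := (hJ h).two_mul_card_edges
      rw [← this]
      push_cast
      ring
  rw [h1]
  linear_combination h2 + h3

lemma exists_moved_adj (hn : 0 < n)
    (hG : ∀ u v, G.Adj u v → G.Adj (shift n f n u) (shift n f n v))
    {u v u' v' : ZMod (2 * n) ⊕ Fin f} (h : G.Adj u v) (z : ZMod (2 * n))
    (hu : shift n f z u = u') (hv : shift n f z v = v') :
    ∃ x < n, (moved G (x : ZMod (2 * n))).Adj u' v' ∧
      (z = (x : ZMod (2 * n)) ∨ z = (x : ZMod (2 * n)) + n) := by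
  obtain ⟨x, hx, h1, h2⟩ := exists_moved_eq hn hG z
  refine ⟨x, hx, ?_, h2⟩
  rw [← h1, ← hu, ← hv]
  exact moved_adj h

open Classical in
/-- The number of translates of `G` by `0, …, n - 1` that contain the edge `e`. -/
noncomputable def cover (G : SimpleGraph (ZMod (2 * n) ⊕ Fin f))
    (e : Sym2 (ZMod (2 * n) ⊕ Fin f)) : ℕ :=
  ((Finset.range n).filter fun x : ℕ => e ∈ (moved G (x : ZMod (2 * n))).edgeSet).card

lemma one_le_cover {u v : ZMod (2 * n) ⊕ Fin f}
    (h : ∃ x < n, (moved G (x : ZMod (2 * n))).Adj u v) : 1 ≤ cover G s(u, v) := by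
  classical
  obtain ⟨x, hx, h⟩ := h
  refine Finset.card_pos.2 ⟨x, ?_⟩
  simp only [Finset.mem_filter, Finset.mem_range, SimpleGraph.mem_edgeSet]
  exact ⟨hx, h⟩

/-- The translates of a starter factor cover every edge at least as often as needed. -/
lemma edgeMult_le_cover (hn : 2 ≤ n) {σ : ℤ} (hσ : σ = -1 ∨ σ = 0 ∨ σ = 1) (hf : (f : ℤ) = 1 - σ)
    (hG : ∀ u v, G.Adj u v → G.Adj (shift n f n u) (shift n f n v))
    (hdiff : ∀ d : ℕ, 1 ≤ d → d < n → ∃ u : ZMod (2 * n), G.Adj (Sum.inl u) (Sum.inl (u + d)))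
    (hinr : ∀ i : Fin f, ∃ p, G.Adj (Sum.inr i) (Sum.inl p))
    (h0 : 0 ≤ σ → ∃ p : ZMod (2 * n), G.Adj (Sum.inl p) (Sum.inl (p + n)))
    (h1 : σ = 1 → ∃ p q : ZMod (2 * n), p ≠ q ∧ p ≠ q + n ∧
      G.Adj (Sum.inl p) (Sum.inl (p + n)) ∧ G.Adj (Sum.inl q) (Sum.inl (q + n)))
    (e : Sym2 (ZMod (2 * n) ⊕ Fin f)) : edgeMult σ (halfFactor n f) e ≤ cover G e := by
  classical
  have hn0 : 0 < n := by omega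
  have : NeZero (2 * n) := ⟨by omega⟩
  induction e using Sym2.ind with
  | _ u v =>
  rcases eq_or_ne u v with rfl | huv
  · simp [edgeMult]
  have hle : edgeMult σ (halfFactor n f) s(u, v) ≤
      1 + σ * (if (halfFactor n f).Adj u v then 1 else 0) := by
    simp [edgeMult, huv]
  refine hle.trans ?_
  have hmix : ∀ (a : ZMod (2 * n)) (i : Fin f), 1 ≤ cover G s(Sum.inr i, Sum.inl a) := by
    intro a i
    obtain ⟨p, hp⟩ := hinr i
    obtain ⟨x, hx, h, -⟩ := exists_moved_adj hn0 hG hp (a - p) (shift_inr _ _)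
      (by rw [shift_inl, add_sub_cancel])
    exact one_le_cover ⟨x, hx, h⟩
  rcases u with a | i <;> rcases v with b | j
  · have hab : a ≠ b := fun h => huv (by rw [h])
    by_cases hJ : b = a + n
    · subst hJ
      rw [if_pos ⟨huv, Or.inl ⟨a, rfl, rfl⟩⟩]
      rcases hσ with rfl | rfl | rfl
      · simp
      · obtain ⟨p, hp⟩ := h0 le_rfl
        obtain ⟨x, hx, h, -⟩ := exists_moved_adj hn0 hG (u' := Sum.inl a) (v' := Sum.inl (a + n))
          hp (a - p) (by rw [shift_inl, add_sub_cancel]) (by rw [shift_inl]; congr 1; ring)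
        simpa using one_le_cover ⟨x, hx, h⟩
      · obtain ⟨p, q, hpq, hpq', hp, hq⟩ := h1 rfl
        obtain ⟨x, hx, hxa, hx'⟩ := exists_moved_adj hn0 hG (u' := Sum.inl a)
          (v' := Sum.inl (a + n)) hp (a - p) (by rw [shift_inl, add_sub_cancel])
          (by rw [shift_inl]; congr 1; ring)
        obtain ⟨y, hy, hya, hy'⟩ := exists_moved_adj hn0 hG (u' := Sum.inl a)
          (v' := Sum.inl (a + n)) hq (a - q) (by rw [shift_inl, add_sub_cancel])
          (by rw [shift_inl]; congr 1; ring)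
        have hxy : x ≠ y := by
          rintro rfl
          have h2 := half_add_half (n := n)
          rcases hx' with hx' | hx' <;> rcases hy' with hy' | hy'
          · exact hpq (by linear_combination hy' - hx')
          · exact hpq' (by linear_combination hy' - hx')
          · exact hpq' (by linear_combination hy' - hx' - h2)
          · exact hpq (by linear_combination hy' - hx')
        have : 1 < cover G s(Sum.inl a, Sum.inl (a + n)) := by
          refine Finset.one_lt_card.2 ⟨x, ?_, y, ?_, hxy⟩ <;>
            simp only [Finset.mem_filter, Finset.mem_range, SimpleGraph.mem_edgeSet]
          · exact ⟨hx, hxa⟩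
          · exact ⟨hy, hya⟩
        norm_num
        omega
    · have hnJ : ¬ (halfFactor n f).Adj (Sum.inl a) (Sum.inl b) := by
        rintro ⟨-, ⟨c, hc, hc'⟩ | ⟨i, j, h, -⟩⟩
        · rw [Sum.inl.inj hc] at hJ
          exact hJ (Sum.inl.inj hc')
        · simp at h
      rw [if_neg hnJ, mul_zero, add_zero, Nat.one_le_cast]
      have hval := ZMod.natCast_zmod_val (b - a)
      have hlt := ZMod.val_lt (b - a)
      have hne0 : (b - a).val ≠ 0 := by
        rw [Ne, ZMod.val_eq_zero, sub_eq_zero]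
        exact hab.symm
      have hnen : (b - a).val ≠ n := by
        intro h
        rw [h] at hval
        exact hJ (by rw [hval]; ring)
      rcases lt_or_ge (b - a).val n with hl | hl
      · obtain ⟨w, hw⟩ := hdiff _ (by omega) hl
        rw [hval] at hw
        obtain ⟨x, hx, h, -⟩ := exists_moved_adj hn0 hG (u' := Sum.inl a) (v' := Sum.inl b)
          hw (a - w) (by rw [shift_inl, add_sub_cancel]) (by rw [shift_inl]; congr 1; ring)
        exact one_le_cover ⟨x, hx, h⟩
      · obtain ⟨w, hw⟩ := hdiff (2 * n - (b - a).val) (by omega) (by omega)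
        rw [Nat.cast_sub hlt.le, hval, ZMod.natCast_self] at hw
        obtain ⟨x, hx, h, -⟩ := exists_moved_adj hn0 hG (u' := Sum.inl a) (v' := Sum.inl b)
          hw.symm (b - w) (by rw [shift_inl]; congr 1; ring) (by rw [shift_inl, add_sub_cancel])
        exact one_le_cover ⟨x, hx, h⟩
  · rw [Sym2.eq_swap, if_neg, mul_zero, add_zero, Nat.one_le_cast]
    · exact hmix a j
    · rintro ⟨-, ⟨c, -, hc⟩ | ⟨k, l, h, -⟩⟩
      · simp at hc
      · simp at h
  · rw [if_neg, mul_zero, add_zero, Nat.one_le_cast]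
    · exact hmix b i
    · rintro ⟨-, ⟨c, hc, -⟩ | ⟨k, l, -, h⟩⟩
      · simp at hc
      · simp at h
  · rw [if_pos ⟨huv, Or.inr ⟨i, j, rfl, rfl⟩⟩]
    have hij : i.val ≠ j.val := fun h => huv (by rw [Fin.ext h])
    have hi := i.2
    have hj := j.2
    have : σ = -1 := by omega
    subst this
    simp

lemma sum_cover [Fintype (ZMod (2 * n))] [DecidableRel G.Adj]
    (hcard : G.edgeFinset.card ≤ Fintype.card (ZMod (2 * n) ⊕ Fin f)) :
    ∑ e, cover G e ≤ n * Fintype.card (ZMod (2 * n) ⊕ Fin f) := by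
  classical
  simp only [cover, Finset.card_filter]
  rw [Finset.sum_comm]
  refine (Finset.sum_le_card_nsmul _ _ (Fintype.card (ZMod (2 * n) ⊕ Fin f)) ?_).trans (by simp)
  intro x _
  refine le_trans (le_of_eq ?_) hcard
  rw [← Finset.card_filter,
    ← (SimpleGraph.Iso.map (shift n f (x : ZMod (2 * n))) G).card_edgeFinset_eq.symm]
  congr 1
  ext e
  rw [SimpleGraph.mem_edgeFinset]
  exact ⟨fun h => (Finset.mem_filter.1 h).2, fun h => Finset.mem_filter.2 ⟨Finset.mem_univ _, h⟩⟩

/-- Counting edges shows that the translates cover every edge exactly as often as needed. -/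
lemma cover_eq_edgeMult (hn : 2 ≤ n) {σ : ℤ} (hσ : σ = -1 ∨ σ = 0 ∨ σ = 1)
    (hf : (f : ℤ) = 1 - σ) [Fintype (ZMod (2 * n))] [DecidableRel G.Adj]
    (hcard : G.edgeFinset.card ≤ Fintype.card (ZMod (2 * n) ⊕ Fin f))
    (hle : ∀ e, edgeMult σ (halfFactor n f) e ≤ cover G e) (e : Sym2 (ZMod (2 * n) ⊕ Fin f)) :
    (cover G e : ℤ) = edgeMult σ (halfFactor n f) e := by
  classical
  have hW : (Fintype.card (ZMod (2 * n) ⊕ Fin f) : ℤ) = 2 * n + f := by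
    have : NeZero (2 * n) := ⟨by omega⟩
    rw [Fintype.card_sum, Fintype.card_fin]
    have := ZMod.card (2 * n)
    rw [Fintype.card_congr (Equiv.refl (ZMod (2 * n))), this]
    push_cast
    ring
  have hJ : σ ≠ 0 → IsOneFactor (halfFactor n f) :=
    fun h => halfFactor_isOneFactor (by omega) (by omega)
  have h1 := two_mul_sum_edgeMult hJ
  have h2 : ∑ e, (cover G e : ℤ) ≤ n * (Fintype.card (ZMod (2 * n) ⊕ Fin f) : ℤ) := by
    exact_mod_cast sum_cover hcard
  have h3 := Finset.sum_le_sum fun e (_ : e ∈ Finset.univ) => hle e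
  have h4 : ∑ e, edgeMult σ (halfFactor n f) e =
      n * (Fintype.card (ZMod (2 * n) ⊕ Fin f) : ℤ) := by
    have h5 : (Fintype.card (ZMod (2 * n) ⊕ Fin f) : ℤ) - 1 + σ = 2 * n := by
      rw [hW, hf]
      ring
    rw [h5] at h1
    linarith
  exact ((Finset.sum_eq_sum_iff_of_le fun e _ => hle e).1 (le_antisymm h3 (h4 ▸ h2))
    e (Finset.mem_univ _)).symm

/-- The group of all translations. -/
def shiftGroup (n f : ℕ) : Subgroup (Equiv.Perm (ZMod (2 * n) ⊕ Fin f)) where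
  carrier := Set.range (shift n f)
  mul_mem' := by
    rintro _ _ ⟨y, rfl⟩ ⟨z, rfl⟩
    exact ⟨z + y, (shift_mul y z).symm⟩
  one_mem' := ⟨0, shift_zero⟩
  inv_mem' := by
    rintro _ ⟨y, rfl⟩
    exact ⟨-y, (shift_symm y).symm⟩

open Classical in
/-- The distinct translates of a starter factor. -/
noncomputable def orbit (G : SimpleGraph (ZMod (2 * n) ⊕ Fin f)) :
    Finset (SimpleGraph (ZMod (2 * n) ⊕ Fin f)) :=
  (Finset.range n).image fun x : ℕ => moved G (x : ZMod (2 * n))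

lemma orbit_isPyramidal (hn : 2 ≤ n)
    (hG : ∀ u v, G.Adj u v → G.Adj (shift n f n u) (shift n f n v)) :
    IsPyramidal f (orbit G) := by
  classical
  refine ⟨shiftGroup n f, ?_, Finset.univ.image Sum.inr, ?_, ?_, ?_⟩
  · rintro _ ⟨y, rfl⟩ _ hT
    obtain ⟨x, -, rfl⟩ := Finset.mem_image.1 hT
    obtain ⟨z, hz, h, -⟩ := exists_moved_eq (by omega) hG ((x : ZMod (2 * n)) + y)
    refine Finset.mem_image.2 ⟨z, Finset.mem_range.2 hz, ?_⟩
    rw [← h, ← moved_moved]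
    rfl
  · rw [Finset.card_image_of_injective _ Sum.inr_injective]
    simp
  · rintro _ ⟨y, rfl⟩ x hx
    obtain ⟨i, -, rfl⟩ := Finset.mem_image.1 hx
    rfl
  · rintro (a | i) hx (b | j) hy
    · refine ⟨shift n f (b - a), ⟨⟨_, rfl⟩, by rw [shift_inl, add_sub_cancel]⟩, ?_⟩
      rintro _ ⟨⟨y, rfl⟩, h⟩
      rw [show b = a + y from (Sum.inl.inj h).symm, add_sub_cancel_left]
    · simp at hy
    · simp at hx
    · simp at hx

/-- A starter factor that is invariant under translation by `n` and contains enough differences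
yields an `f`-pyramidal solution. -/
theorem exists_solution_of_starter {V : Type*} {F : SimpleGraph V} (hn : 2 ≤ n) {σ : ℤ}
    (hσ : σ = -1 ∨ σ = 0 ∨ σ = 1) (hf : (f : ℤ) = 1 - σ) (hiso : Nonempty (G ≃g F))
    [Fintype (ZMod (2 * n))] [DecidableRel G.Adj]
    (hcard : G.edgeFinset.card ≤ Fintype.card (ZMod (2 * n) ⊕ Fin f))
    (hG : ∀ u v, G.Adj u v → G.Adj (shift n f n u) (shift n f n v))
    (hdiff : ∀ d : ℕ, 1 ≤ d → d < n → ∃ u : ZMod (2 * n), G.Adj (Sum.inl u) (Sum.inl (u + d)))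
    (hinr : ∀ i : Fin f, ∃ p, G.Adj (Sum.inr i) (Sum.inl p))
    (h0 : 0 ≤ σ → ∃ p : ZMod (2 * n), G.Adj (Sum.inl p) (Sum.inl (p + n)))
    (h1 : σ = 1 → ∃ p q : ZMod (2 * n), p ≠ q ∧ p ≠ q + n ∧
      G.Adj (Sum.inl p) (Sum.inl (p + n)) ∧ G.Adj (Sum.inl q) (Sum.inl (q + n))) :
    IsOPSolution σ F (orbit G) ∧ IsPyramidal f (orbit G) := by
  classical
  have hcov := cover_eq_edgeMult hn hσ hf hcard (edgeMult_le_cover hn hσ hf hG hdiff hinr h0 h1)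
  -- The edges of difference 1 are covered once each, so the `n` translates are distinct.
  have hinj : Set.InjOn (fun x : ℕ => moved G (x : ZMod (2 * n))) (Finset.range n) := by
    intro x hx y hy hxy
    by_contra hne
    obtain ⟨u, hu⟩ := hdiff 1 le_rfl (by omega)
    have hx1 := moved_adj (y := (x : ZMod (2 * n))) hu
    have hy1 : (moved G (y : ZMod (2 * n))).Adj (shift n f x (Sum.inl u))
        (shift n f x (Sum.inl (u + (1 : ℕ)))) := by
      rw [← show moved G (x : ZMod (2 * n)) = moved G (y : ZMod (2 * n)) from hxy]
      exact hx1
    have h2 : 1 < cover G s(shift n f x (Sum.inl u), shift n f x (Sum.inl (u + (1 : ℕ)))) := by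
      refine Finset.one_lt_card.2 ⟨x, ?_, y, ?_, hne⟩ <;>
        rw [Finset.mem_filter, SimpleGraph.mem_edgeSet]
      · exact ⟨hx, hx1⟩
      · exact ⟨hy, hy1⟩
    have h3 := hcov s(shift n f x (Sum.inl u), shift n f x (Sum.inl (u + (1 : ℕ))))
    have hnJ : ¬ (halfFactor n f).Adj (shift n f x (Sum.inl u))
        (shift n f x (Sum.inl (u + (1 : ℕ)))) := by
      rintro ⟨-, ⟨c, hc, hc'⟩ | ⟨i, j, h, -⟩⟩
      · rw [← Sum.inl.inj hc] at hc'
        have h4 : ((1 : ℕ) : ZMod (2 * n)) = (n : ZMod (2 * n)) := by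
          have := Sum.inl.inj hc'
          simp only [Equiv.coe_addRight] at this
          linear_combination this
        have := natCast_inj_of_lt (by omega) (by omega) h4
        omega
      · simp [shift_inl] at h
    have h5 : edgeMult σ (halfFactor n f)
        s(shift n f x (Sum.inl u), shift n f x (Sum.inl (u + (1 : ℕ)))) ≤ 1 := by
      rw [edgeMult, if_neg fun h => hnJ ((SimpleGraph.mem_edgeSet _).1 h)]
      split_ifs <;> simp
    omega
  refine ⟨⟨?_, halfFactor n f, fun h => halfFactor_isOneFactor (by omega) (by omega), ?_⟩,
    orbit_isPyramidal hn hG⟩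
  · intro T hT
    obtain ⟨x, -, rfl⟩ := Finset.mem_image.1 hT
    obtain ⟨φ⟩ := hiso
    exact ⟨(SimpleGraph.Iso.map (shift n f (x : ZMod (2 * n))) G).symm.trans φ⟩
  · intro e
    rw [← hcov, cover, Nat.cast_inj]
    rw [← Finset.card_image_of_injOn (f := fun x : ℕ => moved G (x : ZMod (2 * n)))
      (hinj.mono (Finset.coe_subset.2 (Finset.filter_subset _ _))), ← Set.ncard_coe_finset]
    congr 1
    ext T
    simp only [orbit, Set.mem_ofPred_eq, Finset.coe_image, Set.mem_image, Finset.mem_coe,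
      Finset.mem_filter, Finset.mem_image]
    constructor
    · rintro ⟨⟨x, hx, rfl⟩, h⟩
      exact ⟨x, ⟨hx, h⟩, rfl⟩
    · rintro ⟨x, ⟨hx, h⟩, rfl⟩
      exact ⟨⟨x, hx, rfl⟩, h⟩

end Starter

/-! ### Transport along a bijection of the vertices -/

section Transport

variable {U V : Type*} (e : U ≃ V)

/-- The bijection between graphs induced by a bijection between the vertex sets. -/
def graphEquiv : SimpleGraph U ≃ SimpleGraph V where
  toFun G := G.map e
  invFun G := G.map e.symm
  left_inv G := by ext u v; simp
  right_inv G := by ext u v; simp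

lemma graphEquiv_adj (G : SimpleGraph U) (u v : V) :
    (graphEquiv e G).Adj u v ↔ G.Adj (e.symm u) (e.symm v) :=
  map_equiv_adj G e u v

lemma mem_edgeSet_graphEquiv (G : SimpleGraph U) (z : Sym2 V) :
    z ∈ (graphEquiv e G).edgeSet ↔ z.map e.symm ∈ G.edgeSet := by
  induction z using Sym2.ind with
  | _ u v => simp [graphEquiv_adj]

lemma IsOPSolution.transport {W : Type*} {F : SimpleGraph W} {σ : ℤ} {S : Finset (SimpleGraph U)}
    (h : IsOPSolution σ F S) : IsOPSolution σ F (S.map (graphEquiv e).toEmbedding) := by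
  classical
  obtain ⟨h1, J, h2, h3⟩ := h
  refine ⟨?_, graphEquiv e J, fun hs v => ?_, fun z => ?_⟩
  · intro _ hT
    obtain ⟨G, hG, rfl⟩ := Finset.mem_map.1 hT
    obtain ⟨φ⟩ := h1 G hG
    exact ⟨(SimpleGraph.Iso.map e G).symm.trans φ⟩
  · obtain ⟨w, hw, hw'⟩ := h2 hs (e.symm v)
    refine ⟨e w, ?_, ?_⟩
    · simpa [graphEquiv_adj] using hw
    · intro y hy
      rw [← hw' (e.symm y) ((graphEquiv_adj e J v y).1 hy), Equiv.apply_symm_apply]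
  · have h4 := h3 (z.map e.symm)
    have h5 : edgeMult σ (graphEquiv e J) z = edgeMult σ J (z.map e.symm) := by
      have : z ∈ (⊤ : SimpleGraph V).edgeSet ↔ z.map e.symm ∈ (⊤ : SimpleGraph U).edgeSet := by
        induction z using Sym2.ind with
        | _ u v => simp
      simp only [edgeMult, mem_edgeSet_graphEquiv, this]
    rw [h5, ← h4, Nat.cast_inj, ← Set.ncard_image_of_injective _ (graphEquiv e).injective]
    congr 1
    ext T
    simp only [Set.mem_ofPred_eq, Finset.mem_map_equiv, Set.mem_image]
    constructor
    · rintro ⟨hT, hz⟩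
      refine ⟨_, ⟨hT, ?_⟩, (graphEquiv e).apply_symm_apply T⟩
      rwa [← mem_edgeSet_graphEquiv, Equiv.apply_symm_apply]
    · rintro ⟨G, ⟨hG, hz⟩, rfl⟩
      exact ⟨by simpa using hG, (mem_edgeSet_graphEquiv e G z).2 hz⟩

lemma IsPyramidal.transport {f : ℕ} {S : Finset (SimpleGraph U)} (h : IsPyramidal f S) :
    IsPyramidal f (S.map (graphEquiv e).toEmbedding) := by
  obtain ⟨A, h1, X, h2, h3, h4⟩ := h
  refine ⟨A.map e.permCongrHom.toMonoidHom, ?_, X.map e.toEmbedding, by simpa using h2, ?_, ?_⟩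
  · rintro _ ⟨g, hg, rfl⟩ _ hT
    obtain ⟨G, hG, rfl⟩ := Finset.mem_map.1 hT
    refine Finset.mem_map.2 ⟨_, h1 g hg G hG, ?_⟩
    ext u v
    change (graphEquiv e (G.map g)).Adj u v ↔
      ((graphEquiv e G).map (e.permCongr g : Equiv.Perm V)).Adj u v
    simp only [graphEquiv_adj, map_equiv_adj]
    simp [Equiv.permCongr_def]
  · rintro _ ⟨g, hg, rfl⟩ _ hv
    obtain ⟨x, hx, rfl⟩ := Finset.mem_map.1 hv
    change e (g (e.symm (e x))) = e x
    rw [e.symm_apply_apply, h3 g hg x hx]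
  · intro x hx y hy
    obtain ⟨g, ⟨hg, hg1⟩, hg2⟩ := h4 (e.symm x) (fun h => hx (Finset.mem_map.2 ⟨_, h, by simp⟩))
      (e.symm y) (fun h => hy (Finset.mem_map.2 ⟨_, h, by simp⟩))
    refine ⟨e.permCongr g, ⟨⟨g, hg, rfl⟩, ?_⟩, ?_⟩
    · change e (g (e.symm x)) = y
      rw [hg1, e.apply_symm_apply]
    · rintro _ ⟨⟨g', hg', rfl⟩, h⟩
      change e (g' (e.symm x)) = y at h
      rw [← hg2 g' ⟨hg', by rw [← h, e.symm_apply_apply]⟩]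
      rfl

end Transport

/-! ### Starter factors from half systems -/

section HalfSystem

lemma isChain_glue {W : Type*} {R : W → W → Prop} {l₁ X l₂ : List W} {a b : W}
    (ha : X.head? = some a) (hb : X.getLast? = some b) :
    (l₁ ++ (X ++ l₂)).IsChain R ↔ (l₁ ++ [a]).IsChain R ∧ X.IsChain R ∧ (b :: l₂).IsChain R := by
  obtain ⟨X', rfl⟩ := List.head?_eq_some_iff.1 ha
  obtain ⟨X'', h⟩ := List.getLast?_eq_some_iff.1 hb
  rw [List.cons_append, List.isChain_split, ← List.cons_append]
  rw [h, List.append_assoc, List.singleton_append, List.isChain_split (l₁ := X'')]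

lemma closedChain_iff {W : Type*} {R : W → W → Prop} {C : List W} {b : W}
    (h : C.getLast? = some b) : ClosedChain R C ↔ (b :: C).IsChain R := by
  simp [ClosedChain, h]

/-- A closed chain that runs through two lists `X` and `Y` and through two connecting lists. -/
lemma closedChain_join {W : Type*} {R : W → W → Prop} {pre X mid Y : List W} {a b c d : W}
    (ha : X.head? = some a) (hb : X.getLast? = some b) (hc : Y.head? = some c)
    (hd : Y.getLast? = some d) :
    ClosedChain R (pre ++ (X ++ (mid ++ Y))) ↔
      (d :: (pre ++ [a])).IsChain R ∧ X.IsChain R ∧ (b :: (mid ++ [c])).IsChain R ∧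
        Y.IsChain R := by
  have hl : (pre ++ (X ++ (mid ++ Y))).getLast? = some d := by
    simp [List.getLast?_append, hd]
  rw [closedChain_iff hl, ← List.cons_append, isChain_glue ha hb, ← List.cons_append]
  conv_lhs => rw [← List.append_nil Y]
  rw [isChain_glue hc hd]
  simp

/-- Half of a starter factor: a path `P`, cycles `Ct` each of which is to be joined to its translate
by `n`, and cycles `Cu` each of which is to be closed.  Up to translation by `n` every vertex lies on
one of the lists and every difference occurs. -/
structure HalfSystem (n : ℕ) (P : List (ZMod (2 * n))) (Ct Cu : List (List (ZMod (2 * n)))) :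
    Prop where
  two_le : 2 ≤ P.length
  two_le_ct : ∀ C ∈ Ct, 2 ≤ C.length
  three_le_cu : ∀ C ∈ Cu, 3 ≤ C.length
  length_eq : P.length + (Ct.flatten.length + Cu.flatten.length) = n
  covers : ∀ z, z ∈ P ++ (Ct.flatten ++ Cu.flatten) ∨ z + n ∈ P ++ (Ct.flatten ++ Cu.flatten)
  differences : ∀ H : SimpleGraph (ZMod (2 * n)), P.IsChain H.Adj →
    (∀ C ∈ Ct, C.IsChain H.Adj ∧ ∀ a ∈ C.head?, ∀ b ∈ C.getLast?, H.Adj b (a + n)) →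
    (∀ C ∈ Cu, ClosedChain H.Adj C) → ∀ d : ℕ, 1 ≤ d → d < n → ∃ u, H.Adj u (u + d)

variable {n f : ℕ} {P : List (ZMod (2 * n))} {Ct Cu : List (List (ZMod (2 * n)))}

/-- A list in `ZMod (2 * n)`, with all its members increased by `y`, among the vertices. -/
def place (f : ℕ) (y : ZMod (2 * n)) (C : List (ZMod (2 * n))) : List (ZMod (2 * n) ⊕ Fin f) :=
  C.map fun a => Sum.inl (a + y)

/-- The closed lists of the starter factor of a half system.  The path is joined to its translate by
`n`, directly or through a fixed point, at both ends. -/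
def fullLists (pre mid : List (Fin f)) (P : List (ZMod (2 * n)))
    (Ct Cu : List (List (ZMod (2 * n)))) : List (List (ZMod (2 * n) ⊕ Fin f)) :=
  (pre.map Sum.inr ++ (place f 0 P ++ (mid.map Sum.inr ++ (place f n P).reverse))) ::
    ((Ct.map fun C => [] ++ (place f 0 C ++ ([] ++ place f n C))) ++
      (Cu.map (place f 0) ++ Cu.map (place f n)))

lemma place_head {y a : ZMod (2 * n)} {C : List (ZMod (2 * n))} (h : C.head? = some a) :
    (place f y C).head? = some (Sum.inl (a + y)) := by
  simp [place, h]

lemma place_getLast {y a : ZMod (2 * n)} {C : List (ZMod (2 * n))} (h : C.getLast? = some a) :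
    (place f y C).getLast? = some (Sum.inl (a + y)) := by
  simp [place, h]

lemma fullLists_length (pre mid : List (Fin f)) :
    ((fullLists pre mid P Ct Cu).map List.length : Multiset ℕ) =
      {2 * P.length + (pre.length + mid.length)} + (Ct.map fun C => 2 * C.length : List ℕ) +
        2 • (Cu.map List.length : Multiset ℕ) := by
  have h : (fullLists pre mid P Ct Cu).map List.length =
      [2 * P.length + (pre.length + mid.length)] ++ ((Ct.map fun C => 2 * C.length) ++
        (Cu.map List.length ++ Cu.map List.length)) := by
    simp only [fullLists, List.map_cons, List.map_append, List.map_map, List.singleton_append]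
    congr 1
    · simp [place]
      omega
    · congr 1
      · refine List.map_congr_left fun C _ => ?_
        simp [place]
        omega
      · congr 1 <;> refine List.map_congr_left fun C _ => ?_ <;> simp [place]
  rw [h, ← Multiset.coe_add, ← Multiset.coe_add, ← Multiset.coe_add, two_nsmul, add_assoc]
  simp

lemma mem_fullLists (pre mid : List (Fin f)) (hpm : ∀ i, i ∈ pre ∨ i ∈ mid)
    (hc : ∀ z, z ∈ P ++ (Ct.flatten ++ Cu.flatten) ∨ z + n ∈ P ++ (Ct.flatten ++ Cu.flatten))
    (w : ZMod (2 * n) ⊕ Fin f) : w ∈ (fullLists pre mid P Ct Cu).flatten := by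
  have h2 := half_add_half (n := n)
  rcases w with z | i
  · have key : ∀ y : ZMod (2 * n), (y = 0 ∨ y = n) → z + y ∈ P ++ (Ct.flatten ++ Cu.flatten) →
        Sum.inl z ∈ (fullLists pre mid P Ct Cu).flatten := by
      intro y hy hz
      have hpl : ∀ C, z + y ∈ C → (Sum.inl z : ZMod (2 * n) ⊕ Fin f) ∈ place f y C := by
        intro C hC
        refine List.mem_map.2 ⟨z + y, hC, ?_⟩
        rcases hy with rfl | rfl
        · simp
        · rw [add_assoc, h2, add_zero]
      simp only [List.mem_append] at hz
      rw [List.mem_flatten]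
      rcases hz with hz | hz | hz
      · refine ⟨_, List.mem_cons_self, ?_⟩
        have := hpl _ hz
        rcases hy with rfl | rfl <;> simp [this]
      · obtain ⟨C, hC, hz⟩ := List.mem_flatten.1 hz
        refine ⟨_, List.mem_cons_of_mem _ (List.mem_append_left _ (List.mem_map.2 ⟨C, hC, rfl⟩)),
          ?_⟩
        have := hpl _ hz
        rcases hy with rfl | rfl <;> simp [this]
      · obtain ⟨C, hC, hz⟩ := List.mem_flatten.1 hz
        refine ⟨_, List.mem_cons_of_mem _ (List.mem_append_right _ ?_), hpl _ hz⟩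
        rcases hy with rfl | rfl
        · exact List.mem_append_left _ (List.mem_map.2 ⟨C, hC, rfl⟩)
        · exact List.mem_append_right _ (List.mem_map.2 ⟨C, hC, rfl⟩)
    rcases hc z with hz | hz
    · exact key 0 (Or.inl rfl) (by simpa using hz)
    · exact key n (Or.inr rfl) hz
  · rw [List.mem_flatten]
    refine ⟨_, List.mem_cons_self, ?_⟩
    rcases hpm i with h | h <;> simp [h]

lemma nodup_of_length_le {W : Type*} [Fintype W] {l : List W} (hc : ∀ w, w ∈ l)
    (hl : l.length ≤ Fintype.card W) : l.Nodup := by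
  classical
  rw [← Multiset.coe_nodup, ← Multiset.toFinset_card_eq_card_iff_nodup]
  refine le_antisymm (Multiset.toFinset_card_le _) ?_
  rw [Finset.eq_univ_of_forall (s := Multiset.toFinset (l : Multiset W)) (by simpa using hc)]
  simpa using hl

lemma place_shift (y : ZMod (2 * n)) (C : List (ZMod (2 * n))) :
    (place f y C).map (shift n f n) = place f (y + (n : ZMod (2 * n))) C := by
  simp only [place, List.map_map]
  refine List.map_congr_left fun a _ => ?_
  simp only [Function.comp_apply, shift_inl, add_assoc]

/-- The starter factor is invariant under translation by `n`. -/
lemma fullLists_shift {R : ZMod (2 * n) ⊕ Fin f → ZMod (2 * n) ⊕ Fin f → Prop}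
    (hR : ∀ u v, R u v → R v u) (pre mid : List (Fin f)) (hpre : pre.length ≤ 1)
    (hmid : mid.length ≤ 1) (hP : P ≠ [])
    (h : ∀ C ∈ fullLists pre mid P Ct Cu, ClosedChain R C) :
    ∀ C ∈ fullLists pre mid P Ct Cu,
      ClosedChain (fun u v => R (shift n f n u) (shift n f n v)) C := by
  have h2 := half_add_half (n := n)
  have hmap : ∀ C : List (ZMod (2 * n) ⊕ Fin f),
      ClosedChain (fun u v => R (shift n f n u) (shift n f n v)) C ↔
        ClosedChain R (C.map (shift n f n)) := by
    intro C
    rcases C.eq_nil_or_concat with rfl | ⟨C', b, rfl⟩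
    · simp [ClosedChain]
    · rw [closedChain_iff (b := b) (by simp), closedChain_iff (b := shift n f n b) (by simp),
        ← List.map_cons, List.isChain_map]
  have hsymm : ∀ {C : List (ZMod (2 * n) ⊕ Fin f)}, C.reverse.IsChain R ↔ C.IsChain R := by
    intro C
    rw [List.isChain_reverse]
    exact ⟨fun h => h.imp fun a b => hR _ _, fun h => h.imp fun a b => hR _ _⟩
  have hshort : ∀ (l : List (Fin f)), l.length ≤ 1 → l.reverse = l := by
    intro l hl
    match l, hl with
    | [], _ => rfl
    | [_], _ => rfl
  intro C hC
  rw [hmap]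
  simp only [fullLists, List.mem_cons, List.mem_append, List.mem_map] at hC
  have hinr : ∀ l : List (Fin f), (l.map Sum.inr).map (shift n f n) = l.map Sum.inr := by
    intro l
    rw [List.map_map]
    exact List.map_congr_left fun i _ => rfl
  rcases hC with rfl | ⟨C, hC, rfl⟩ | ⟨C, hC, rfl⟩ | ⟨C, hC, rfl⟩
  · have h0 := h _ List.mem_cons_self
    obtain ⟨a, ha⟩ : ∃ a, P.head? = some a := by
      rcases P with _ | ⟨a, P⟩
      · exact absurd rfl hP
      · exact ⟨a, rfl⟩
    obtain ⟨b, hb⟩ : ∃ b, P.getLast? = some b := ⟨_, List.getLast?_eq_some_getLast hP⟩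
    simp only [List.map_append, List.map_reverse, hinr, place_shift, zero_add, h2]
    rw [closedChain_join (place_head ha) (place_getLast hb)
      (by rw [List.head?_reverse]; exact place_getLast hb)
      (by rw [List.getLast?_reverse]; exact place_head ha)] at h0 ⊢
    obtain ⟨h1, h2, h3, h4⟩ := h0
    refine ⟨?_, hsymm.1 h4, ?_, hsymm.2 h2⟩
    · rw [← hsymm]
      simpa [← List.map_reverse, hshort pre hpre] using h1
    · rw [← hsymm]
      simpa [← List.map_reverse, hshort mid hmid] using h3
  · have h0 := h _ (List.mem_cons_of_mem _ (List.mem_append_left _ (List.mem_map.2 ⟨C, hC, rfl⟩)))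
    rcases eq_or_ne C [] with rfl | hne
    · simp [ClosedChain, place]
    obtain ⟨a, ha⟩ : ∃ a, C.head? = some a := by
      rcases C with _ | ⟨a, C⟩
      · exact absurd rfl hne
      · exact ⟨a, rfl⟩
    obtain ⟨b, hb⟩ : ∃ b, C.getLast? = some b := ⟨_, List.getLast?_eq_some_getLast hne⟩
    simp only [List.map_append, List.map_nil, place_shift, zero_add, h2]
    rw [closedChain_join (place_head ha) (place_getLast hb) (place_head ha)
      (place_getLast hb)] at h0 ⊢
    exact ⟨h0.2.2.1, h0.2.2.2, h0.1, h0.2.1⟩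
  · rw [place_shift, zero_add]
    exact h _ (List.mem_cons_of_mem _ (List.mem_append_right _ (List.mem_append_right _
      (List.mem_map.2 ⟨C, hC, rfl⟩))))
  · rw [place_shift, h2]
    exact h _ (List.mem_cons_of_mem _ (List.mem_append_right _ (List.mem_append_left _
      (List.mem_map.2 ⟨C, hC, rfl⟩))))

lemma flatten_fullLists_length (pre mid : List (Fin f)) :
    (fullLists pre mid P Ct Cu).flatten.length =
      2 * (P.length + (Ct.flatten.length + Cu.flatten.length)) + (pre.length + mid.length) := by
  have h := congrArg Multiset.sum (fullLists_length (P := P) (Ct := Ct) (Cu := Cu) pre mid)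
  simp only [Multiset.sum_coe, Multiset.sum_add, Multiset.sum_singleton, Multiset.sum_nsmul,
    List.sum_map_mul_left, smul_eq_mul] at h
  simp only [List.length_flatten, h]
  ring

/-- The fixed points are distributed over the two connections between the path and its translate. -/
lemma exists_fixed_lists (f : ℕ) (hf : f ≤ 2) : ∃ pre mid : List (Fin f),
    (∀ i, i ∈ pre ∨ i ∈ mid) ∧ pre.length + mid.length = f ∧ pre.length ≤ 1 ∧ mid.length ≤ 1 ∧
      (f ≤ 1 → mid = []) ∧ (f = 0 → pre = []) := by
  interval_cases f
  · exact ⟨[], [], by simp⟩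
  · exact ⟨[0], [], by simp [Fin.forall_fin_one]⟩
  · exact ⟨[0], [1], by simp [Fin.forall_fin_two]⟩

/-- A half system yields an `f`-pyramidal solution. -/
theorem HalfSystem.exists_solution {V : Type*} {F : SimpleGraph V} (hs : HalfSystem n P Ct Cu)
    {σ : ℤ} (hσ : σ = -1 ∨ σ = 0 ∨ σ = 1) (hf : (f : ℤ) = 1 - σ) {M : List ℕ}
    (hF : Nonempty (F ≃g cycleUnion M.get))
    (hM : (M : Multiset ℕ) = {2 * P.length + f} + (Ct.map fun C => 2 * C.length : List ℕ) +
      2 • (Cu.map List.length : Multiset ℕ)) :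
    ∃ S : Finset (SimpleGraph V), IsOPSolution σ F S ∧ IsPyramidal f S := by
  classical
  have hn : 2 ≤ n := by
    have := hs.two_le
    have := hs.length_eq
    omega
  have : NeZero (2 * n) := ⟨by omega⟩
  obtain ⟨pre, mid, hpm, hlen, hpre, hmid, hmid0, hpre0⟩ := exists_fixed_lists f (by omega)
  have hperm : ((fullLists pre mid P Ct Cu).map List.length).Perm M := by
    rw [← Multiset.coe_eq_coe, fullLists_length, hM, hlen]
  obtain ⟨Cs, hCs, hCsM⟩ := exists_perm_map List.length hperm
  have hmem : ∀ C, C ∈ Cs ↔ C ∈ fullLists pre mid P Ct Cu := fun C => hCs.mem_iff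
  have hcov : ∀ w, w ∈ Cs.flatten := fun w =>
    hCs.flatten.mem_iff.2 (mem_fullLists pre mid hpm hs.covers w)
  have hnd : Cs.flatten.Nodup := by
    refine nodup_of_length_le hcov ?_
    rw [hCs.flatten.length_eq, flatten_fullLists_length, hs.length_eq, hlen, Fintype.card_sum,
      ZMod.card, Fintype.card_fin]
  have hndC : ∀ C ∈ fullLists pre mid P Ct Cu, C.Nodup := fun C hC =>
    (List.nodup_flatten.1 hnd).1 C ((hmem C).2 hC)
  have hclosed : ∀ C ∈ fullLists pre mid P Ct Cu, ClosedChain (closedGraph Cs).Adj C := by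
    intro C hC
    refine closedGraph_closedChain ((hmem C).2 hC) (hndC C hC) ?_
    simp only [fullLists, List.mem_cons, List.mem_append, List.mem_map] at hC
    have h1 := hs.two_le
    rcases hC with rfl | ⟨C, hC, rfl⟩ | ⟨C, hC, rfl⟩ | ⟨C, hC, rfl⟩
    · simp [place]
      omega
    · have := hs.two_le_ct C hC
      simp [place]
      omega
    · have := hs.three_le_cu C hC
      simp [place]
      omega
    · have := hs.three_le_cu C hC
      simp [place]
      omega
  obtain ⟨a, ha⟩ : ∃ a, P.head? = some a := by
    rcases hP : P with _ | ⟨a, P⟩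
    · have := hs.two_le
      simp [hP] at this
    · exact ⟨a, rfl⟩
  have hPne : P ≠ [] := by
    rintro rfl
    simp at ha
  obtain ⟨b, hb⟩ : ∃ b, P.getLast? = some b := ⟨_, List.getLast?_eq_some_getLast hPne⟩
  have hturn := hclosed _ List.mem_cons_self
  rw [closedChain_join (place_head ha) (place_getLast hb)
    (by rw [List.head?_reverse]; exact place_getLast hb)
    (by rw [List.getLast?_reverse]; exact place_head ha)] at hturn
  simp only [add_zero] at hturn
  obtain ⟨ht1, ht2, ht3, ht4⟩ := hturn
  have hcomap : ∀ {C : List (ZMod (2 * n))}, (place f 0 C).IsChain (closedGraph Cs).Adj →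
      C.IsChain ((closedGraph Cs).comap Sum.inl).Adj := by
    intro C hC
    rw [place, List.isChain_map] at hC
    simp only [add_zero] at hC
    exact hC
  obtain ⟨φ⟩ := closedGraph_iso hF hCsM hnd hcov
  have key := exists_solution_of_starter (G := closedGraph Cs) (F := F) hn hσ hf ⟨φ⟩
    (closedGraph_card_edges hnd hcov) ?_ ?_ ?_ ?_ ?_
  · exact ⟨_, key.1.transport φ.toEquiv, key.2.transport φ.toEquiv⟩
  · intro u v huv
    refine closedGraph_le (R := fun u v => (closedGraph Cs).Adj (shift n f n u) (shift n f n v))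
      (fun u v h => h.symm) ?_ huv
    intro C hC
    exact fullLists_shift (fun u v h => h.symm) pre mid hpre hmid hPne hclosed C ((hmem C).1 hC)
  · refine hs.differences ((closedGraph Cs).comap Sum.inl) (hcomap ht2) ?_ ?_
    · intro C hC
      have h := hclosed _
        (List.mem_cons_of_mem _ (List.mem_append_left _ (List.mem_map.2 ⟨C, hC, rfl⟩)))
      have hne : C ≠ [] := by
        rintro rfl
        simpa using hs.two_le_ct _ hC
      obtain ⟨a', ha'⟩ : ∃ a, C.head? = some a := by
        rcases C with _ | ⟨a, C⟩
        · exact absurd rfl hne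
        · exact ⟨a, rfl⟩
      obtain ⟨b', hb'⟩ : ∃ b, C.getLast? = some b := ⟨_, List.getLast?_eq_some_getLast hne⟩
      rw [closedChain_join (place_head ha') (place_getLast hb') (place_head ha')
        (place_getLast hb')] at h
      refine ⟨hcomap h.2.1, ?_⟩
      intro x hx y hy
      rw [ha', Option.mem_def, Option.some.injEq] at hx
      rw [hb', Option.mem_def, Option.some.injEq] at hy
      subst hx hy
      simpa using h.2.2.1
    · intro C hC
      have h := hclosed _ (List.mem_cons_of_mem _ (List.mem_append_right _
        (List.mem_append_left _ (List.mem_map.2 ⟨C, hC, rfl⟩))))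
      intro b' hb'
      have := h _ (place_getLast hb')
      refine hcomap ?_
      simpa [place] using this
  · intro i
    rcases hpm i with hi | hi
    · have : pre = [i] := by
        match pre, hpre, hi with
        | [j], _, hi => rw [List.mem_singleton.1 hi]
      subst this
      refine ⟨a, ?_⟩
      simp only [List.map_cons, List.map_nil, List.cons_append, List.nil_append,
        List.isChain_cons_cons] at ht1
      exact ht1.2.1
    · have : mid = [i] := by
        match mid, hmid, hi with
        | [j], _, hi => rw [List.mem_singleton.1 hi]
      subst this
      refine ⟨b, ?_⟩
      simp only [List.map_cons, List.map_nil, List.cons_append, List.nil_append,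
        List.isChain_cons_cons] at ht3
      exact ht3.1.symm
  · intro h
    have := hmid0 (by omega)
    subst this
    refine ⟨b, ?_⟩
    simpa using ht3
  · rintro rfl
    have h1 := hmid0 (by omega)
    have h2 := hpre0 (by omega)
    subst h1 h2
    have ht1' : (closedGraph Cs).Adj (Sum.inl (a + n)) (Sum.inl a) := by simpa using ht1
    refine ⟨b, a, ?_, ?_, by simpa using ht3, ht1'.symm⟩
    all_goals
      have h := hndC _ List.mem_cons_self
      obtain ⟨P', rfl⟩ := List.head?_eq_some_iff.1 ha
      have hb1 : b ∈ P' := by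
        have h3 := hs.two_le
        rcases P' with _ | ⟨c, P'⟩
        · simp at h3
        · rw [List.getLast?_cons_cons] at hb
          exact List.mem_of_getLast? hb
      simp only [place, List.map_cons, List.map_nil, List.nil_append, List.cons_append,
        List.nodup_cons, List.mem_append, List.mem_reverse, List.mem_cons, List.mem_map] at h
    · rintro rfl
      exact h.1 (Or.inl ⟨_, hb1, rfl⟩)
    · rintro rfl
      refine h.1 (Or.inr (Or.inr ⟨_, hb1, ?_⟩))
      rw [add_assoc, half_add_half]

end HalfSystem

/-! ### Half systems from graceful labellings -/

section Lifting

/-- The absolute difference between the first and the last member of a list. -/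
def gap (C : List ℤ) : ℤ := |C.headD 0 - C.getLastD 0|

/-- The cycles of a `Rest`, as lists. -/
lemma Rest.exists_lists {t : ℤ} {L : List ℕ} {V D : Multiset ℤ} (h : Rest Any t L V D) :
    ∃ Cs : List (List ℤ), Cs.map List.length = L ∧ (Cs.flatten : Multiset ℤ) = V ∧
      (Cs.map fun C => steps C + {gap C}).sum = D ∧ ∀ v ∈ D, v < t := by
  induction h with
  | nil => exact ⟨[], rfl, rfl, rfl, by simp⟩
  | cons hs _ hn ht _ ih =>
    obtain ⟨Cs, h1, h2, h3, h4⟩ := ih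
    obtain ⟨C, -, ha, hb, hV, hD⟩ := hs
    refine ⟨C :: Cs, ?_, ?_, ?_, ?_⟩
    · rw [List.map_cons, h1, ← hn, ← hV, Multiset.coe_card]
    · rw [List.flatten_cons, ← Multiset.coe_add, hV, h2]
    · rw [List.map_cons, List.sum_cons, h3, hD, gap, List.headD_eq_head?_getD,
        List.getLastD_eq_getLast?, ha, hb]
      rfl
    · intro v hv
      rw [Multiset.mem_add] at hv
      exact hv.elim (ht v) (h4 v)

variable {n : ℕ}

/-- The residues of the members of a list. -/
def castList (n : ℕ) (C : List ℤ) : List (ZMod (2 * n)) := C.map fun x : ℤ => (x : ZMod (2 * n))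

/-- The path through the residues of the members of a list, starting at offset `o`, in which every
edge with difference in `T` is replaced by one that changes the offset by `n`. -/
def liftPath (n : ℕ) (T : Finset ℤ) : ZMod (2 * n) → List ℤ → List (ZMod (2 * n))
  | o, a :: b :: l => (a + o) :: liftPath n T (if |b - a| ∈ T then o + n else o) (b :: l)
  | o, [a] => [a + o]
  | _, [] => []

lemma liftPath_length (T : Finset ℤ) (l : List ℤ) :
    ∀ o, (liftPath n T o l).length = l.length := by
  induction l with
  | nil => simp [liftPath]
  | cons a l ih =>
    intro o
    rcases l with _ | ⟨b, l⟩
    · simp [liftPath]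
    · rw [liftPath, List.length_cons, ih]
      rfl

lemma mem_liftPath {T : Finset ℤ} {x : ℤ} (l : List ℤ) : ∀ {o : ZMod (2 * n)},
    (o = 0 ∨ o = n) → x ∈ l → (x : ZMod (2 * n)) ∈ liftPath n T o l ∨
      (x : ZMod (2 * n)) + n ∈ liftPath n T o l := by
  induction l with
  | nil => simp
  | cons a l ih =>
    intro o ho hx
    have ha : (a : ZMod (2 * n)) = a + o ∨ (a : ZMod (2 * n)) + n = a + o := by
      rcases ho with rfl | rfl
      · exact Or.inl (by simp)
      · exact Or.inr rfl
    rcases l with _ | ⟨b, l⟩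
    · rw [List.mem_singleton.1 hx]
      simpa [liftPath] using ha
    · rw [liftPath]
      rcases List.mem_cons.1 hx with rfl | hx
      · rcases ha with h | h
        · exact Or.inl (List.mem_cons.2 (Or.inl h))
        · exact Or.inr (List.mem_cons.2 (Or.inl h))
      · refine (ih (o := if |b - a| ∈ T then o + n else o) ?_ hx).imp
          (List.mem_cons_of_mem _) (List.mem_cons_of_mem _)
        split_ifs
        · rcases ho with rfl | rfl
          · exact Or.inr (zero_add _)
          · exact Or.inl half_add_half
        · exact ho

/-- The difference `e` occurs in the graph `H`. -/
def Occurs (H : SimpleGraph (ZMod (2 * n))) (e : ℤ) : Prop := ∃ u, H.Adj u (u + (e : ZMod (2 * n)))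

variable {H : SimpleGraph (ZMod (2 * n))}

lemma Occurs.of_adj {a b : ZMod (2 * n)} {e : ℤ} (h : H.Adj a b)
    (he : b - a = (e : ZMod (2 * n)) ∨ a - b = (e : ZMod (2 * n))) : Occurs H e := by
  rcases he with he | he
  · exact ⟨a, by rwa [← he, add_sub_cancel]⟩
  · exact ⟨b, by rw [← he, add_sub_cancel]; exact h.symm⟩

lemma cast_abs_sub (a b : ℤ) : (a : ZMod (2 * n)) - b = ((|a - b| : ℤ) : ZMod (2 * n)) ∨
    (b : ZMod (2 * n)) - a = ((|a - b| : ℤ) : ZMod (2 * n)) := by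
  rcases abs_cases (a - b) with ⟨h, -⟩ | ⟨h, -⟩
  · left
    rw [h]
    push_cast
    ring
  · right
    rw [h]
    push_cast
    ring

lemma Occurs.of_castList {C : List ℤ} (h : (castList n C).IsChain H.Adj) :
    ∀ v ∈ steps C, Occurs H v := by
  induction C with
  | nil => simp
  | cons a l ih =>
    rcases l with _ | ⟨b, l⟩
    · simp
    · intro v hv
      rw [castList, List.map_cons, List.map_cons, List.isChain_cons_cons] at h
      rw [steps_cons, Multiset.mem_cons] at hv
      rcases hv with rfl | hv
      · exact Occurs.of_adj h.1 (cast_abs_sub b a)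
      · exact ih h.2 v hv

lemma Occurs.of_liftPath {T : Finset ℤ} {l : List ℤ} : ∀ {o : ZMod (2 * n)},
    (liftPath n T o l).IsChain H.Adj → ∀ v ∈ steps l, Occurs H (if v ∈ T then n - v else v) := by
  have h2 := half_add_half (n := n)
  induction l with
  | nil => simp
  | cons a l ih =>
    intro o h
    rcases l with _ | ⟨b, l⟩
    · simp
    · intro v hv
      rw [liftPath] at h
      rw [steps_cons, Multiset.mem_cons] at hv
      rcases hv with rfl | hv
      · have h1 : H.Adj (a + o) (b + if |b - a| ∈ T then o + n else o) := by
          rcases l with _ | ⟨c, l⟩ <;> exact (List.isChain_cons_cons.1 h).1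
        refine Occurs.of_adj h1 ?_
        rcases cast_abs_sub (n := n) b a with h3 | h3 <;> split_ifs
        · right
          push_cast at h3 ⊢
          linear_combination -h3 - h2
        · left
          linear_combination h3
        · left
          push_cast at h3 ⊢
          linear_combination -h3
        · right
          linear_combination h3
      · exact ih (List.isChain_of_isChain_cons h) v hv

lemma castList_head {C : List ℤ} {a : ZMod (2 * n)} (h : (castList n C).head? = some a) :
    a = (C.headD 0 : ZMod (2 * n)) := by
  rcases C with _ | ⟨b, C⟩
  · simp [castList] at h
  · simpa [castList] using h.symm

lemma castList_getLast {C : List ℤ} {a : ZMod (2 * n)} (h : (castList n C).getLast? = some a) :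
    a = (C.getLastD 0 : ZMod (2 * n)) := by
  rcases C.eq_nil_or_concat with rfl | ⟨C', b, rfl⟩
  · simp [castList] at h
  · simpa [castList] using h.symm

lemma mem_sum_map {α : Type*} {f : α → Multiset ℤ} {l : List α} {v : ℤ} :
    v ∈ (l.map f).sum ↔ ∃ C ∈ l, v ∈ f C := by
  induction l with
  | nil => simp
  | cons a l ih => simp [ih]

lemma length_castList (C : List ℤ) : (castList n C).length = C.length := by simp [castList]

lemma flatten_castList (Cs : List (List ℤ)) :
    (Cs.map (castList n)).flatten = castList n Cs.flatten := by
  simp only [castList, List.map_flatten]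
  rfl

/-- Twisting the cycles in `Ct`: the closing difference `g` of such a cycle is replaced by `n - g`, and
the path supplies `g` in place of `n - g`.  The lists in `E` are single edges, and each supplies two
differences with sum `n`. -/
theorem HalfSystem.of_lists {P : List ℤ} {Ct Cu E : List (List ℤ)} (hP : 2 ≤ P.length)
    (hCt : ∀ C ∈ Ct, 2 ≤ C.length) (hCu : ∀ C ∈ Cu, 3 ≤ C.length) (hE : ∀ C ∈ E, 2 ≤ C.length)
    (hEs : ∀ C ∈ E, steps C = {gap C})
    (hV : (P : Multiset ℤ) + ((Ct ++ E).flatten ++ Cu.flatten : List ℤ) = iv 0 n)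
    (hD : steps P + ((Ct.map fun C => steps C + {gap C}).sum +
      (Cu.map fun C => steps C + {gap C}).sum + (E.map fun C => {gap C} + {(n : ℤ) - gap C}).sum) =
        iv 1 n)
    (hlt : ∀ v ∈ (Ct.map fun C => steps C + {gap C}).sum +
      (Cu.map fun C => steps C + {gap C}).sum, 2 * v < n) :
    ∃ P' : List (ZMod (2 * n)), P'.length = P.length ∧
      HalfSystem n P' ((Ct ++ E).map (castList n)) (Cu.map (castList n)) := by
  classical
  set T : Finset ℤ := (Ct.map fun C => (n : ℤ) - gap C).toFinset with hT
  have hVm : ∀ x : ℤ, 0 ≤ x → x < n → x ∈ P ∨ x ∈ (Ct ++ E).flatten ∨ x ∈ Cu.flatten := by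
    intro x h0 hn
    have : x ∈ iv 0 (n : ℤ) := mem_iv.2 ⟨h0, hn⟩
    rw [← hV] at this
    simpa only [Multiset.mem_add, Multiset.mem_coe, List.mem_append] using this
  refine ⟨liftPath n T 0 P, liftPath_length _ _ _, ?_, ?_, ?_, ?_, ?_, ?_⟩
  · rwa [liftPath_length]
  · intro _ hm
    obtain ⟨C, hC, rfl⟩ := List.mem_map.1 hm
    rw [length_castList]
    rcases List.mem_append.1 hC with h | h
    · exact hCt C h
    · exact hE C h
  · intro _ hm
    obtain ⟨C, hC, rfl⟩ := List.mem_map.1 hm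
    rw [length_castList]
    exact hCu C hC
  · have h1 := congrArg Multiset.card hV
    have h2 := card_iv (a := 0) (b := n) (by omega)
    rw [← h1, Multiset.card_add, Multiset.coe_card, Multiset.coe_card] at h2
    rw [flatten_castList, flatten_castList, length_castList, length_castList, liftPath_length]
    have h3 : ((Ct ++ E).flatten ++ Cu.flatten : List ℤ).length =
      (Ct ++ E).flatten.length + Cu.flatten.length := List.length_append
    rw [h3] at h2
    omega
  · intro z
    have hz : ∀ x : ℤ, 0 ≤ x → x < n → ∀ L : List (ZMod (2 * n)),
        L = liftPath n T 0 P ++ (((Ct ++ E).map (castList n)).flatten ++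
          (Cu.map (castList n)).flatten) →
        (x : ZMod (2 * n)) ∈ L ∨ (x : ZMod (2 * n)) + n ∈ L := by
      rintro x h0 hn L rfl
      rw [flatten_castList, flatten_castList]
      have hc : ∀ l : List ℤ, x ∈ l → (x : ZMod (2 * n)) ∈ castList n l :=
        fun l hl => List.mem_map.2 ⟨x, hl, rfl⟩
      simp only [List.mem_append]
      rcases hVm x h0 hn with h | h | h
      · exact (mem_liftPath P (Or.inl rfl) h).imp Or.inl Or.inl
      · exact Or.inl (Or.inr (Or.inl (hc _ h)))
      · exact Or.inl (Or.inr (Or.inr (hc _ h)))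
    have hn : 0 < n := by
      have h1 := congrArg Multiset.card hV
      have h2 := card_iv (a := 0) (b := n) (by omega)
      rw [← h1, Multiset.card_add, Multiset.coe_card, Multiset.coe_card] at h2
      omega
    obtain ⟨x, hx, rfl | rfl⟩ := exists_natCast_or hn z
    · simpa using hz x (by omega) (by omega) _ rfl
    · rw [add_assoc, half_add_half, add_zero]
      simpa using (hz x (by omega) (by omega) _ rfl).symm
  · intro H hHP hHt hHu d hd hdn
    have htwist : ∀ C ∈ Ct ++ E, Occurs H (n - gap C) := by
      intro C hC
      have hC' := hHt _ (List.mem_map.2 ⟨C, hC, rfl⟩)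
      have hne : castList n C ≠ [] := by
        intro h
        have h2 : 2 ≤ C.length := by
          rcases List.mem_append.1 hC with h | h
          · exact hCt C h
          · exact hE C h
        have := congrArg List.length h
        rw [length_castList, List.length_nil] at this
        omega
      obtain ⟨a, ha⟩ : ∃ a, (castList n C).head? = some a :=
        ⟨_, List.head?_eq_some_head hne⟩
      obtain ⟨b, hb⟩ : ∃ b, (castList n C).getLast? = some b :=
        ⟨_, List.getLast?_eq_some_getLast hne⟩
      have hadj := hC'.2 a ha b hb
      refine Occurs.of_adj hadj ?_
      have h2 := half_add_half (n := n)
      rw [castList_head ha, castList_getLast hb]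
      rcases cast_abs_sub (n := n) (C.headD 0) (C.getLastD 0) with h3 | h3
      · right
        rw [gap]
        push_cast at h3 ⊢
        linear_combination -h3 - h2
      · left
        rw [gap]
        push_cast at h3 ⊢
        linear_combination -h3
    have hsteps : ∀ C, (castList n C).IsChain H.Adj → ∀ v ∈ steps C, Occurs H v :=
      fun C hC => Occurs.of_castList hC
    have huntw : ∀ C ∈ Cu, ∀ v ∈ steps C + {gap C}, Occurs H v := by
      intro C hC v hv
      have hC' := hHu _ (List.mem_map.2 ⟨C, hC, rfl⟩)
      have hne : castList n C ≠ [] := by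
        intro h
        have h2 := hCu C hC
        have := congrArg List.length h
        rw [length_castList, List.length_nil] at this
        omega
      obtain ⟨b, hb⟩ : ∃ b, (castList n C).getLast? = some b :=
        ⟨_, List.getLast?_eq_some_getLast hne⟩
      obtain ⟨a, ha⟩ : ∃ a, (castList n C).head? = some a :=
        ⟨_, List.head?_eq_some_head hne⟩
      have h1 := (closedChain_iff hb).1 hC'
      rw [List.isChain_cons] at h1
      rcases Multiset.mem_add.1 hv with hv | hv
      · exact hsteps C h1.2 v hv
      · rw [Multiset.mem_singleton.1 hv]
        refine Occurs.of_adj (h1.1 a ha) ?_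
        rw [castList_head ha, castList_getLast hb]
        exact cast_abs_sub _ _
    have hTmem : ∀ {v : ℤ}, v ∈ T ↔ ∃ C ∈ Ct, (n : ℤ) - gap C = v := by
      intro v
      rw [hT, List.mem_toFinset, List.mem_map]
    suffices h : Occurs H (d : ℤ) by
      obtain ⟨u, hu⟩ := h
      exact ⟨u, by simpa using hu⟩
    have hmem : (d : ℤ) ∈ iv 1 (n : ℤ) := mem_iv.2 ⟨by omega, by omega⟩
    have hnd := nodup_iv 1 (n : ℤ)
    rw [← hD] at hmem
    simp only [Multiset.mem_add] at hmem
    rcases hmem with h | (h | h) | h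
    · by_cases hdT : (d : ℤ) ∈ T
      · obtain ⟨C, hC, hg⟩ := hTmem.1 hdT
        rw [← hg]
        exact htwist C (List.mem_append_left _ hC)
      · have := Occurs.of_liftPath hHP _ h
        rwa [if_neg hdT] at this
    · obtain ⟨C, hC, hv⟩ := mem_sum_map.1 h
      rcases Multiset.mem_add.1 hv with hv | hv
      · exact hsteps C (hHt _ (List.mem_map.2 ⟨C, List.mem_append_left _ hC, rfl⟩)).1 _ hv
      · -- The path supplies the gap `d` because `n - d` is none of the other differences.
        rw [Multiset.mem_singleton] at hv
        have h1 : (n : ℤ) - d ∈ iv 1 (n : ℤ) := mem_iv.2 ⟨by omega, by omega⟩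
        rw [← hD] at h1 hnd
        have h2 : (n : ℤ) - d ∈ steps P := by
          rcases Multiset.mem_add.1 h1 with h1 | h1
          · exact h1
          · exfalso
            have hd2 := hlt d (Multiset.mem_add.2 (Or.inl h))
            rcases Multiset.mem_add.1 h1 with h1 | h1
            · have := hlt _ h1
              omega
            · obtain ⟨C', hC', h3⟩ := mem_sum_map.1 h1
              have h4 : (d : ℤ) ∈ (E.map fun C => ({gap C} + {(n : ℤ) - gap C} : Multiset ℤ)).sum := by
                refine mem_sum_map.2 ⟨C', hC', ?_⟩
                simp only [Multiset.mem_add, Multiset.mem_singleton] at h3 ⊢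
                omega
              have hdis := (Multiset.nodup_add.1 (Multiset.nodup_add.1 hnd).2.1).2.2
              exact Multiset.disjoint_left.1 hdis (Multiset.mem_add.2 (Or.inl h)) h4
        have h3 := Occurs.of_liftPath hHP _ h2
        rw [if_pos (hTmem.2 ⟨C, hC, by rw [hv]⟩), sub_sub_cancel] at h3
        exact h3
    · obtain ⟨C, hC, hv⟩ := mem_sum_map.1 h
      exact huntw C hC _ hv
    · obtain ⟨C, hC, hv⟩ := mem_sum_map.1 h
      rcases Multiset.mem_add.1 hv with hv | hv
      · rw [← hEs C hC] at hv
        exact hsteps C (hHt _ (List.mem_map.2 ⟨C, List.mem_append_right _ hC, rfl⟩)).1 _ hv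
      · rw [Multiset.mem_singleton.1 hv]
        exact htwist C (List.mem_append_right _ hC)

end Lifting

/-! ### Existence of solutions -/

/-- A half system from a labelling of a path, of cycles of the lengths in `Lt` and `Lu`, which are
to be joined to their translates and to be closed respectively, and of the single edges in `E`. -/
lemma exists_halfSystem_of_core {n m : ℕ} {k t : ℤ} {V D : Multiset ℤ} {Lt Lu : List ℕ}
    {E : List (List ℤ)} (hc : Core n k (V + (E.flatten : Multiset ℤ))
      (D + (E.map fun C => ({gap C} + {(n : ℤ) - gap C} : Multiset ℤ)).sum))
    (hr : Rest Any t (Lt ++ Lu) V D) (ht : 2 * t ≤ n) (hE : ∀ C ∈ E, 2 ≤ C.length)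
    (hEs : ∀ C ∈ E, steps C = {gap C}) (hLt : ∀ l ∈ Lt, 2 ≤ l) (hLu : ∀ l ∈ Lu, 3 ≤ l)
    (hm : 2 ≤ m) (hn : m + ((Lt ++ E.map List.length).sum + Lu.sum) = n) :
    ∃ P Ct Cu, HalfSystem n P Ct Cu ∧ P.length = m ∧
      Ct.map List.length = Lt ++ E.map List.length ∧ Cu.map List.length = Lu := by
  obtain ⟨e, _, _, ⟨P, -, -, -, rfl, rfl⟩, hV, hD⟩ := hc
  obtain ⟨Cs, hCs, rfl, rfl, hlt⟩ := hr.exists_lists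
  obtain ⟨Ct, Cu, rfl, rfl, rfl⟩ := List.map_eq_append_iff.1 hCs
  have hlen : P.length = m := by
    have h1 := congrArg Multiset.card hV
    have h2 := card_iv (a := 0) (b := n) (by omega)
    rw [← h1] at h2
    simp only [Multiset.card_add, Multiset.coe_card, List.length_flatten, List.map_append,
      List.sum_append] at h2 hn
    omega
  have hmap : ∀ Cs : List (List ℤ), (Cs.map (castList n)).map List.length = Cs.map List.length := by
    intro Cs
    rw [List.map_map]
    exact List.map_congr_left fun C _ => length_castList C
  have key := HalfSystem.of_lists (n := n) (P := P) (Ct := Ct) (Cu := Cu) (E := E)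
    (by omega) (fun C hC => hLt _ (List.mem_map.2 ⟨C, hC, rfl⟩))
    (fun C hC => hLu _ (List.mem_map.2 ⟨C, hC, rfl⟩)) hE hEs ?_ ?_ ?_
  · obtain ⟨P', hP', hs⟩ := key
    exact ⟨P', _, _, hs, hP'.trans hlen, by rw [hmap, List.map_append], hmap _⟩
  · rw [← hV, List.flatten_append, List.flatten_append]
    simp only [← Multiset.coe_add]
    rw [add_right_comm]
  · rw [← hD, List.map_append, List.sum_append]
  · intro v hv
    rw [List.map_append, List.sum_append] at hlt
    have := hlt v hv
    omega

lemma Grace.exists_halfSystem {n m : ℕ} {k t : ℤ} {Lt Lu : List ℕ} (h : Grace (Lt ++ Lu) n t k)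
    (ht : 2 * t ≤ n) (hLt : ∀ l ∈ Lt, 2 ≤ l) (hLu : ∀ l ∈ Lu, 3 ≤ l)
    (hm : 2 ≤ m) (hn : m + (Lt.sum + Lu.sum) = n) :
    ∃ P Ct Cu, HalfSystem n P Ct Cu ∧ P.length = m ∧
      Ct.map List.length = Lt ∧ Cu.map List.length = Lu := by
  obtain ⟨V, D, hc, hr⟩ := h
  obtain ⟨P, Ct, Cu, h1, h2, h3, h4⟩ := exists_halfSystem_of_core (E := []) (by simpa using hc) hr ht
    (by simp) (by simp) hLt hLu hm (by simpa using hn)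
  exact ⟨P, Ct, Cu, h1, h2, by simpa using h3, h4⟩

lemma GraceEdge.exists_halfSystem {n m : ℕ} {t : ℤ} {Lt Lu : List ℕ} (h : GraceEdge (Lt ++ Lu) n t)
    (ht : 2 * t ≤ n) (hLt : ∀ l ∈ Lt, 2 ≤ l) (hLu : ∀ l ∈ Lu, 3 ≤ l)
    (hm : 2 ≤ m) (hn : m + ((Lt ++ [2]).sum + Lu.sum) = n) :
    ∃ P Ct Cu, HalfSystem n P Ct Cu ∧ P.length = m ∧
      Ct.map List.length = Lt ++ [2] ∧ Cu.map List.length = Lu := by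
  obtain ⟨k, V, D, x, d, hc, hr, hd, hdn⟩ := h
  have hg : gap [x, x + d] = d := by
    simp [gap, abs_of_pos hd]
  obtain ⟨P, Ct, Cu, h1, h2, h3, h4⟩ := exists_halfSystem_of_core (E := [[x, x + d]])
    (by simpa [hg, ← Multiset.cons_coe] using hc) hr ht (by simp) (by simp [hg, steps_cons, abs_of_pos hd]) hLt hLu hm
    (by simpa using hn)
  exact ⟨P, Ct, Cu, h1, h2, by simpa using h3, h4⟩

lemma card_cycleUnion {V : Type*} [Fintype V] {F : SimpleGraph V} {M : List ℕ}
    (hF : Nonempty (F ≃g cycleUnion M.get)) : Fintype.card V = M.sum := by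
  obtain ⟨φ⟩ := hF
  rw [Fintype.card_congr φ.toEquiv, Fintype.card_sigma]
  simp only [Fintype.card_fin]
  exact Fin.sum_univ_getElem M

/-- Half systems with a path of prescribed length `m`, if `m` is large.  The lengths in `Lt` and
`Ltwo` are those of the lists to be joined to their translates, and at most one of them is `2`. -/
lemma exists_halfSystem {n m : ℕ} {lam X mu Z W : ℤ} {Le Lo Lt Lu Ltwo : List ℕ}
    (hLo : ∀ l ∈ Lo, Odd l ∧ 3 ≤ l ∧ (l : ℤ) ≤ lam)
    (hX : Lo ≠ [] → 3 ≤ lam ∧ X = 7 ^ (Lo.length - 1) * (2 * lam + 1))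
    (hLe : ∀ l ∈ Le, Even l ∧ 4 ≤ l ∧ (l : ℤ) ≤ mu) (hmu : 0 ≤ mu)
    (hZ : Z = Le.length * (mu + 3)) (hW : W = max 1 (2 * Z - 1))
    (htwo : Ltwo = [] ∧ 10 * max 3 X + 8 * W + 14 + mu ≤ n ∨
      Ltwo = [2] ∧ 10 * max 3 (7 * X) + 8 * W + 14 + mu ≤ n)
    (hperm : (Le ++ Lo).Perm (Lt ++ Lu)) (hm : 2 ≤ m)
    (hn : m + ((Lt ++ Ltwo).sum + Lu.sum) = n) :
    ∃ P Ct Cu, HalfSystem n P Ct Cu ∧ P.length = m ∧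
      Ct.map List.length = Lt ++ Ltwo ∧ Cu.map List.length = Lu := by
  have h3 : ∀ l ∈ Lt ++ Lu, 3 ≤ l := by
    intro l hl
    rcases List.mem_append.1 (hperm.mem_iff.2 hl) with h | h
    · have := (hLe l h).2.1
      omega
    · exact (hLo l h).2.1
  have hLt : ∀ l ∈ Lt, 2 ≤ l := fun l hl => by
    have := h3 l (List.mem_append_left _ hl)
    omega
  have hLu : ∀ l ∈ Lu, 3 ≤ l := fun l hl => h3 l (List.mem_append_right _ hl)
  rcases htwo with ⟨rfl, hb⟩ | ⟨rfl, hb⟩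
  · obtain ⟨t, k, hg, ht⟩ := Grace.exists hLo hX hLe hmu hZ hW hb
    rw [List.append_nil] at hn ⊢
    exact (hg.perm hperm).exists_halfSystem ht hLt hLu hm hn
  · obtain ⟨t, ⟨k, V, D, x, d, hc, hr, hd⟩, ht⟩ := GraceEdge.exists hLo hX hLe hmu hZ hW hb
    exact GraceEdge.exists_halfSystem ⟨k, V, D, x, d, hc, hr.perm hperm, hd⟩ ht hLt hLu hm hn

theorem theorem1p2 (h r s : ℕ) (ℓ : ℕ → ℕ) (hrs : r ≤ s)
    (hℓ : ∀ i ∈ Finset.Icc 1 r, 2 ≤ ℓ i)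
    (hmono : ∀ i ∈ Finset.Icc 1 r, ∀ j ∈ Finset.Icc 1 r, i < j → ℓ i < ℓ j)
    (hh : 3 ≤ h) (hℓ' : ∀ i ∈ Finset.Icc (r + 1) s, 3 ≤ ℓ i)
    (hbound : (h : ℤ) > 16 * max 1 (boundEven s ℓ) + 20 * max 3 (boundOdd s ℓ) + 29)
    {V : Type*} [Fintype V] (F : SimpleGraph V)
    (hF : IsCycleGraphOf F (singleFlipLengths h r s ℓ))
    (σ : ℤ) (hσ : σ = -1 ∨ σ = 0 ∨ σ = 1) (hpar : (Fintype.card V : ℤ) - 1 ≡ σ [ZMOD 2]) :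
    ∃ S : Finset (SimpleGraph V),
      IsOPSolution σ F S ∧ IsPyramidal (1 - σ).toNat S := by
  obtain ⟨M, hM, hiso⟩ := hF
  -- `Two` has at most one member, and `Tw ∪ U = I ∪ O` consists of the `i` with `ℓ i ≠ 2`.
  set I := evenIndices s ℓ with hI
  set O : Finset ℕ := {i ∈ Finset.Icc 1 s | i ∉ I ∧ ℓ i ≠ 2} with hO
  set Tw : Finset ℕ := {i ∈ Finset.Icc 1 r | ℓ i ≠ 2} with hTw
  set U : Finset ℕ := Finset.Icc (r + 1) s with hU
  set Two : Finset ℕ := {i ∈ Finset.Icc 1 r | ℓ i = 2} with hTwo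
  have hmemI : ∀ i, i ∈ I ↔ (1 ≤ i ∧ i ≤ s) ∧ 2 < ℓ i ∧ Even (ℓ i) := by
    simp [hI, evenIndices]
  have hmemO : ∀ i, i ∈ O ↔ (1 ≤ i ∧ i ≤ s) ∧ i ∉ I ∧ ℓ i ≠ 2 := by
    simp [hO]
  have h2 : ∀ i, 1 ≤ i → i ≤ s → 2 ≤ ℓ i := by
    intro i h1 hs
    rcases le_or_gt i r with hr | hr
    · exact hℓ i (Finset.mem_Icc.2 ⟨h1, hr⟩)
    · have := hℓ' i (Finset.mem_Icc.2 ⟨hr, hs⟩)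
      omega
  have hOodd : ∀ i ∈ O, Odd (ℓ i) ∧ 3 ≤ ℓ i := by
    intro i hi
    obtain ⟨⟨h1, hs⟩, hiI, hne⟩ := (hmemO i).1 hi
    have := h2 i h1 hs
    have h3 : 2 < ℓ i := by omega
    refine ⟨?_, h3⟩
    rw [← Nat.not_even_iff_odd]
    exact fun he => hiI ((hmemI i).2 ⟨⟨h1, hs⟩, h3, he⟩)
  have hdisj : Disjoint I O := Finset.disjoint_right.2 fun i hi => ((hmemO i).1 hi).2.1
  have hTU : Disjoint Tw U := by
    rw [Finset.disjoint_left]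
    intro i hi hi'
    simp only [hTw, hU, Finset.mem_filter, Finset.mem_Icc] at hi hi'
    omega
  have hunion : I.disjUnion O hdisj = Tw.disjUnion U hTU := by
    ext i
    simp only [Finset.mem_disjUnion, hmemO, hTw, hU, Finset.mem_filter, Finset.mem_Icc]
    constructor
    · intro hi
      have h1 : (1 ≤ i ∧ i ≤ s) ∧ ℓ i ≠ 2 := by
        rcases hi with hi | hi
        · have := (hmemI i).1 hi
          exact ⟨this.1, by omega⟩
        · exact ⟨hi.1, hi.2.2⟩
      rcases le_or_gt i r with hr | hr
      · exact Or.inl ⟨⟨h1.1.1, hr⟩, h1.2⟩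
      · exact Or.inr ⟨hr, h1.1.2⟩
    · intro hi
      by_cases hiI : i ∈ I
      · exact Or.inl hiI
      · refine Or.inr ⟨?_, hiI, ?_⟩
        · omega
        · rcases hi with hi | hi
          · exact hi.2
          · have := hℓ' i (Finset.mem_Icc.2 hi)
            omega
  have hTwoTw : Disjoint Tw Two := by
    rw [Finset.disjoint_left]
    intro i hi hi'
    simp only [hTw, hTwo, Finset.mem_filter] at hi hi'
    exact hi.2 hi'.2
  have hIcc : Tw.disjUnion Two hTwoTw = Finset.Icc 1 r := by
    ext i
    simp only [Finset.mem_disjUnion, hTw, hTwo, Finset.mem_filter]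
    tauto
  have hTwo1 : Two.card ≤ 1 := by
    rw [Finset.card_le_one]
    intro i hi j hj
    simp only [hTwo, Finset.mem_filter] at hi hj
    by_contra hne
    rcases lt_or_gt_of_ne hne with hlt | hlt
    · have := hmono i hi.1 j hj.1 hlt
      omega
    · have := hmono j hj.1 i hi.1 hlt
      omega
  have hcard : I.card + O.card + Two.card = s := by
    have h1 := congrArg Finset.card hunion
    have h3 := congrArg Finset.card hIcc
    simp only [Finset.card_disjUnion, Nat.card_Icc, hU] at h1 h3
    omega
  have hperm : (I.toList.map ℓ ++ O.toList.map ℓ).Perm (Tw.toList.map ℓ ++ U.toList.map ℓ) := by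
    rw [← Multiset.coe_eq_coe]
    simp only [← Multiset.coe_add, ← Multiset.map_coe, Finset.coe_toList]
    rw [← Multiset.map_add, ← Multiset.map_add]
    exact congrArg (fun A : Finset ℕ => A.val.map ℓ) hunion
  have hsumtw : (Tw.toList.map ℓ).sum = ∑ i ∈ Tw, ℓ i := Finset.sum_map_toList _ _
  have hsumtwo : (Two.toList.map ℓ).sum = ∑ i ∈ Two, ℓ i := Finset.sum_map_toList _ _
  have hsumu : (U.toList.map ℓ).sum = ∑ i ∈ U, ℓ i := Finset.sum_map_toList _ _
  -- The order of `F` is `h` plus twice the sum of the `ℓ i`.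
  have hV : Fintype.card V = h + 2 * ((∑ i ∈ Tw, ℓ i + ∑ i ∈ Two, ℓ i) + ∑ i ∈ U, ℓ i) := by
    rw [card_cycleUnion hiso, ← Multiset.sum_coe, hM, singleFlipLengths, ← hIcc]
    rw [Multiset.sum_add, Multiset.sum_add, Multiset.sum_singleton, Multiset.sum_nsmul,
      show ((Tw.disjUnion Two hTwoTw).val.map fun i => 2 * ℓ i).sum =
        ∑ i ∈ Tw.disjUnion Two hTwoTw, 2 * ℓ i from rfl,
      show (Multiset.map ℓ U.val).sum = ∑ i ∈ U, ℓ i from rfl, Finset.sum_disjUnion,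
      ← Finset.mul_sum, ← Finset.mul_sum, smul_eq_mul]
    ring
  -- `f` is the number of fixed points and `m` the number of vertices of the path.
  obtain ⟨f, hf⟩ : ∃ f : ℕ, (f : ℤ) = 1 - σ := ⟨(1 - σ).toNat, by omega⟩
  obtain ⟨m, hm⟩ : ∃ m : ℕ, h = 2 * m + f := by
    have hp := hpar.dvd
    refine ⟨(h - f) / 2, ?_⟩
    rw [hV] at hp
    push_cast at hp
    omega
  set n := m + ((Tw.toList.map ℓ ++ Two.toList.map ℓ).sum + (U.toList.map ℓ).sum) with hn
  have hnsum : n = m + ((∑ i ∈ Tw, ℓ i + ∑ i ∈ Two, ℓ i) + ∑ i ∈ U, ℓ i) := by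
    rw [hn, List.sum_append, hsumtw, hsumtwo, hsumu]
  have hIsum : ∑ i ∈ I, ℓ i ≤ ∑ i ∈ Tw, ℓ i + ∑ i ∈ U, ℓ i := by
    rw [← Finset.sum_disjUnion hTU, ← hunion, Finset.sum_disjUnion]
    omega
  obtain ⟨mu, hmu0, hmu, hmuI, hZ⟩ : ∃ mu : ℕ, 0 ≤ mu ∧ (∀ i ∈ I, ℓ i ≤ mu) ∧
      mu ≤ ∑ i ∈ I, ℓ i ∧ I.card * I.sup (fun i => ℓ i + 3) = I.card * (mu + 3) := by
    rcases I.eq_empty_or_nonempty with h0 | h0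
    · exact ⟨0, by simp [h0]⟩
    · obtain ⟨i, hi, hs⟩ := Finset.exists_mem_eq_sup I h0 (fun i => ℓ i + 3)
      refine ⟨ℓ i, by omega, fun j hj => ?_, Finset.single_le_sum (f := ℓ) (by simp) hi, by rw [hs]⟩
      have := Finset.le_sup (f := fun i => ℓ i + 3) hj
      rw [hs] at this
      simpa using this
  obtain ⟨lam, hlam, hlamO⟩ : ∃ lam : ℕ, (∀ i ∈ O, ℓ i ≤ lam) ∧ (O.Nonempty →
      3 ≤ lam ∧ O.sup (fun i => 2 * ℓ i + 1) = 2 * lam + 1) := by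
    rcases O.eq_empty_or_nonempty with h0 | h0
    · exact ⟨0, by simp [h0]⟩
    · obtain ⟨i, hi, hs⟩ := Finset.exists_mem_eq_sup O h0 (fun i => 2 * ℓ i + 1)
      refine ⟨ℓ i, fun j hj => ?_, fun _ => ⟨(hOodd i hi).2, hs⟩⟩
      have := Finset.le_sup (f := fun i => 2 * ℓ i + 1) hj
      rw [hs] at this
      omega
  have hEven : boundEven s ℓ = 2 * (I.card * (mu + 3) : ℤ) - 1 := by
    rw [boundEven, ← hI, mul_assoc]
    congr 2
    exact_mod_cast hZ
  have hOdd : boundOdd s ℓ = 7 ^ (s - I.card - 1) * (O.sup (fun i => 2 * ℓ i + 1) : ℕ) := rfl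
  have htwo : ∃ X : ℤ, (O.Nonempty → X = 7 ^ (O.card - 1) * (2 * lam + 1)) ∧
      (Two.toList.map ℓ = [] ∧ boundOdd s ℓ = X ∨
        Two.toList.map ℓ = [2] ∧ boundOdd s ℓ = 7 * X) := by
    rcases O.eq_empty_or_nonempty with h0 | h0
    · have hz : boundOdd s ℓ = 0 := by rw [hOdd, h0]; simp
      refine ⟨0, fun h => absurd h0 h.ne_empty, ?_⟩
      rcases Nat.le_one_iff_eq_zero_or_eq_one.1 hTwo1 with h1 | h1
      · exact Or.inl ⟨by rw [Finset.card_eq_zero.1 h1]; simp, hz⟩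
      · obtain ⟨i, hi⟩ := Finset.card_eq_one.1 h1
        have : i ∈ Two := by rw [hi]; simp
        refine Or.inr ⟨?_, by rw [hz]; rfl⟩
        rw [hi]
        simpa using (Finset.mem_filter.1 this).2
    · refine ⟨7 ^ (O.card - 1) * (2 * lam + 1), fun _ => rfl, ?_⟩
      rw [hOdd, (hlamO h0).2]
      have hpos := h0.card_pos
      rcases Nat.le_one_iff_eq_zero_or_eq_one.1 hTwo1 with h1 | h1
      · refine Or.inl ⟨by rw [Finset.card_eq_zero.1 h1]; simp, ?_⟩
        rw [show s - I.card - 1 = O.card - 1 by omega]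
        push_cast
        rfl
      · obtain ⟨i, hi⟩ := Finset.card_eq_one.1 h1
        have : i ∈ Two := by rw [hi]; simp
        refine Or.inr ⟨?_, ?_⟩
        · rw [hi]
          simpa using (Finset.mem_filter.1 this).2
        · rw [show s - I.card - 1 = (O.card - 1) + 1 by omega, pow_succ]
          push_cast
          ring
  obtain ⟨X, hX, htwo⟩ := htwo
  have hmn : 10 * max 3 (boundOdd s ℓ) + 8 * max 1 (boundEven s ℓ) + 14 + mu ≤ (n : ℤ) := by
    omega
  have key := exists_halfSystem (n := n) (m := m) (lam := lam) (X := X)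
    (mu := mu) (Z := I.card * (mu + 3)) (W := max 1 (boundEven s ℓ)) (Le := I.toList.map ℓ)
    (Lo := O.toList.map ℓ) (Lt := Tw.toList.map ℓ) (Lu := U.toList.map ℓ)
    (Ltwo := Two.toList.map ℓ) ?_ ?_ ?_ (by omega) ?_ ?_ ?_ hperm (by omega) hn.symm
  · obtain ⟨P, Ct, Cu, hs, hPm, hCt, hCu⟩ := key
    have hf' : f = (1 - σ).toNat := by omega
    rw [← hf']
    refine hs.exists_solution hσ hf hiso ?_
    have hCt2 : (Ct.map fun C => 2 * C.length) = (Ct.map List.length).map fun x => 2 * x := by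
      rw [List.map_map]
      rfl
    rw [hM, singleFlipLengths, hPm, ← hm, hCt2, hCt, hCu, ← hIcc, ← List.map_append, List.map_map]
    congr 1
    · congr 1
      simp only [← Multiset.map_coe, ← Multiset.coe_add, Finset.coe_toList]
      rfl
    · rw [← Multiset.map_coe, Finset.coe_toList]
  · intro l hl
    obtain ⟨i, hi, rfl⟩ := List.mem_map.1 hl
    rw [Finset.mem_toList] at hi
    exact ⟨(hOodd i hi).1, (hOodd i hi).2, by exact_mod_cast hlam i hi⟩
  · intro hne
    have h0 : O.Nonempty := by
      rw [Finset.nonempty_iff_ne_empty]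
      rintro h0
      exact hne (by rw [h0]; simp)
    refine ⟨by exact_mod_cast (hlamO h0).1, ?_⟩
    rw [List.length_map, Finset.length_toList]
    exact hX h0
  · intro l hl
    obtain ⟨i, hi, rfl⟩ := List.mem_map.1 hl
    rw [Finset.mem_toList] at hi
    obtain ⟨-, h3, he⟩ := (hmemI i).1 hi
    refine ⟨he, ?_, by exact_mod_cast hmu i hi⟩
    obtain ⟨c, hc⟩ := he
    omega
  · rw [List.length_map, Finset.length_toList]
  · rw [hEven]
  · rcases htwo with ⟨h1, h3⟩ | ⟨h1, h3⟩
    · exact Or.inl ⟨h1, by rw [← h3]; exact hmn⟩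
    · exact Or.inr ⟨h1, by rw [← h3]; exact hmn⟩
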